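/- **Setting.** Let $K=\mathbb{Q}(\alpha)$ be a number field, $\alpha$ a root of a monic irreducible $f\in\mathbb{Z}[t]$ of degree $n$. Let $\mathcal{O}$ be an order with $\mathbb{Z}[\alpha]\subseteq\mathcal{O}\subseteq\mathcal{O}_K$, given by a $\mathbb{Z}$-basis $\omega_1,\dots,\omega_n$ and the two matrices that relate $(\omega_i)$ and $(\alpha^{i-1})$, and let $f_0\ge 1$ be an integer with $f_0\mathcal{O}_K\subseteq\mathcal{O}$. For $x\in K$ let $\|\Sigma(x)\|_\infty$ be the largest absolute value of a conjugate of $x$. Let $\mathsf{C}$ be an integer that is at least $\max_j\sum_i|m_{ij}|$, where $(m_{ij})$ is the inverse of the matrix $(\sigma_j(\omega_i))_{i,j}$ and $\sigma_1,\dots,\sigma_n$ are the embeddings $K\to\mathbb{C}$. **Input.** An odd prime power $e=\ell^m$ ($m\ge1$); non-zero $u_1,\dots,u_r\in\mathcal{O}$ ($r\ge 1$), given by their integer coordinates on $(\omega_i)$, with integers $b_i\ge\|\Sigma(u_i)\|_\infty$; and exponents $0\le a_i<e$ such that $y=\prod_i u_i^{a_i}$ is an $e$-th power in $K$. **Good primes.**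 An odd prime $q$ is good if $f$ is squarefree modulo $q$ (equivalently, $q$ is unramified in $K$ and does not divide $[\mathcal{O}_K:\mathbb{Z}[\alpha]]$) and $$(*)\qquad q^{f_{\mathfrak q}}\not\equiv 1 \bmod \ell\quad\text{for all primes } \mathfrak q\mid q \text{ of } \mathcal{O}_K,$$ where $f_{\mathfrak q}$ is the residue degree. **Algorithm (Double CRT).** 1. Compute $B=f_0\,\mathsf{C}\prod_i b_i$. 2. Choose distinct good primes $q_1,\dots,q_k$ with $Q=\prod_j q_j>2B$. 3. Reduce all coordinates of all $u_i$ modulo all $q_j$, with a product tree. 4. For each $j$: factor $f$ modulo $q_j$ by the Cantor–Zassenhaus algorithm (distinct-degree, then randomised equal-degree factorisation). For every irreducible factor $h$, reduce the $u_i$ modulo $h$, compute $y_h=\prod_i u_i^{a_i}$ in $\mathbb{F}_{q_j}[t]/(h)$ with exponents reduced modulo $q_j^{\deg h}-1$ (positive exponents staying positive), and $x_h=y_h^{d}$ with $d=e^{-1}\bmod (q_j^{\deg h}-1)$. Recombine the $x_h$ by the CRT in $\mathbb{F}_{q_j}[t]/(f)$, multiply by $f_0$, and write the result on the basis $(\omega_i)$.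 5. Recombine coordinate by coordinate by the CRT over $\mathbb{Z}$ (product tree), with representatives of least absolute value modulo $Q$; divide the element of $\mathcal{O}$ so obtained by $f_0$ and return it. **Cost model.** Time is the number of word operations spent on arithmetic, except that the choice of the primes in step 2 is not counted. The length of an integer is its number of binary digits. A product of two integers of length $\le s$ costs $M_{\mathbb Z}(s)$, and a product of two polynomials with at most $d$ coefficients modulo an integer of length $s$ costs $M(d,s)$. Additions are linear. A division with remainder costs one product of the size of the divisor for each block of that size in the dividend. A modular inverse of integers of length $\le s$ costs $M_{\mathbb Z}(s)\log s$, and a gcd or modular inverse of polynomials with at most $d$ coefficients costs $M(d,s)(\log d+\log s)$. Drawing a random polynomial of degree $<n$ modulo $q$ costs $n\log q$. For constants $c,\varepsilon>0$ the prices satisfy $$M_{\mathbb Z}(s)\ge s,\quad M_{\mathbb Z}(s)+M_{\mathbb Z}(t)\le M_{\mathbb Z}(s+t),\quad M_{\mathbb Z}(s)\le c\,s\log^{1+\varepsilon}s,$$ $$M(d,s)\ge ds,\quad M(d,s)+M(d',s)\le M(d+d',s),\quad M(2d,s)\le c\,M(d,s),$$ and $M(d,s)$ is non-decreasing in $s$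 (inside the prices, $\log s$ stands for $1+\lfloor\log_2 s\rfloor$). **Proposition.** For all $\varepsilon>0$ and $c$ there is a constant $C$, depending only on $\varepsilon$ and $c$, such that for all $K$, $\alpha$, $(\omega_i)$, $f_0$, $\mathsf{C}$ as above there is a constant $s_0\ge1$, depending only on these data and on $\varepsilon$, $c$, with the following property. For all prices as above and every input, put $$s=s_0+\sum_{i=1}^r\bigl(1+\log_2\|\Sigma(u_i)\|_\infty\bigr)$$ (the total input size). Let $q_1,\dots,q_k$ be distinct good primes with $\prod_jq_j>2B$, let $\kappa$ be the largest binary length of the $q_j$, and suppose that $k\kappa\le c\,s$ (the primes are chosen evenly, of total length $O(s)$). Then: * *(correctness)* every output $x$ of the Double CRT algorithm satisfies $x^e=y$, and the algorithm terminates with probability $1$: the probability that at most $N$ random draws for each prime suffice tends to $1$ as $N\to\infty$; * *(complexity)* its expected running time is at most $$C\cdot r\,n\,s\,\bigl(M(n,\kappa)+\log^{2+\varepsilon}s+\log e\bigr);$$ more precisely, for every $N$ this bounds the expected running time of the algorithm stopped when a prime would need more than $N$ draws. -/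

import Mathlib

open Polynomial NumberField

noncomputable section

namespace CrtRoot

/-! ## Timed computations

A timed computation is a result together with the number of word operations spent on it.  All
arithmetic on data goes through the priced operations below; sequencing adds the times. -/

structure Timed (α : Type) where
  val : α
  time : ℝ

instance : Monad Timed where
  pure a := ⟨a, 0⟩
  bind x g := ⟨(g x.val).val, x.time + (g x.val).time⟩

/-- Spend time `t` and return `a`. -/
def tick {α : Type} (t : ℝ) (a : α) : Timed α := ⟨a, t⟩

/-- The loop `for i in 0, …, n-1`, with independent iterations: the times add up. -/
def forFin {n : ℕ} {α : Type} (g : Fin n → Timed α) : Timed (Fin n → α) :=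
  ⟨fun i => (g i).val, ∑ i, (g i).time⟩

/-- The loop over the members of a list, with independent iterations. -/
def forList {α β : Type} (g : α → Timed β) : List α → Timed (List β)
  | [] => pure []
  | a :: l => do
    let b ← g a
    let bs ← forList g l
    pure (b :: bs)

/-- Combine the members of a list one after the other with a timed operation. -/
def foldT {α : Type} (op : α → α → Timed α) (init : α) : List α → Timed α
  | [] => pure init
  | a :: l => do
    let b ← foldT op init l
    op a b

/-- Square-and-multiply: `x ^ k` for a timed multiplication `mul`. -/
def powT {α : Type} (mul : α → α → Timed α) (one x : α) (k : ℕ) : Timed α :=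
  if h : k = 0 then pure one
  else do
    let y ← powT mul one x (k / 2)
    let z ← mul y y
    if k % 2 = 1 then mul z x else pure z
termination_by k
decreasing_by omega

/-! ## The prices of the arithmetic operations -/

/-- The binary length `1 + ⌊log₂ s⌋` of a length `s` (with value `1` at `s = 0`). -/
def lg (s : ℕ) : ℕ := Nat.log 2 s + 1

/-- The binary length of an integer. -/
def len (z : ℤ) : ℕ := max 1 (Nat.size z.natAbs)

/-- `Z s` is the price of a product of two integers of length at most `s`; `P d s` is the price of a
product of two polynomials with at most `d` coefficients that are taken modulo an integer of
length `s`.  As usual these prices are at least linear, and superadditive in the size. -/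
structure MulCost where
  Z : ℕ → ℝ
  P : ℕ → ℕ → ℝ
  le_Z : ∀ s : ℕ, (s : ℝ) ≤ Z s
  Z_add : ∀ s t : ℕ, Z s + Z t ≤ Z (s + t)
  le_P : ∀ d s : ℕ, (d : ℝ) * s ≤ P d s
  P_add : ∀ d d' s : ℕ, P d s + P d' s ≤ P (d + d') s
  P_mono : ∀ d s t : ℕ, s ≤ t → P d s ≤ P d t

/-- Integer multiplication is quasi-linear, of price at most `c · s · (log s)^{1+ε}`, and doubling
the number of coefficients multiplies the price of a polynomial product by at most `c`. -/
def MulCost.Fast (M : MulCost) (c ε : ℝ) : Prop :=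
  (∀ s : ℕ, M.Z s ≤ c * s * (lg s : ℝ) ^ (1 + ε)) ∧ ∀ d s : ℕ, M.P (2 * d) s ≤ c * M.P d s

section Integers

variable (M : MulCost)

def zadd (a b : ℤ) : Timed ℤ := tick (max (len a) (len b) : ℕ) (a + b)

def zsub (a b : ℤ) : Timed ℤ := tick (max (len a) (len b) : ℕ) (a - b)

def zmul (a b : ℤ) : Timed ℤ := tick (M.Z (max (len a) (len b))) (a * b)

/-- The price of a division with remainder: one product of the length of the divisor for every
block of the dividend of that length. -/
def zdivPrice (a b : ℤ) : ℝ := ((len a / len b + 1 : ℕ) : ℝ) * M.Z (len b)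

def zmod (a b : ℤ) : Timed ℤ := tick (zdivPrice M a b) (a % b)

def zdiv (a b : ℤ) : Timed ℤ := tick (zdivPrice M a b) (a / b)

/-- The remainder of `a` modulo `b` of least absolute value. -/
def zbmod (a : ℤ) (b : ℕ) : Timed ℤ := tick (zdivPrice M a b) (Int.bmod a b)

/-- Modular inverse by the fast extended Euclidean algorithm. -/
def zinv (a m : ℤ) : Timed ℤ :=
  tick (M.Z (max (len a) (len m)) * lg (max (len a) (len m))) (Int.gcdA a m % m)

def zpow (a : ℤ) (k : ℕ) : Timed ℤ := powT (zmul M) 1 a k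

/-! ## Product trees, multimodular reduction, and the Chinese remainder theorem over `ℤ` -/

inductive PTree where
  | leaf (p : ℕ) : PTree
  | node (p : ℕ) (l r : PTree) : PTree

def PTree.root : PTree → ℕ
  | .leaf p => p
  | .node p _ _ => p

def PTree.leaves : PTree → List ℕ
  | .leaf p => [p]
  | .node _ l r => l.leaves ++ r.leaves

/-- The product tree of a list of moduli, halving the list at each node.  The first argument bounds
the depth. -/
def buildTree : ℕ → List ℕ → Timed PTree
  | 0, l => pure (.leaf (l.headD 1))
  | h + 1, l =>
    if l.length ≤ 1 then pure (.leaf (l.headD 1))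
    else do
      let a ← buildTree h (l.take (l.length / 2))
      let b ← buildTree h (l.drop (l.length / 2))
      let p ← zmul M a.root b.root
      pure (.node p.toNat a b)

/-- The remainders of `c` modulo the leaves of a product tree. -/
def remTree : PTree → ℤ → Timed (List ℤ)
  | .leaf p, c => do
    let v ← zmod M c p
    pure [v]
  | .node p l r, c => do
    let v ← zmod M c p
    let a ← remTree l v
    let b ← remTree r v
    pure (a ++ b)

/-- The linear combination `∑ⱼ wⱼ · Q / qⱼ`, where the `qⱼ` are the leaves of the tree and `Q` is
their product. -/
def combTree : PTree → List ℤ → Timed ℤ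
  | .leaf _, w => pure (w.headD 0)
  | .node _ l r, w => do
    let a ← combTree l (w.take l.leaves.length)
    let b ← combTree r (w.drop l.leaves.length)
    let a' ← zmul M a r.root
    let b' ← zmul M b l.root
    zadd a' b'

/-- The numbers `(Q / qⱼ)⁻¹ mod qⱼ`.  Here `Q / qⱼ` modulo `qⱼ` is obtained as the remainder of
`∑ᵢ Q / qᵢ`. -/
def crtPrep {k : ℕ} (t : PTree) (q : Fin k → ℕ) : Timed (Fin k → ℤ) := do
  let d ← combTree M t (List.replicate k 1)
  let rs ← remTree M t d
  forFin fun j => zinv M (rs.getD j 0) (q j)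

/-- The integer of least absolute value that is congruent to `v j` modulo `q j` for all `j`; `m` is
the output of `crtPrep`. -/
def crtZ {k : ℕ} (t : PTree) (q : Fin k → ℕ) (m v : Fin k → ℤ) : Timed ℤ := do
  let w ← forFin fun j => do
    let x ← zmul M (v j) (m j)
    zmod M x (q j)
  let a ← combTree M t (List.ofFn w)
  zbmod M a t.root

end Integers

/-! ## Arithmetic in `𝔽_q` and `𝔽_q[t]` -/

section FiniteField

variable (M : MulCost) {q : ℕ} [Fact q.Prime]

/-- A sum of `n` elements of `𝔽_q`, each of them computed first. -/
def fsum {n : ℕ} (g : Fin n → Timed (ZMod q)) : Timed (ZMod q) :=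
  ⟨∑ i, (g i).val, ∑ i, ((g i).time + len q)⟩

def fmul (a b : ZMod q) : Timed (ZMod q) := tick (M.P 1 (len q)) (a * b)

/-- Reduction of an integer modulo `q`. -/
def zred (q : ℕ) (a : ℤ) : Timed (ZMod q) := do
  let v ← zmod M a q
  pure (v : ZMod q)

/-- Reduction of a rational number with denominator prime to `q`. -/
def ratRed (q : ℕ) (b : ℚ) : Timed (ZMod q) := do
  let x ← zmod M b.num q
  let y ← zmod M b.den q
  let z ← zinv M y q
  let v ← zmul M x z
  zred M q v

/-- The number of coefficients of a polynomial. -/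
def plen (a : (ZMod q)[X]) : ℕ := a.natDegree + 1

def padd (a b : (ZMod q)[X]) : Timed (ZMod q)[X] :=
  tick ((max (plen a) (plen b) * len q : ℕ) : ℝ) (a + b)

def psub (a b : (ZMod q)[X]) : Timed (ZMod q)[X] :=
  tick ((max (plen a) (plen b) * len q : ℕ) : ℝ) (a - b)

def pmul (a b : (ZMod q)[X]) : Timed (ZMod q)[X] :=
  tick (M.P (max (plen a) (plen b)) (len q)) (a * b)

def pdivPrice (a h : (ZMod q)[X]) : ℝ :=
  ((plen a / plen h + 1 : ℕ) : ℝ) * M.P (plen h) (len q)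

/-- Quotient and remainder for a monic divisor. -/
def pdiv (a h : (ZMod q)[X]) : Timed (ZMod q)[X] := tick (pdivPrice M a h) (a /ₘ h)

def pmod (a h : (ZMod q)[X]) : Timed (ZMod q)[X] := tick (pdivPrice M a h) (a %ₘ h)

/-- The price of the fast extended Euclidean algorithm for polynomials with at most `d`
coefficients; the second logarithm pays for the inversions of leading coefficients. -/
def euclidPrice (q d : ℕ) : ℝ := M.P d (len q) * ((lg d : ℝ) + lg (len q))

/-- Monic greatest common divisor. -/
def pgcd (a b : (ZMod q)[X]) : Timed (ZMod q)[X] :=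
  tick (euclidPrice M q (max (plen a) (plen b))) (normalize (EuclideanDomain.gcd a b))

/-- The inverse of `a` modulo the monic polynomial `h`, for `a` prime to `h`. -/
def pinv (a h : (ZMod q)[X]) : Timed (ZMod q)[X] :=
  tick (euclidPrice M q (max (plen a) (plen h)))
    ((C ((EuclideanDomain.gcd a h).coeff 0)⁻¹ * EuclideanDomain.gcdA a h) %ₘ h)

def mulMod (h a b : (ZMod q)[X]) : Timed (ZMod q)[X] := do
  let c ← pmul M a b
  pmod M c h

def powMod (h a : (ZMod q)[X]) (k : ℕ) : Timed (ZMod q)[X] := powT (mulMod M h) 1 a k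

/-! ### Factorisation of a squarefree polynomial (Cantor–Zassenhaus) -/

/-- Distinct-degree factorisation of the monic polynomial `f`.  After `i` rounds `g` is
`t ^ (q ^ i) mod f`, and `rem` is the product of the irreducible factors of degree greater than
`i`.  The output lists the pairs `(h, d)`, where `h ≠ 1` is the product of the irreducible factors
of degree `d`. -/
def ddf (f : (ZMod q)[X]) : ℕ → ℕ → (ZMod q)[X] → (ZMod q)[X] → Timed (List ((ZMod q)[X] × ℕ))
  | 0, _, _, _ => pure []
  | fuel + 1, i, g, rem =>
    open Classical in
    if rem = 1 then pure []
    else do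
      let g' ← powMod M f g q
      let w ← psub g' X
      let h ← pgcd M w rem
      let rem' ← pdiv M rem h
      let rest ← ddf f fuel (i + 1) g' rem'
      pure (if h = 1 then rest else (h, i + 1) :: rest)

/-- One attempt to split `h`, a product of irreducible polynomials of degree `d`, by means of the
random polynomial `a`. -/
def splitOne (a : (ZMod q)[X]) (hd : (ZMod q)[X] × ℕ) : Timed (List ((ZMod q)[X] × ℕ)) :=
  open Classical in
  if hd.1.natDegree ≤ hd.2 then pure [hd]
  else do
    let N ← zpow M q hd.2
    let N' ← zsub N 1
    let N'' ← zdiv M N' 2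
    let a' ← pmod M a hd.1
    let b ← powMod M hd.1 a' N''.toNat
    let b' ← psub b 1
    let g ← pgcd M b' hd.1
    let g' ← pdiv M hd.1 g
    pure (if g = 1 ∨ g' = 1 then [hd] else [(g, hd.2), (g', hd.2)])

/-- Equal-degree factorisation.  The first argument holds the coefficients of the random polynomials
that may be drawn, in the order in which they are drawn; a draw is paid for when it is made.  The
result is `none` if the supply is exhausted before all factors are irreducible. -/
def edf {n : ℕ} : List (Fin n → Fin q) → List ((ZMod q)[X] × ℕ) →
    Timed (Option (List (ZMod q)[X]))
  | [], L =>
    pure (if ∀ hd ∈ L, hd.1.natDegree ≤ hd.2 then some (L.map Prod.fst) else none)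
  | τ :: τs, L =>
    if ∀ hd ∈ L, hd.1.natDegree ≤ hd.2 then pure (some (L.map Prod.fst))
    else do
      let a ← tick ((n * len q : ℕ) : ℝ) (∑ i, C (((τ i : ℕ) : ZMod q)) * X ^ (i : ℕ))
      let L' ← forList (splitOne M a) L
      edf τs L'.flatten

/-- The monic irreducible factors of the monic squarefree polynomial `f`. -/
def factor {n : ℕ} (τs : List (Fin n → Fin q)) (f : (ZMod q)[X]) :
    Timed (Option (List (ZMod q)[X])) := do
  let x ← pmod M X f
  let L ← ddf M f f.natDegree 0 x f
  edf M τs L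

/-! ### The `e`-th root modulo `q` -/

/-- A positive exponent `a` is replaced by the exponent in `{1, …, m}` that is congruent to it
modulo `m`; the exponent `0` is kept. -/
def expRed (a m : ℤ) : Timed ℤ :=
  if a = 0 then pure 0
  else do
    let a' ← zsub a 1
    let a'' ← zmod M a' m
    zadd a'' 1

/-- The `e`-th root of `∏ᵢ uᵢ ^ aᵢ` in the field `𝔽_q[t]/(h)` with `q ^ deg h` elements: the power
with exponent `e⁻¹ mod (q ^ deg h - 1)`. -/
def rootAt {r : ℕ} (e : ℕ) (a : Fin r → ℕ) (u : Fin r → (ZMod q)[X]) (h : (ZMod q)[X]) :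
    Timed (ZMod q)[X] := do
  let N ← zpow M q h.natDegree
  let m ← zsub N 1
  let w ← forFin fun i => do
    let ui ← pmod M (u i) h
    let ai ← expRed M (a i) m
    powMod M h ui ai.toNat
  let y ← foldT (mulMod M h) 1 (List.ofFn w)
  let e' ← zmod M e m
  let d ← zinv M e' m
  powMod M h y d.toNat

/-- Chinese remaindering modulo the factors of `f`: the sum over the members `(h, x)` of the list of
`x · ((f / h)⁻¹ mod h) · (f / h)`. -/
def crtPoly (f : (ZMod q)[X]) (L : List ((ZMod q)[X] × (ZMod q)[X])) : Timed (ZMod q)[X] := do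
  let ts ← forList (fun hx => do
    let cof ← pdiv M f hx.1
    let c ← pmod M cof hx.1
    let iv ← pinv M c hx.1
    let s ← mulMod M hx.1 hx.2 iv
    pmul M s cof) L
  foldT padd 0 ts

/-- The `e`-th root of `∏ᵢ uᵢ ^ aᵢ` in `𝔽_q[t]/(f)`: factor `f`, take the root in each residue
field, and recombine. -/
def rootModPoly {r n : ℕ} (τs : List (Fin n → Fin q)) (f : (ZMod q)[X]) (e : ℕ) (a : Fin r → ℕ)
    (u : Fin r → (ZMod q)[X]) : Timed (Option (ZMod q)[X]) := do
  let S ← factor M τs f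
  match S with
  | none => pure none
  | some S => do
    let xs ← forList (fun h => do
      let x ← rootAt M e a u h
      pure (h, x)) S
    let x ← crtPoly M f xs
    pure (some x)

end FiniteField

/-! ## The number field and its order -/

/-- What is known of the number field: `K = ℚ(α)` for a root `α` of the monic irreducible
`f ∈ ℤ[t]`; an order `ℤ[α] ⊆ O ⊆ O_K` with a `ℤ`-basis `ω`; the matrices that relate `ω` to the
powers of `α`; an integer `f₀ ≥ 1` with `f₀ O_K ⊆ O`; and an upper bound `Cinf` for the norm
`max_j ∑ᵢ |mᵢⱼ|` of the inverse `(mᵢⱼ)` of the matrix `(σⱼ(ωᵢ))`, where `σ` enumerates the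
embeddings of `K` into `ℂ`. -/
structure OrderData (K : Type*) [Field K] [NumberField K] where
  f : ℤ[X]
  monic : f.Monic
  irreducible : Irreducible f
  α : K
  root : aeval α f = 0
  adjoin_eq_top : IntermediateField.adjoin ℚ {α} = ⊤
  O : Subalgebra ℤ K
  isIntegral : ∀ x ∈ O, IsIntegral ℤ x
  α_mem : α ∈ O
  ω : Module.Basis (Fin f.natDegree) ℤ O
  Ω : Matrix (Fin f.natDegree) (Fin f.natDegree) ℚ
  ω_eq : ∀ i, (ω i : K) = ∑ j, algebraMap ℚ K (Ω i j) * α ^ (j : ℕ)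
  T : Matrix (Fin f.natDegree) (Fin f.natDegree) ℤ
  pow_eq : ∀ i : Fin f.natDegree, α ^ (i : ℕ) = ∑ j, (T i j : K) * (ω j : K)
  f₀ : ℕ
  f₀_pos : 0 < f₀
  f₀_mul_mem : ∀ x : K, IsIntegral ℤ x → (f₀ : K) * x ∈ O
  σ : Fin f.natDegree ≃ (K →+* ℂ)
  Cinf : ℕ
  sum_norm_le : ∀ j, ∑ i, ‖(Matrix.of fun i j => σ j (ω i : K))⁻¹ i j‖ ≤ (Cinf : ℝ)

variable {K : Type*} [Field K] [NumberField K]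

/-- The degree of the number field. -/
def OrderData.n (D : OrderData K) : ℕ := D.f.natDegree

/-- The element of the order with given coordinates. -/
def OrderData.elt (D : OrderData K) (c : Fin D.n → ℤ) : K := ∑ i, (c i : K) * (D.ω i : K)

/-- `f` modulo `q`. -/
def OrderData.fbar (D : OrderData K) (q : ℕ) : (ZMod q)[X] := D.f.map (Int.castRingHom (ZMod q))

/-- The total size `∑ᵢ (1 + log₂ ‖Σ(uᵢ)‖_∞)` of a family of elements of `K`, where `‖Σ(u)‖_∞` is
the largest absolute value of a conjugate of `u`. -/
def size {r : ℕ} (u : Fin r → K) : ℝ := ∑ i, (1 + Real.logb 2 (house (u i)))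

/-! ## The algorithms -/

/-- Reduction of the polynomial `f` modulo `q`. -/
def redPoly (M : MulCost) (D : OrderData K) (q : ℕ) : Timed (ZMod q)[X] := do
  let c ← forFin fun i : Fin (D.n + 1) => zred M q (D.f.coeff i)
  pure (∑ i, C (c i) * X ^ (i : ℕ))

/-- Number field CRT: the coordinates of `f₀ · (∏ᵢ uᵢ ^ aᵢ)^{1/e}` modulo `q` with respect to the
basis of the order.  The coordinates `c` of the `uᵢ` are given modulo `q`, and `τs` is the supply
of random polynomials. -/
def rootModPrime (M : MulCost) (D : OrderData K) {r : ℕ} (e : ℕ) (a : Fin r → ℕ)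
    (q : ℕ) [Fact q.Prime] (τs : List (Fin D.n → Fin q)) (c : Fin r → Fin D.n → ℤ) :
    Timed (Option (Fin D.n → ℤ)) := do
  let f ← redPoly M D q
  let W ← forFin fun i : Fin D.n => forFin fun j : Fin D.n => ratRed M q (D.Ω i j)
  let T ← forFin fun i : Fin D.n => forFin fun j : Fin D.n => zred M q (D.T i j)
  let f₀ ← zred M q D.f₀
  let u ← forFin fun i => do
    let p ← forFin fun j : Fin D.n => fsum fun l : Fin D.n => fmul M ((c i l : ℤ) : ZMod q) (W l j)
    pure (∑ j, C (p j) * X ^ (j : ℕ))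
  let x ← rootModPoly M τs f e a u
  match x with
  | none => pure none
  | some x => do
    let v ← forFin fun j : Fin D.n => do
      let s ← fsum fun l : Fin D.n => fmul M (x.coeff l) (T l j)
      let s' ← fmul M f₀ s
      pure ((s'.val : ℕ) : ℤ)
    pure (some v)

/-- The bound `B = f₀ · C · ∏ᵢ bᵢ` for the coordinates of `f₀ x`, where `bᵢ` is an upper estimate of
`‖Σ(uᵢ)‖_∞`. -/
def boundB (M : MulCost) (D : OrderData K) {r : ℕ} (b : Fin r → ℕ) : Timed ℤ := do
  let p ← foldT (zmul M) 1 (List.ofFn fun i => (b i : ℤ))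
  let p' ← zmul M D.Cinf p
  zmul M D.f₀ p'

/-- The supply of random polynomials: at most `N` draws for each of the primes `q j`.  All supplies
are equally likely. -/
abbrev Tape (n N : ℕ) {k : ℕ} (q : Fin k → ℕ) : Type := (j : Fin k) → Fin N → Fin n → Fin (q j)

/-- Double CRT for the `e`-th root of `∏ᵢ uᵢ ^ aᵢ`, where `u i` lists the coordinates of `uᵢ`, for
the chosen primes `q j`.  The result is `none` if the supply of random polynomials is exhausted, or
if the product of the chosen primes is not greater than `2B`. -/
def doubleCRT (M : MulCost) (D : OrderData K) {r k : ℕ} (e : ℕ) (a : Fin r → ℕ)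
    (u : Fin r → Fin D.n → ℤ) (b : Fin r → ℕ) (q : Fin k → ℕ) [∀ j, Fact (q j).Prime]
    {N : ℕ} (τ : Tape D.n N q) : Timed (Option (Fin D.n → ℤ)) := do
  let B ← boundB M D b
  let t ← buildTree M k (List.ofFn q)
  if (t.root : ℤ) ≤ 2 * B then pure none
  else do
    let res ← forFin fun i => forFin fun l => remTree M t (u i l)
    let xs ← forFin fun j =>
      rootModPrime M D e a (q j) (List.ofFn (τ j)) (fun i l => (res i l).getD j 0)
    if ∀ j, (xs j).isSome then do
      let m ← crtPrep M t q
      let z ← forFin fun l => crtZ M t q m (fun j => (xs j).getD 0 l)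
      pure (some z)
    else pure none

/-- The element of `K` that an output of the algorithm stands for. -/
def OrderData.out (D : OrderData K) (z : Fin D.n → ℤ) : K := D.elt z / (D.f₀ : K)

/-- The average of the running time over all supplies of at most `N` random polynomials for each
prime. -/
def expTime (M : MulCost) (D : OrderData K) {r k : ℕ} (e : ℕ) (a : Fin r → ℕ)
    (u : Fin r → Fin D.n → ℤ) (b : Fin r → ℕ) (q : Fin k → ℕ) [∀ j, Fact (q j).Prime]
    (N : ℕ) : ℝ :=
  (∑ τ : Tape D.n N q, (doubleCRT M D e a u b q τ).time) / Fintype.card (Tape D.n N q)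

/-- The probability that the algorithm delivers a result after at most `N` draws for each prime. -/
def successProb (M : MulCost) (D : OrderData K) {r k : ℕ} (e : ℕ) (a : Fin r → ℕ)
    (u : Fin r → Fin D.n → ℤ) (b : Fin r → ℕ) (q : Fin k → ℕ) [∀ j, Fact (q j).Prime]
    (N : ℕ) : ℝ :=
  (Nat.card {τ : Tape D.n N q // (doubleCRT M D e a u b q τ).val.isSome} : ℝ) /
    Fintype.card (Tape D.n N q)

/-- A prime that may be used: `q` is odd, `f` is squarefree modulo `q` (that is, `q` is unramified
in `K` and does not divide the index of `ℤ[α]` in `O_K`), and `q ^ f_𝔮 ≢ 1 mod ℓ` for all prime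
ideals `𝔮` of `O_K` above `q`, where `f_𝔮` is the residue degree. -/
structure GoodPrime (D : OrderData K) (ℓ q : ℕ) : Prop where
  odd : Odd q
  squarefree : Squarefree (D.fbar q)
  not_modEq : ∀ Q : Ideal (𝓞 K), Q.IsPrime → (q : 𝓞 K) ∈ Q →
    ¬ q ^ Q.inertiaDeg ℤ ≡ 1 [MOD ℓ]

end CrtRoot

end

set_option linter.unusedSectionVars false

namespace CrtRoot

/-! ## Timed computations -/

section TimedLemmas

variable {α β : Type}

/-! Correctness. Let `x ^ e = y`. Then `x` is integral, so `f₀ x` lies in the order. The house of a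
non-zero algebraic integer is at least `1`, hence every `b i ≥ 1`, and `|φ x| ^ e = ∏ |φ uᵢ| ^ aᵢ ≤
(∏ bᵢ) ^ e` for each embedding `φ`. Multiplying the vector of conjugates by the inverse of `(σⱼ ωᵢ)`
bounds the coordinates of `f₀ x` by `B` (`abs_coord_le`, `norm_le_prod`), so a modulus `Q > 2B`
determines them. Modulo a good prime `q`, squarefreeness of `f` forces the index of `ℤ[α]` in the
maximal order to be prime to `q` (`exists_not_dvd_mul_mem`). Hence the integers of `K` map to
`𝔽_q[t]/(f)` by a ring homomorphism (`exists_reduction`), and every irreducible factor `h` of `f` is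
the residue field of a prime above `q` of residue degree `deg h`. Condition `(*)` therefore says
that `e` is prime to `q ^ deg h - 1` (`GoodPrime.coprime`). Taking `e`-th powers is then injective
on each residue field, and the power computed by `rootAt` can only be the reduction of `x`.
Polynomial and integer Chinese remaindering give back `f₀ x` (`rootModPrime_val_modEq`,
`doubleCRT_correct`).

Expected time of the factorisation. A random polynomial has different quadratic characters modulo
two irreducible factors with probability at least `1/5`, so each attempt splits a reducible block
with at least this probability. The potential `pot` charges five attempts for every splitting still
to be made. One round does not increase the expected sum of potential and money spent, so the
initial potential bounds the expected time, uniformly in the number `N` of allowed draws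
(`sum_edf_time_le`). Termination follows from the same bound: a run that fails has paid for `N`
draws, so by Markov's inequality failure has probability `O(1/N)` (`tendsto_successProb`).

Total time. A pass through the product tree costs `O(kκ)` times two kinds of logarithmic factors:
`log^{1+ε}` from integer multiplication and `log` from the depth. There are `O(rn)` passes, and `kκ
= O(s)`. Modulo one prime, a root in a residue field of degree `d` needs `r + 1` powers with
exponents of length `dκ`; the degrees add up to `n`, which gives `O(r n κ M(n,κ))`. Reducing
exponents of length `O(log e)` adds `O(r n κ log e)`. The field data have some fixed length `X`, so
treating them once per prime contributes terms with `kX` in place of `kκ`; since the primes are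
distinct, `kX ≤ kκ + X 2^X`, and the constant is absorbed by `s₀` (`mul_le_of_injective`). -/

@[simp] theorem Timed.val_pure (a : α) : (pure a : Timed α).val = a := rfl

@[simp] theorem Timed.time_pure (a : α) : (pure a : Timed α).time = 0 := rfl

@[simp] theorem Timed.val_bind (x : Timed α) (g : α → Timed β) : (x >>= g).val = (g x.val).val := rfl

@[simp] theorem Timed.time_bind (x : Timed α) (g : α → Timed β) :
    (x >>= g).time = x.time + (g x.val).time := rfl

@[simp] theorem tick_val (t : ℝ) (a : α) : (tick t a).val = a := rfl

@[simp] theorem tick_time (t : ℝ) (a : α) : (tick t a).time = t := rfl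

@[simp] theorem forFin_val {n : ℕ} (g : Fin n → Timed α) : (forFin g).val = fun i => (g i).val := rfl

@[simp] theorem forFin_time {n : ℕ} (g : Fin n → Timed α) : (forFin g).time = ∑ i, (g i).time := rfl

@[simp] theorem forList_val (g : α → Timed β) (l : List α) :
    (forList g l).val = l.map fun a => (g a).val := by
  induction l with
  | nil => rfl
  | cons a l ih => simp [forList, ih]

@[simp] theorem forList_time (g : α → Timed β) (l : List α) :
    (forList g l).time = (l.map fun a => (g a).time).sum := by
  induction l with
  | nil => rfl
  | cons a l ih => simp [forList, ih]

theorem Timed.bind_nonneg {x : Timed α} {g : α → Timed β} (hx : 0 ≤ x.time)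
    (hg : ∀ a, 0 ≤ (g a).time) : 0 ≤ (x >>= g).time := add_nonneg hx (hg _)

theorem Timed.pure_nonneg (a : α) : 0 ≤ (pure a : Timed α).time := le_rfl

theorem forFin_nonneg {n : ℕ} {g : Fin n → Timed α} (hg : ∀ i, 0 ≤ (g i).time) :
    0 ≤ (forFin g).time := by
  rw [forFin_time]
  exact Finset.sum_nonneg fun i _ => hg i

theorem forList_nonneg {g : α → Timed β} (hg : ∀ a, 0 ≤ (g a).time) (l : List α) :
    0 ≤ (forList g l).time := by
  rw [forList_time]
  exact List.sum_nonneg (by simpa using fun a _ => hg a)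

theorem foldT_val (op : α → α → Timed α) (init : α) (l : List α) :
    (foldT op init l).val = l.foldr (fun a b => (op a b).val) init := by
  induction l with
  | nil => rfl
  | cons a l ih => simp [foldT, ih]

theorem foldT_time_nonneg {op : α → α → Timed α} (h : ∀ a b, 0 ≤ (op a b).time) (init : α)
    (l : List α) : 0 ≤ (foldT op init l).time := by
  induction l with
  | nil => simp [foldT]
  | cons a l ih => simpa [foldT] using add_nonneg ih (h _ _)

/-- If every partial result satisfies the invariant `Q` and each step costs at most `B`, then the
fold of a list costs at most its length times `B`. -/
theorem foldT_time_le {op : α → α → Timed α} {init : α} {Q : α → Prop} {B : ℝ} {l : List α}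
    (h0 : Q init) (hop : ∀ a ∈ l, ∀ b, Q b → Q (op a b).val) (ht : ∀ a ∈ l, ∀ b, Q b → (op a b).time ≤ B) :
    Q (foldT op init l).val ∧ (foldT op init l).time ≤ l.length * B := by
  induction l with
  | nil => simpa [foldT] using h0
  | cons a l ih =>
    obtain ⟨h1, h2⟩ := ih (fun a ha => hop a (List.mem_cons_of_mem _ ha))
      (fun a ha => ht a (List.mem_cons_of_mem _ ha))
    refine ⟨by simpa [foldT] using hop a List.mem_cons_self _ h1, ?_⟩
    have := ht a List.mem_cons_self _ h1
    simp only [foldT, Timed.time_bind, List.length_cons, Nat.cast_add, Nat.cast_one]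
    linarith

theorem powT_time_nonneg {mul : α → α → Timed α} (h : ∀ a b, 0 ≤ (mul a b).time) (one x : α)
    (k : ℕ) : 0 ≤ (powT mul one x k).time := by
  induction k using Nat.strong_induction_on with
  | _ k ih =>
    unfold powT
    split_ifs with h0 h1
    · simp
    all_goals
      have := ih (k / 2) (by omega)
      have h1 := h (powT mul one x (k / 2)).val (powT mul one x (k / 2)).val
      have := h (mul (powT mul one x (k / 2)).val (powT mul one x (k / 2)).val).val x
      simp only [Timed.time_bind, Timed.time_pure]
      linarith

/-- Square-and-multiply: if `P i y` expresses that `y` is an `i`-th power of `x`, then the result is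
a `k`-th power, at the price of at most two products per binary digit of `k`. -/
theorem powT_spec {mul : α → α → Timed α} {one x : α} {P : ℕ → α → Prop} {B : ℝ} (hB : 0 ≤ B) (k : ℕ)
    (h0 : P 0 one) (h1 : 0 < k → P 1 x)
    (hm : ∀ i j a b, i + j ≤ k → P i a → P j b → P (i + j) (mul a b).val)
    (ht : ∀ i j a b, i + j ≤ k → P i a → P j b → (mul a b).time ≤ B) :
    P k (powT mul one x k).val ∧ (powT mul one x k).time ≤ 2 * Nat.size k * B := by
  induction k using Nat.strong_induction_on with
  | _ k ih =>
    unfold powT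
    rcases Nat.eq_zero_or_pos k with rfl | hk
    · simpa using h0
    have hk0 : k ≠ 0 := hk.ne'
    obtain ⟨i1, i2⟩ := ih (k / 2) (by omega) (fun _ => h1 hk)
      (fun i j a b h => hm i j a b (by omega)) (fun i j a b h => ht i j a b (by omega))
    have hs : Nat.size k = Nat.size (k / 2) + 1 := by
      rw [← Nat.div2_val]
      conv_lhs => rw [← Nat.bit_bodd_div2 k, Nat.size_bit (by rwa [Nat.bit_bodd_div2])]
    have hk2 : k / 2 + k / 2 ≤ k := by omega
    have j1 := hm _ _ _ _ hk2 i1 i1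
    have j2 := ht _ _ _ _ hk2 i1 i1
    rw [hs]
    push_cast
    rw [dif_neg hk0]
    split_ifs with hodd
    · have e : k / 2 + k / 2 + 1 = k := by omega
      have j3 := hm _ _ _ _ e.le j1 (h1 hk)
      have j4 := ht _ _ _ _ e.le j1 (h1 hk)
      rw [e] at j3
      simp only [Timed.val_bind, Timed.time_bind]
      exact ⟨j3, by linarith⟩
    · have e : k / 2 + k / 2 = k := by omega
      rw [e] at j1
      simp only [Timed.val_bind, Timed.time_bind, Timed.val_pure, Timed.time_pure]
      exact ⟨j1, by linarith⟩

end TimedLemmas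

/-! ## Lengths of integers -/

theorem one_le_len (z : ℤ) : 1 ≤ len z := le_max_left _ _

theorem len_le_iff {z : ℤ} {k : ℕ} (hk : 1 ≤ k) : len z ≤ k ↔ z.natAbs < 2 ^ k := by
  rw [len, max_le_iff, Nat.size_le]
  exact ⟨fun h => h.2, fun h => ⟨hk, h⟩⟩

theorem natAbs_lt_two_pow_len (z : ℤ) : z.natAbs < 2 ^ len z :=
  (len_le_iff (one_le_len z)).1 le_rfl

theorem len_mono {a b : ℤ} (h : a.natAbs ≤ b.natAbs) : len a ≤ len b :=
  (len_le_iff (one_le_len b)).2 (h.trans_lt (natAbs_lt_two_pow_len b))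

theorem len_mul_le (a b : ℤ) : len (a * b) ≤ len a + len b := by
  rw [len_le_iff (by have := one_le_len a; omega), Int.natAbs_mul, pow_add]
  exact Nat.mul_lt_mul'' (natAbs_lt_two_pow_len a) (natAbs_lt_two_pow_len b)

theorem len_pow_le (a : ℤ) {i d : ℕ} (hid : i ≤ d) (hd : 1 ≤ d) : len (a ^ i) ≤ d * len a := by
  have h1 := one_le_len a
  rw [len_le_iff (by nlinarith), Int.natAbs_pow, mul_comm, pow_mul]
  rcases Nat.eq_zero_or_pos i with rfl | hi
  · simpa using Nat.one_lt_pow (by omega) (Nat.one_lt_two_pow (by omega))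
  · calc a.natAbs ^ i < (2 ^ len a) ^ i := Nat.pow_lt_pow_left (natAbs_lt_two_pow_len a) (by omega)
      _ ≤ (2 ^ len a) ^ d := Nat.pow_le_pow_right (by positivity) hid

theorem two_pow_len_le {z : ℤ} (hz : z ≠ 0) : 2 ^ (len z - 1) ≤ z.natAbs := by
  have h := Nat.size_pos.2 (Int.natAbs_pos.2 hz)
  have : len z = Nat.size z.natAbs := max_eq_right h
  rw [this]
  exact Nat.lt_size.1 (by omega)

theorem one_le_lg (s : ℕ) : 1 ≤ lg s := by simp [lg]

theorem lg_mono {s t : ℕ} (h : s ≤ t) : lg s ≤ lg t := by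
  simpa [lg] using Nat.log_mono_right h

theorem lg_le_self {s : ℕ} (h : 1 ≤ s) : lg s ≤ s := Nat.log_lt_self 2 (by omega)

theorem size_le_lg (s : ℕ) : Nat.size s ≤ lg s := by
  rw [Nat.size_le]
  exact Nat.lt_pow_succ_log_self (by norm_num) s

/-! ## Prices -/

namespace MulCost

variable (M : MulCost)

theorem Z_nonneg (s : ℕ) : 0 ≤ M.Z s := (Nat.cast_nonneg s).trans (M.le_Z s)

theorem P_nonneg (d s : ℕ) : 0 ≤ M.P d s := le_trans (by positivity) (M.le_P d s)

/-- Superadditive and non-negative prices are monotone. The same argument makes `P` monotone in the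
number of coefficients. -/
theorem Z_mono {s t : ℕ} (h : s ≤ t) : M.Z s ≤ M.Z t := by
  obtain ⟨u, rfl⟩ := Nat.exists_eq_add_of_le h
  have := M.Z_add s u
  have := M.Z_nonneg u
  linarith

theorem P_le {d d' s t : ℕ} (h : d ≤ d') (hst : s ≤ t) : M.P d s ≤ M.P d' t := by
  obtain ⟨u, rfl⟩ := Nat.exists_eq_add_of_le h
  have := M.P_add d u s
  have := M.P_nonneg u s
  exact le_trans (by linarith) (M.P_mono _ _ _ hst)

theorem mul_P_le (j d s : ℕ) : j * M.P d s ≤ M.P (j * d) s := by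
  induction j with
  | zero => simpa using M.P_nonneg 0 s
  | succ j ih =>
    have := M.P_add (j * d) d s
    rw [← Nat.succ_mul] at this
    push_cast
    linarith

/-- The bounds on the prices that are used for the arithmetic modulo one prime. -/
structure Tame (c : ℝ) : Prop where
  two_le : 2 ≤ c
  -- A quadratic bound is enough modulo one prime: the integers have length `d κ` with `d ≤ n`, and
  -- since `d κ ≤ n κ ≤ M.P n κ`, one of the two factors in `(d κ) ^ 2` is absorbed by the price of
  -- a polynomial product.
  quad : ∀ s : ℕ, M.Z s * lg s ≤ c * (s : ℝ) ^ 2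
  double : ∀ d s : ℕ, M.P (2 * d) s ≤ c * M.P d s

variable {M} {c : ℝ}

theorem Tame.Z_le (hM : M.Tame c) (s : ℕ) : M.Z s ≤ c * (s : ℝ) ^ 2 := by
  refine le_trans ?_ (hM.quad s)
  have : (1 : ℝ) ≤ lg s := by exact_mod_cast one_le_lg s
  have := M.Z_nonneg s
  nlinarith

theorem zdivPrice_nonneg (a b : ℤ) : 0 ≤ zdivPrice M a b :=
  mul_nonneg (Nat.cast_nonneg _) (M.Z_nonneg _)

/-- The full blocks of the dividend together are no longer than the dividend, and the one extra
block accounts for `len b`. Here and below `Λ` is the price of multiplication per binary digit. -/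
theorem zdivPrice_le_of_linear {Λ : ℝ} {a b : ℤ} (hΛ : 0 ≤ Λ) (hb : M.Z (len b) ≤ Λ * len b) :
    zdivPrice M a b ≤ Λ * (len a + len b) := by
  have h1 : ((len a / len b : ℕ) : ℝ) * len b ≤ len a := by exact_mod_cast Nat.div_mul_le_self _ _
  unfold zdivPrice
  calc ((len a / len b + 1 : ℕ) : ℝ) * M.Z (len b)
      ≤ ((len a / len b + 1 : ℕ) : ℝ) * (Λ * len b) := by gcongr
    _ = Λ * (((len a / len b : ℕ) : ℝ) * len b + len b) := by push_cast; ring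
    _ ≤ Λ * (len a + len b) := by gcongr

theorem Tame.zdivPrice_le (hM : M.Tame c) {a b : ℤ} {s t : ℕ} (ha : len a ≤ s) (hb : len b ≤ t) :
    zdivPrice M a b ≤ c * (s + t) * t := by
  have hc := hM.two_le
  have h : M.Z (len b) ≤ (c * len b) * len b := by
    have := hM.Z_le (len b); rw [pow_two] at this; linarith
  refine (zdivPrice_le_of_linear (by positivity) h).trans ?_
  calc c * len b * (len a + len b : ℝ) ≤ c * t * (s + t) := by gcongr
    _ = _ := by ring

end MulCost

end CrtRoot

namespace CrtRoot

/-! ## Product trees -/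

/-- Every node of the tree is labelled with the product of the labels of its children. -/
def PTree.WF : PTree → Prop
  | .leaf _ => True
  | .node p l r => p = l.root * r.root ∧ l.WF ∧ r.WF

def PTree.depth : PTree → ℕ
  | .leaf _ => 0
  | .node _ l r => max l.depth r.depth + 1

theorem PTree.WF.root_eq {t : PTree} (h : t.WF) : t.root = t.leaves.prod := by
  induction t with
  | leaf p => simp [root, leaves]
  | node p l r ihl ihr =>
    obtain ⟨h1, h2, h3⟩ := h
    rw [leaves, List.prod_append, ← ihl h2, ← ihr h3, ← h1, root]

/-- The empty list is excluded because `len 1 = 1`, whereas the bound would be `0`. -/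
theorem len_list_prod_le {κ : ℕ} {l : List ℕ} (hl : l ≠ []) (h : ∀ p ∈ l, len (p : ℤ) ≤ κ) :
    len (l.prod : ℤ) ≤ l.length * κ := by
  induction l with
  | nil => exact absurd rfl hl
  | cons a l ih =>
    have ha := h a List.mem_cons_self
    rcases eq_or_ne l [] with rfl | hne
    · simpa using ha
    · have := ih hne fun p hp => h p (List.mem_cons_of_mem _ hp)
      rw [List.prod_cons, List.length_cons]
      push_cast
      refine (len_mul_le _ _).trans ?_
      push_cast at this
      linarith

theorem PTree.leaves_ne_nil (t : PTree) : t.leaves ≠ [] := by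
  induction t with
  | leaf p => simp [leaves]
  | node p l r ihl ihr => simp [leaves, ihl]

theorem PTree.WF.len_root_le {t : PTree} (h : t.WF) {κ : ℕ}
    (hκ : ∀ p ∈ t.leaves, len (p : ℤ) ≤ κ) : len (t.root : ℤ) ≤ t.leaves.length * κ := by
  rw [h.root_eq]
  exact len_list_prod_le t.leaves_ne_nil hκ

section Trees

variable {M : MulCost} {Λ : ℝ} {S κ : ℕ}

/-- `fuel` only makes the recursion terminate; the true depth is governed by `h`, since halving the
list `h` times leaves single moduli. The labels on one level have total length at most `l.length *
κ`, so each level costs at most `Λ` times this. -/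
theorem buildTree_spec (hΛ : 0 ≤ Λ) (hZ : ∀ x ≤ S, M.Z x ≤ Λ * x) (fuel : ℕ) :
    ∀ (h : ℕ) (l : List ℕ), l ≠ [] → l.length ≤ 2 ^ fuel → l.length ≤ 2 ^ h →
      (∀ p ∈ l, len (p : ℤ) ≤ κ) → l.length * κ ≤ S →
      (buildTree M fuel l).val.leaves = l ∧ (buildTree M fuel l).val.WF ∧
      (buildTree M fuel l).val.depth ≤ h ∧
      (buildTree M fuel l).time ≤ h * (Λ * (l.length * κ : ℕ)) := by
  induction fuel with
  | zero =>
    intro h l hl h0 _ _ _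
    obtain ⟨a, rfl⟩ : ∃ a, l = [a] := List.length_eq_one_iff.1
      (le_antisymm (by simpa using h0) (List.length_pos_iff.2 hl))
    simp only [buildTree, Timed.val_pure, Timed.time_pure]
    exact ⟨by simp [PTree.leaves], trivial, by simp [PTree.depth], by positivity⟩
  | succ fuel ih =>
    intro h l hl h0 h1 hκ hS
    have hpos := List.length_pos_iff.2 hl
    unfold buildTree
    split_ifs with hl1
    · obtain ⟨a, rfl⟩ : ∃ a, l = [a] := List.length_eq_one_iff.1 (by omega)
      simp only [Timed.val_pure, Timed.time_pure]
      exact ⟨by simp [PTree.leaves], trivial, by simp [PTree.depth], by positivity⟩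
    · obtain ⟨h, rfl⟩ : ∃ h', h = h' + 1 := by
        rcases h with _ | h
        · simp at h1; omega
        · exact ⟨h, rfl⟩
      rw [pow_succ] at h0 h1
      have e1 : (l.take (l.length / 2)).length = l.length / 2 := by simp; omega
      have e2 : (l.drop (l.length / 2)).length = l.length - l.length / 2 := by simp
      have mono : ∀ x, x ≤ l.length → x * κ ≤ S := fun x hx =>
        (Nat.mul_le_mul_right κ hx).trans hS
      obtain ⟨a1, a2, a3, a4⟩ := ih h (l.take (l.length / 2)) (by rw [← List.length_pos_iff]; omega)
        (by omega) (by omega) (fun p hp => hκ p (List.mem_of_mem_take hp)) (mono _ (by omega))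
      obtain ⟨b1, b2, b3, b4⟩ := ih h (l.drop (l.length / 2)) (by rw [← List.length_pos_iff]; omega)
        (by omega) (by omega) (fun p hp => hκ p (List.mem_of_mem_drop hp)) (mono _ (by omega))
      simp only [Timed.val_bind, Timed.time_bind, Timed.val_pure, Timed.time_pure, zmul, tick_val,
        tick_time]
      set a := (buildTree M fuel (l.take (l.length / 2)))
      set b := (buildTree M fuel (l.drop (l.length / 2)))
      refine ⟨by simp [PTree.leaves, a1, b1], ⟨by norm_cast, a2, b2⟩, by simp [PTree.depth, a3, b3], ?_⟩
      have la : len (a.val.root : ℤ) ≤ l.length * κ := by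
        refine (a2.len_root_le (κ := κ) ?_).trans ?_
        · rw [a1]; exact fun p hp => hκ p (List.mem_of_mem_take hp)
        · rw [a1]; exact Nat.mul_le_mul_right _ (by omega)
      have lb : len (b.val.root : ℤ) ≤ l.length * κ := by
        refine (b2.len_root_le (κ := κ) ?_).trans ?_
        · rw [b1]; exact fun p hp => hκ p (List.mem_of_mem_drop hp)
        · rw [b1]; exact Nat.mul_le_mul_right _ (by omega)
      have hz := (M.Z_mono (max_le la lb)).trans (hZ _ hS)
      have hsum : ((l.take (l.length / 2)).length * κ : ℕ) + ((l.drop (l.length / 2)).length * κ : ℕ)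
          = l.length * κ := by
        rw [e1, e2, ← add_mul]; congr 1; omega
      have hsum' : (((l.take (l.length / 2)).length * κ : ℕ) : ℝ)
          + ((l.drop (l.length / 2)).length * κ : ℕ) = (l.length * κ : ℕ) := by exact_mod_cast hsum
      rw [← hsum'] at hz ⊢
      push_cast at *
      linarith

theorem remTree_val {t : PTree} (ht : t.WF) (c : ℤ) :
    (remTree M t c).val = t.leaves.map fun p : ℕ => c % (p : ℤ) := by
  induction t generalizing c with
  | leaf p => simp [remTree, PTree.leaves, zmod]
  | node p l r ihl ihr =>
    obtain ⟨h1, h2, h3⟩ := ht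
    simp only [remTree, zmod, Timed.val_bind, tick_val, Timed.val_pure, ihl h2, ihr h3, PTree.leaves,
      List.map_append]
    congr 1
    · refine List.map_congr_left fun x hx => Int.emod_emod_of_dvd _ ?_
      rw [h1, h2.root_eq]
      exact_mod_cast (List.dvd_prod hx).mul_right _
    · refine List.map_congr_left fun x hx => Int.emod_emod_of_dvd _ ?_
      rw [h1, h3.root_eq]
      exact_mod_cast (List.dvd_prod hx).mul_left _

theorem remTree_time_nonneg (t : PTree) (c : ℤ) : 0 ≤ (remTree M t c).time := by
  induction t generalizing c with
  | leaf p => simpa [remTree, zmod] using M.zdivPrice_nonneg _ _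
  | node p l r ihl ihr =>
    simp only [remTree, zmod, Timed.time_bind, tick_time, tick_val, Timed.time_pure]
    have := M.zdivPrice_nonneg c p
    have := ihl (c % p)
    have := ihr (c % p)
    linarith

/-- Only the division at the root sees the full length of `c`; further down the dividends are
already reduced modulo the parent. The `3` per level consists of one length for the divisor and two
for the reduced number, which is handed to both children. -/
theorem remTree_time_le (hΛ : 0 ≤ Λ) (hZ : ∀ x ≤ S, M.Z x ≤ Λ * x) {t : PTree} (ht : t.WF)
    (hκ : ∀ p ∈ t.leaves, 0 < p ∧ len (p : ℤ) ≤ κ) (hS : t.leaves.length * κ ≤ S) (c : ℤ) :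
    (remTree M t c).time ≤ Λ * (len c + (3 * t.depth + 1) * (t.leaves.length * κ : ℕ)) := by
  induction t generalizing c with
  | leaf p =>
    have hp := (hκ p (by simp [PTree.leaves])).2
    simp only [PTree.leaves, List.length_singleton, one_mul] at hS
    simp only [remTree, zmod, Timed.time_bind, tick_time, Timed.time_pure, PTree.depth, PTree.leaves]
    have h1 := MulCost.zdivPrice_le_of_linear (a := c) hΛ (hZ _ (hp.trans hS))
    have h2 : (len (p : ℤ) : ℝ) ≤ κ := by exact_mod_cast hp
    have h3 : Λ * len (p : ℤ) ≤ Λ * κ := by gcongr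
    simp
    linarith
  | node p l r ihl ihr =>
    have hroot := ht.len_root_le fun p hp => (hκ p hp).2
    have hrootpos : 0 < p := by
      change 0 < (PTree.node p l r).root
      rw [ht.root_eq]
      exact List.prod_pos fun a ha => (hκ a ha).1
    obtain ⟨h1, h2, h3⟩ := ht
    simp only [PTree.leaves, List.length_append, List.mem_append, PTree.root] at hκ hS hroot
    have hv : len (c % (p : ℤ)) ≤ (l.leaves.length + r.leaves.length) * κ := by
      refine le_trans (len_mono ?_) hroot
      have := Int.emod_nonneg c (b := p) (by omega)
      have := Int.emod_lt_of_pos c (b := p) (by omega)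
      omega
    have a1 := ihl h2 (fun q hq => hκ q (Or.inl hq)) (le_trans (by gcongr; omega) hS) (c % p)
    have a2 := ihr h3 (fun q hq => hκ q (Or.inr hq)) (le_trans (by gcongr; omega) hS) (c % p)
    have a3 := MulCost.zdivPrice_le_of_linear (a := c) hΛ (hZ _ (hroot.trans hS))
    simp only [remTree, zmod, Timed.time_bind, tick_time, tick_val, Timed.time_pure, PTree.depth,
      PTree.leaves, List.length_append]
    have hv' : (len (c % (p : ℤ)) : ℝ) ≤ ((l.leaves.length + r.leaves.length) * κ : ℕ) := by
      exact_mod_cast hv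
    have hroot' : (len (p : ℤ) : ℝ) ≤ ((l.leaves.length + r.leaves.length) * κ : ℕ) := by
      exact_mod_cast hroot
    have d1 : (l.depth : ℝ) ≤ (max l.depth r.depth : ℕ) := by exact_mod_cast le_max_left _ _
    have d2 : (r.depth : ℝ) ≤ (max l.depth r.depth : ℕ) := by exact_mod_cast le_max_right _ _
    generalize (max l.depth r.depth : ℕ) = m at *
    have b1 : (3 * (l.depth : ℝ) + 1) * (l.leaves.length * κ : ℕ)
        ≤ (3 * (m : ℝ) + 1) * (l.leaves.length * κ : ℕ) := by gcongr
    have b2 : (3 * (r.depth : ℝ) + 1) * (r.leaves.length * κ : ℕ)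
        ≤ (3 * (m : ℝ) + 1) * (r.leaves.length * κ : ℕ) := by gcongr
    calc _ ≤ Λ * (len c + len (p : ℤ))
          + (Λ * (len (c % (p : ℤ)) + (3 * l.depth + 1) * (l.leaves.length * κ : ℕ))
            + (Λ * (len (c % (p : ℤ)) + (3 * r.depth + 1) * (r.leaves.length * κ : ℕ)) + 0)) := by
          gcongr
      _ = Λ * ((len c + len (p : ℤ)) + (len (c % (p : ℤ)) + (3 * l.depth + 1) * (l.leaves.length * κ : ℕ))
            + (len (c % (p : ℤ)) + (3 * r.depth + 1) * (r.leaves.length * κ : ℕ))) := by ring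
      _ ≤ _ := by
        refine mul_le_mul_of_nonneg_left ?_ hΛ
        push_cast at *
        linarith

/-- Over `ℚ` one may divide by the root, and then the recursion `a * r.root + b * l.root` becomes
the plain addition of two sums of fractions. -/
theorem combTree_val {t : PTree} (ht : t.WF) (hpos : ∀ p ∈ t.leaves, 0 < p) {w : List ℤ}
    (hw : w.length = t.leaves.length) :
    ((combTree M t w).val : ℚ) = t.root * (List.zipWith (fun (a : ℤ) (p : ℕ) => (a / p : ℚ)) w t.leaves).sum := by
  induction t generalizing w with
  | leaf p =>
    obtain ⟨a, rfl⟩ := List.length_eq_one_iff.1 (hw.trans (by simp [PTree.leaves]))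
    have : (p : ℚ) ≠ 0 := by
      have := hpos p (by simp [PTree.leaves]); positivity
    simp [combTree, PTree.leaves, PTree.root]
    field_simp
  | node p l r ihl ihr =>
    obtain ⟨h1, h2, h3⟩ := ht
    simp only [PTree.leaves, List.length_append, List.mem_append] at hw hpos
    have a1 := ihl h2 (fun q hq => hpos q (Or.inl hq)) (w := w.take l.leaves.length) (by simp; omega)
    have a2 := ihr h3 (fun q hq => hpos q (Or.inr hq)) (w := w.drop l.leaves.length) (by simp; omega)
    simp only [combTree, Timed.val_bind, zmul, zadd, tick_val, PTree.leaves]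
    change _ = ((p : ℕ) : ℚ) * _
    rw [h1]
    conv_rhs => rw [← List.take_append_drop l.leaves.length w]
    rw [List.zipWith_append (by simp; omega), List.sum_append]
    push_cast
    rw [a1, a2]
    ring

theorem combTree_time_nonneg (t : PTree) (w : List ℤ) : 0 ≤ (combTree M t w).time := by
  induction t generalizing w with
  | leaf p => simp [combTree]
  | node p l r ihl ihr =>
    simp only [combTree, zmul, zadd, Timed.time_bind, tick_time]
    have := ihl (w.take l.leaves.length)
    have := ihr (w.drop l.leaves.length)
    have := M.Z_nonneg
    exact add_nonneg (by assumption) (add_nonneg (by assumption) (add_nonneg (this _)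
      (add_nonneg (this _) (Nat.cast_nonneg _))))

/-- With weights bounded by the leaves, each summand is at most the root. The number of leaves is
itself no longer than `leaves.length * κ` binary digits, which explains the factor `2` in the
length. Each node performs two products and one addition of numbers of this doubled length; this is
the `6`. -/
theorem combTree_spec (hΛ : 1 ≤ Λ) (hZ : ∀ x ≤ S, M.Z x ≤ Λ * x) {t : PTree} (ht : t.WF)
    (hκ : ∀ p ∈ t.leaves, 0 < p ∧ len (p : ℤ) ≤ κ) (hS : 2 * (t.leaves.length * κ) ≤ S)
    {w : List ℤ} (hw : List.Forall₂ (fun (a : ℤ) (p : ℕ) => |a| ≤ p) w t.leaves) :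
    |(combTree M t w).val| ≤ t.leaves.length * (t.root : ℤ) ∧
    len (combTree M t w).val ≤ 2 * (t.leaves.length * κ) ∧
    (combTree M t w).time ≤ 6 * Λ * t.depth * (t.leaves.length * κ : ℕ) := by
  have key : ∀ {t : PTree}, t.WF → (∀ p ∈ t.leaves, 0 < p ∧ len (p : ℤ) ≤ κ) → ∀ {z : ℤ},
      |z| ≤ t.leaves.length * (t.root : ℤ) → len z ≤ 2 * (t.leaves.length * κ) := by
    intro t ht hκ z hz
    have h1 := ht.len_root_le fun p hp => (hκ p hp).2
    have hl := List.length_pos_iff.2 t.leaves_ne_nil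
    have hκ1 : 1 ≤ κ := by
      obtain ⟨p, hp⟩ := List.exists_mem_of_ne_nil _ t.leaves_ne_nil
      exact (one_le_len _).trans (hκ p hp).2
    have h3 : t.leaves.length ≤ t.leaves.length * κ := Nat.le_mul_of_pos_right _ hκ1
    have h2 : len (t.leaves.length : ℤ) ≤ t.leaves.length := by
      rw [len_le_iff hl]; simpa using Nat.lt_two_pow_self
    calc len z ≤ len (t.leaves.length * (t.root : ℤ)) := len_mono (by
          rw [← Int.ofNat_le, Int.natCast_natAbs, Int.natCast_natAbs]
          exact hz.trans (le_abs_self _))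
      _ ≤ _ := (len_mul_le _ _).trans (by omega)
  suffices h : |(combTree M t w).val| ≤ t.leaves.length * (t.root : ℤ) ∧
      (combTree M t w).time ≤ 6 * Λ * t.depth * (t.leaves.length * κ : ℕ) from
    ⟨h.1, key ht hκ h.1, h.2⟩
  induction t generalizing w with
  | leaf p =>
    simp only [PTree.leaves] at hw
    obtain ⟨a, rfl⟩ := List.length_eq_one_iff.1 hw.length_eq
    have : |a| ≤ p := by simpa using hw
    simpa [combTree, PTree.leaves, PTree.root, PTree.depth] using this
  | node p l r ihl ihr =>
    have hp : (PTree.node p l r).root = p := rfl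
    obtain ⟨h1, h2, h3⟩ := id ht
    have hk : ∀ {z : ℤ}, |z| ≤ _ → len z ≤ _ := key ht hκ
    simp only [PTree.leaves, List.length_append, List.mem_append, hp] at hκ hS hw hk ⊢
    have hw1 := List.forall₂_take_append _ _ _ hw
    have hw2 := List.forall₂_drop_append _ _ _ hw
    set L₁ := l.leaves.length with hL₁
    set L₂ := r.leaves.length with hL₂
    have m1 : 2 * (L₁ * κ) ≤ S := le_trans (by gcongr; omega) hS
    have m2 : 2 * (L₂ * κ) ≤ S := le_trans (by gcongr; omega) hS
    obtain ⟨a1, a2⟩ := ihl h2 (fun q hq => hκ q (Or.inl hq)) m1 hw1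
    obtain ⟨b1, b2⟩ := ihr h3 (fun q hq => hκ q (Or.inr hq)) m2 hw2
    have a3 := key h2 (fun q hq => hκ q (Or.inl hq)) a1
    have b3 := key h3 (fun q hq => hκ q (Or.inr hq)) b1
    have a4 := h2.len_root_le fun q hq => (hκ q (Or.inl hq)).2
    have b4 := h3.len_root_le fun q hq => (hκ q (Or.inr hq)).2
    rw [← hL₁] at a3 a4
    rw [← hL₂] at b3 b4
    simp only [combTree, Timed.val_bind, Timed.time_bind, zmul, zadd, tick_val, tick_time]
    set x := (combTree M l (w.take L₁)).val
    set y := (combTree M r (w.drop L₁)).val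
    have hpcast : (p : ℤ) = l.root * r.root := by exact_mod_cast h1
    have e1 : |x * r.root| ≤ L₁ * (p : ℤ) := by
      rw [abs_mul, Nat.abs_cast, hpcast, ← mul_assoc]; gcongr
    have e2 : |y * l.root| ≤ L₂ * (p : ℤ) := by
      rw [abs_mul, Nat.abs_cast, hpcast, mul_comm (l.root : ℤ), ← mul_assoc]; gcongr
    have f1 : len (x * r.root) ≤ 2 * ((L₁ + L₂) * κ) := hk (e1.trans (by push_cast; gcongr; omega))
    have f2 : len (y * l.root) ≤ 2 * ((L₁ + L₂) * κ) := hk (e2.trans (by push_cast; gcongr; omega))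
    have sL₁ : L₁ * κ ≤ (L₁ + L₂) * κ := by gcongr; omega
    have sL₂ : L₂ * κ ≤ (L₁ + L₂) * κ := by gcongr; omega
    have z1 := (M.Z_mono (max_le (a3.trans (by omega)) (b4.trans (by omega)))).trans (hZ _ hS)
    have z2 := (M.Z_mono (max_le (b3.trans (by omega)) (a4.trans (by omega)))).trans (hZ _ hS)
    have z3 : ((max (len (x * r.root)) (len (y * l.root)) : ℕ) : ℝ)
        ≤ (2 * ((L₁ + L₂) * κ) : ℕ) := by exact_mod_cast max_le f1 f2
    refine ⟨(abs_add_le _ _).trans (by push_cast; linarith), ?_⟩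
    simp only [PTree.depth]
    have d1 : (l.depth : ℝ) ≤ (max l.depth r.depth : ℕ) := by exact_mod_cast le_max_left _ _
    have d2 : (r.depth : ℝ) ≤ (max l.depth r.depth : ℕ) := by exact_mod_cast le_max_right _ _
    have c1 : 6 * Λ * (l.depth : ℝ) * (L₁ * κ : ℕ)
        ≤ 6 * Λ * (max l.depth r.depth : ℕ) * (L₁ * κ : ℕ) := by gcongr
    have c2 : 6 * Λ * (r.depth : ℝ) * (L₂ * κ : ℕ)
        ≤ 6 * Λ * (max l.depth r.depth : ℕ) * (L₂ * κ : ℕ) := by gcongr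
    have c3 : (2 * ((L₁ + L₂) * κ) : ℕ) ≤ Λ * (2 * ((L₁ + L₂) * κ) : ℕ) :=
      le_mul_of_one_le_left (Nat.cast_nonneg _) hΛ
    push_cast at *
    linarith

/-! ## Chinese remaindering over the integers -/

variable {k : ℕ} {t : PTree} {q : Fin k → ℕ}

theorem combTree_ofFn_val (ht : t.WF) (hl : t.leaves = List.ofFn q) (hq : ∀ j, 0 < q j)
    (w : Fin k → ℤ) :
    (combTree M t (List.ofFn w)).val = ∑ j, w j * ∏ i ∈ Finset.univ.erase j, (q i : ℤ) := by
  have h := combTree_val (M := M) ht (w := List.ofFn w) (by rw [hl]; simpa [List.mem_ofFn] using hq)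
    (by simp [hl])
  have hz : List.zipWith (fun (a : ℤ) (p : ℕ) => (a / p : ℚ)) (List.ofFn w) (List.ofFn q)
      = List.ofFn fun j => (w j / q j : ℚ) := by
    apply List.ext_getElem <;> simp
  rw [hl, hz, List.sum_ofFn, ht.root_eq, hl, List.prod_ofFn, Finset.mul_sum] at h
  have h2 : ((combTree M t (List.ofFn w)).val : ℚ)
      = ((∑ j, w j * ∏ i ∈ Finset.univ.erase j, (q i : ℤ) : ℤ) : ℚ) := by
    rw [h]
    push_cast
    refine Finset.sum_congr rfl fun j _ => ?_
    rw [← Finset.mul_prod_erase _ _ (Finset.mem_univ j)]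
    have := (hq j).ne'
    field_simp
  exact_mod_cast h2

theorem sum_mul_prod_erase_modEq (w : Fin k → ℤ) (j : Fin k) :
    ∑ i, w i * ∏ l ∈ Finset.univ.erase i, (q l : ℤ)
      ≡ w j * ∏ l ∈ Finset.univ.erase j, (q l : ℤ) [ZMOD q j] := by
  rw [← Finset.add_sum_erase _ _ (Finset.mem_univ j)]
  refine Int.ModEq.symm (Int.modEq_iff_dvd.2 ?_)
  rw [add_sub_cancel_left]
  refine Finset.dvd_sum fun i hi => ?_
  exact Dvd.dvd.mul_left (Finset.dvd_prod_of_mem (fun l => (q l : ℤ))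
    (Finset.mem_erase.2 ⟨(Finset.ne_of_mem_erase hi).symm, Finset.mem_univ j⟩)) _

theorem mul_zinv_modEq {a m : ℤ} (h : IsCoprime a m) : a * (zinv M a m).val ≡ 1 [ZMOD m] := by
  have h1 := Int.gcd_eq_gcd_ab a m
  rw [Int.isCoprime_iff_gcd_eq_one.1 h] at h1
  have h2 : a * Int.gcdA a m ≡ 1 [ZMOD m] :=
    (Int.modEq_iff_dvd.2 ⟨Int.gcdB a m, by push_cast at h1; linarith⟩)
  exact ((Int.mod_modEq _ _).mul_left a).trans h2

theorem zinv_time_nonneg (a m : ℤ) : 0 ≤ (zinv M a m).time :=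
  mul_nonneg (M.Z_nonneg _) (Nat.cast_nonneg _)

theorem emod_natAbs_le (a : ℤ) {m : ℕ} (hm : 0 < m) : (a % (m : ℤ)).natAbs ≤ (m : ℤ).natAbs := by
  have := Int.emod_nonneg a (b := m) (by omega)
  have := Int.emod_lt_of_pos a (b := m) (by omega)
  omega

theorem len_emod_le (a : ℤ) {m : ℕ} (hm : 0 < m) : len (a % (m : ℤ)) ≤ len (m : ℤ) :=
  len_mono (emod_natAbs_le a hm)

theorem crtPrep_val_apply (ht : t.WF) (hl : t.leaves = List.ofFn q) (j : Fin k) :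
    (crtPrep M t q).val j = (zinv M ((combTree M t (List.ofFn fun _ : Fin k => 1)).val % (q j : ℤ)) (q j)).val := by
  simp only [crtPrep, Timed.val_bind, forFin_val, remTree_val ht, hl, List.ofFn_const]
  simp

theorem crtPrep_modEq (ht : t.WF) (hl : t.leaves = List.ofFn q) (hq : ∀ j, (q j).Prime)
    (hinj : Function.Injective q) (j : Fin k) :
    (∏ i ∈ Finset.univ.erase j, (q i : ℤ)) * (crtPrep M t q).val j ≡ 1 [ZMOD q j] := by
  have h1 : (combTree M t (List.ofFn fun _ : Fin k => 1)).val % (q j : ℤ)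
      ≡ ∏ i ∈ Finset.univ.erase j, (q i : ℤ) [ZMOD q j] := by
    refine (Int.mod_modEq _ _).trans ?_
    rw [combTree_ofFn_val ht hl fun j => (hq j).pos]
    simpa using sum_mul_prod_erase_modEq (q := q) (fun _ => 1) j
  have h2 : IsCoprime (∏ i ∈ Finset.univ.erase j, (q i : ℤ)) (q j : ℤ) :=
    IsCoprime.prod_left fun i hi => Nat.isCoprime_iff_coprime.2
      ((Nat.coprime_primes (hq i) (hq j)).2 fun h => Finset.ne_of_mem_erase hi (hinj h))
  have h3 : IsCoprime ((combTree M t (List.ofFn fun _ : Fin k => 1)).val % (q j : ℤ)) (q j : ℤ) := by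
    obtain ⟨c, hc⟩ := h1.symm.dvd
    obtain ⟨u, v, huv⟩ := h2
    refine ⟨u, v - u * c, ?_⟩
    linear_combination huv + u * hc
  rw [crtPrep_val_apply ht hl]
  exact (h1.symm.mul_right _).trans (mul_zinv_modEq h3)

theorem crtPrep_len_le (ht : t.WF) (hl : t.leaves = List.ofFn q) (hq : ∀ j, 0 < q j) (j : Fin k) :
    len ((crtPrep M t q).val j) ≤ len (q j : ℤ) := by
  rw [crtPrep_val_apply ht hl]
  exact len_emod_le _ (hq j)

/-- The combination is congruent to `z` modulo each `q j`, hence modulo the product of these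
distinct primes, and `z` is its own residue of least absolute value because `2 |z|` is below the
product. -/
theorem crtZ_val (ht : t.WF) (hl : t.leaves = List.ofFn q) (hq : ∀ j, (q j).Prime)
    (hinj : Function.Injective q) {v : Fin k → ℤ} {z : ℤ} (hv : ∀ j, v j ≡ z [ZMOD q j])
    (hz : 2 * |z| < ∏ j, (q j : ℤ)) : (crtZ M t q (crtPrep M t q).val v).val = z := by
  simp only [crtZ, Timed.val_bind, forFin_val, zmul, zmod, tick_val, zbmod]
  rw [combTree_ofFn_val ht hl fun j => (hq j).pos]
  have hroot : t.root = ∏ j, q j := by rw [ht.root_eq, hl, List.prod_ofFn]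
  have hcong : ∑ j, (v j * (crtPrep M t q).val j % (q j : ℤ)) * ∏ i ∈ Finset.univ.erase j, (q i : ℤ)
      ≡ z [ZMOD ((∏ j, q j : ℕ) : ℤ)] := by
    rw [Int.modEq_iff_dvd]
    push_cast
    refine Finset.prod_dvd_of_coprime (fun i _ j _ hij => Nat.isCoprime_iff_coprime.2
      ((Nat.coprime_primes (hq i) (hq j)).2 fun h => hij (hinj h))) fun j _ => ?_
    rw [← Int.modEq_iff_dvd]
    refine (sum_mul_prod_erase_modEq _ j).trans ?_
    refine ((Int.mod_modEq _ _).mul_right _).trans ?_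
    have := (crtPrep_modEq (M := M) ht hl hq hinj j).mul_left (v j)
    refine Int.ModEq.trans ?_ (this.trans (by simpa using hv j))
    rw [mul_assoc, mul_comm ((crtPrep M t q).val j)]
  have hQ : ((∏ j, q j : ℕ) : ℤ) = ∏ j, (q j : ℤ) := by push_cast; rfl
  have h1 : Int.bmod z t.root = z := by
    rw [hroot]
    rcases abs_le.1 (le_refl |z|) with ⟨h2, h3⟩
    apply Int.bmod_eq_of_le_mul_two <;> rw [hQ] <;> omega
  rw [← h1, hroot, ← Int.emod_bmod, hcong, Int.emod_bmod]

theorem crtPrep_time_nonneg : 0 ≤ (crtPrep M t q).time := by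
  simp only [crtPrep, Timed.time_bind, forFin_time]
  exact add_nonneg (combTree_time_nonneg _ _) (add_nonneg (remTree_time_nonneg _ _)
    (Finset.sum_nonneg fun _ _ => zinv_time_nonneg _ _))

theorem crtZ_time_nonneg (m v : Fin k → ℤ) : 0 ≤ (crtZ M t q m v).time := by
  simp only [crtZ, Timed.time_bind, forFin_time, zmul, zmod, zbmod, tick_time]
  exact add_nonneg (Finset.sum_nonneg fun _ _ => add_nonneg (M.Z_nonneg _) (M.zdivPrice_nonneg _ _))
    (add_nonneg (combTree_time_nonneg _ _) (M.zdivPrice_nonneg _ _))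

theorem forall₂_ofFn {α β : Type} {R : α → β → Prop} {f : Fin k → α} {g : Fin k → β}
    (h : ∀ j, R (f j) (g j)) : List.Forall₂ R (List.ofFn f) (List.ofFn g) := by
  rw [List.forall₂_iff_get]
  exact ⟨by simp, fun i h1 h2 => by simpa using h ⟨i, by simpa using h1⟩⟩

/-- The combination contributes `6 * depth`, the remainder tree `2 + (3 * depth + 1)` because its
input has length at most `2 * (k * κ)`, and the `k` inversions contribute `lg κ`. -/
theorem crtPrep_time_le (hΛ : 1 ≤ Λ) (hZ : ∀ x ≤ S, M.Z x ≤ Λ * x) (ht : t.WF)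
    (hl : t.leaves = List.ofFn q) (hκ : ∀ j, 0 < q j ∧ len (q j : ℤ) ≤ κ) (hS : 2 * (k * κ) ≤ S) :
    (crtPrep M t q).time ≤ Λ * (9 * t.depth + 3 + lg κ) * (k * κ : ℕ) := by
  have hlen : t.leaves.length = k := by simp [hl]
  have hκ' : ∀ p ∈ t.leaves, 0 < p ∧ len (p : ℤ) ≤ κ := by
    rw [hl]; simpa [List.mem_ofFn] using hκ
  have hΛ0 : 0 ≤ Λ := by linarith
  obtain ⟨-, a1, a2⟩ := combTree_spec (M := M) hΛ hZ ht hκ' (by rw [hlen]; exact hS)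
    (w := List.ofFn fun _ : Fin k => 1) (by
      rw [hl]; exact forall₂_ofFn fun j => by have := (hκ j).1; simp; omega)
  have a3 := remTree_time_le (M := M) hΛ0 hZ ht hκ' (by rw [hlen]; omega)
    (combTree M t (List.ofFn fun _ : Fin k => 1)).val
  rw [hlen] at a1 a2 a3
  have a1' : (len (combTree M t (List.ofFn fun _ : Fin k => 1)).val : ℝ) ≤ 2 * (k * κ : ℕ) := by
    exact_mod_cast a1
  have a4 : ∀ j : Fin k, (zinv M (((combTree M t (List.ofFn fun _ : Fin k => 1)).val % (q j : ℤ))) (q j)).time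
      ≤ Λ * κ * lg κ := by
    intro j
    have h1 := len_emod_le (combTree M t (List.ofFn fun _ : Fin k => 1)).val (hκ j).1
    have hk : 1 ≤ k := by have := j.2; omega
    have h2 : max (len ((combTree M t (List.ofFn fun _ : Fin k => 1)).val % (q j : ℤ))) (len (q j : ℤ)) ≤ κ :=
      max_le (h1.trans (hκ j).2) (hκ j).2
    have h3 : κ ≤ S := by nlinarith
    simp only [zinv, tick_time]
    have := hZ _ h3
    have h4 := M.Z_mono h2
    have h5 : (lg (max (len ((combTree M t (List.ofFn fun _ : Fin k => 1)).val % (q j : ℤ))) (len (q j : ℤ))) : ℝ)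
        ≤ lg κ := by exact_mod_cast lg_mono h2
    have := M.Z_nonneg κ
    gcongr
    exact h4.trans (hZ _ h3)
  simp only [crtPrep, Timed.time_bind, forFin_time, remTree_val ht, hl, ← List.ofFn_const]
  have a5 := Finset.sum_le_sum fun j (_ : j ∈ Finset.univ) => a4 j
  rw [Finset.sum_const, Finset.card_univ, Fintype.card_fin, nsmul_eq_mul] at a5
  have a6 : Λ * len (combTree M t (List.ofFn fun _ : Fin k => 1)).val ≤ Λ * (2 * (k * κ : ℕ)) := by
    gcongr
  have e : ∀ j : Fin k, (List.map (fun p : ℕ => (combTree M t (List.ofFn fun _ : Fin k => 1)).val % (p : ℤ))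
      (List.ofFn q)).getD (j : ℕ) 0 = (combTree M t (List.ofFn fun _ : Fin k => 1)).val % (q j : ℤ) := by
    intro j; simp
  simp only [e]
  push_cast at *
  linarith

/-- The `7` is made up of a product and a division of a number of length `2 κ` for each prime,
together `1 + 3`, and of `3` for the final division by the root. -/
theorem crtZ_time_le (hΛ : 1 ≤ Λ) (hZ : ∀ x ≤ S, M.Z x ≤ Λ * x) (ht : t.WF)
    (hl : t.leaves = List.ofFn q) (hκ : ∀ j, 0 < q j ∧ len (q j : ℤ) ≤ κ) (hS : 2 * (k * κ) ≤ S)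
    {m v : Fin k → ℤ} (hm : ∀ j, len (m j) ≤ κ) (hv : ∀ j, len (v j) ≤ κ) :
    (crtZ M t q m v).time ≤ Λ * (6 * t.depth + 7) * (k * κ : ℕ) := by
  have hlen : t.leaves.length = k := by simp [hl]
  have hκ' : ∀ p ∈ t.leaves, 0 < p ∧ len (p : ℤ) ≤ κ := by
    rw [hl]; simpa [List.mem_ofFn] using hκ
  have hΛ0 : 0 ≤ Λ := by linarith
  obtain ⟨-, a1, a2⟩ := combTree_spec (M := M) hΛ hZ ht hκ' (by rw [hlen]; exact hS)
    (w := List.ofFn fun j => v j * m j % (q j : ℤ)) (by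
      rw [hl]
      refine forall₂_ofFn fun j => ?_
      have := (hκ j).1
      have h1 := Int.emod_nonneg (v j * m j) (b := q j) (by omega)
      have h2 := Int.emod_lt_of_pos (v j * m j) (b := q j) (by omega)
      rw [abs_of_nonneg h1]; exact h2.le)
  have hr := ht.len_root_le fun p hp => (hκ' p hp).2
  rw [hlen] at a1 a2 hr
  have a3 := MulCost.zdivPrice_le_of_linear (M := M)
    (a := (combTree M t (List.ofFn fun j => v j * m j % (q j : ℤ))).val) (b := t.root) hΛ0
    (hZ _ (by omega))
  have a1' : (len (combTree M t (List.ofFn fun j => v j * m j % (q j : ℤ))).val : ℝ) ≤ 2 * (k * κ : ℕ) := by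
    exact_mod_cast a1
  have hr' : (len (t.root : ℤ) : ℝ) ≤ (k * κ : ℕ) := by exact_mod_cast hr
  have a4 : ∀ j, (M.Z (max (len (v j)) (len (m j)))) + zdivPrice M (v j * m j) (q j) ≤ 4 * Λ * κ := by
    intro j
    have hk : 1 ≤ k := by have := j.2; omega
    have h3 : κ ≤ S := by nlinarith
    have h4 := (M.Z_mono (max_le (hv j) (hm j))).trans (hZ _ h3)
    have h5 := MulCost.zdivPrice_le_of_linear (M := M) (a := v j * m j) hΛ0 (hZ _ ((hκ j).2.trans h3))
    have h6 : len (v j * m j) ≤ 2 * κ := (len_mul_le _ _).trans (by have := hv j; have := hm j; omega)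
    have h6' : (len (v j * m j) : ℝ) ≤ 2 * κ := by exact_mod_cast h6
    have h7 : (len (q j : ℤ) : ℝ) ≤ κ := by exact_mod_cast (hκ j).2
    have h8 : Λ * (len (v j * m j) + len (q j : ℤ)) ≤ Λ * (2 * κ + κ) := by gcongr
    linarith
  have a5 := Finset.sum_le_sum fun j (_ : j ∈ Finset.univ) => a4 j
  rw [Finset.sum_const, Finset.card_univ, Fintype.card_fin, nsmul_eq_mul] at a5
  simp only [crtZ, Timed.val_bind, forFin_val, Timed.time_bind, forFin_time, zmul, zmod, zbmod,
    tick_val, tick_time]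
  have a6 : Λ * (len (combTree M t (List.ofFn fun j => v j * m j % (q j : ℤ))).val + len (t.root : ℤ))
      ≤ Λ * (2 * (k * κ : ℕ) + (k * κ : ℕ)) := by gcongr
  push_cast at *
  linarith

end Trees

end CrtRoot

namespace CrtRoot

/-! ## Arithmetic of polynomials over `𝔽_q` -/

section Poly

variable {M : MulCost} {q : ℕ} [Fact q.Prime] {c : ℝ} {n κ : ℕ}

theorem plen_modByMonic_le {h : (ZMod q)[X]} (hh : h.Monic) (hn : h.natDegree ≤ n) (hn1 : 1 ≤ n)
    (a : (ZMod q)[X]) : plen (a %ₘ h) ≤ n := by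
  rcases eq_or_ne h 1 with rfl | h1
  · simpa [plen] using hn1
  · have := natDegree_modByMonic_lt a hh h1
    simp only [plen]
    omega

theorem dvd_modByMonic_sub {h : (ZMod q)[X]} (a : (ZMod q)[X]) : h ∣ a %ₘ h - a := by
  rw [dvd_sub_comm]
  exact ⟨a /ₘ h, by rw [sub_eq_iff_eq_add, add_comm]; exact (modByMonic_add_div a h).symm⟩

/-- By superadditivity the products for all full blocks of `a` cost no more than one product of the
size of `a`. -/
theorem pdivPrice_le (a h : (ZMod q)[X]) :
    pdivPrice M a h ≤ M.P (plen a) (len q) + M.P (plen h) (len q) := by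
  have h1 := M.mul_P_le (plen a / plen h) (plen h) (len q)
  have h2 := M.P_le (Nat.div_mul_le_self (plen a) (plen h)) (le_refl (len q))
  unfold pdivPrice
  push_cast
  linarith

theorem pdivPrice_nonneg (a h : (ZMod q)[X]) : 0 ≤ pdivPrice M a h :=
  mul_nonneg (Nat.cast_nonneg _) (M.P_nonneg _ _)

theorem euclidPrice_nonneg (q d : ℕ) : 0 ≤ euclidPrice M q d :=
  mul_nonneg (M.P_nonneg _ _) (by positivity)

theorem zpow_nonneg' (a : ℤ) (k : ℕ) : 0 ≤ (zpow M a k).time :=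
  powT_time_nonneg (fun _ _ => M.Z_nonneg _) _ _ _

theorem mulMod_nonneg (h a b : (ZMod q)[X]) : 0 ≤ (mulMod M h a b).time :=
  Timed.bind_nonneg (M.P_nonneg _ _) fun _ => pdivPrice_nonneg _ _

theorem powMod_nonneg (h a : (ZMod q)[X]) (k : ℕ) : 0 ≤ (powMod M h a k).time :=
  powT_time_nonneg (mulMod_nonneg h) _ _ _

/-- `n` and `κ` bound the degrees and the length of the prime. -/
structure Within (q n κ : ℕ) : Prop where
  one_le : 1 ≤ n
  len_le : len q ≤ κ

/-! ### Polynomial and integer operations modulo one prime, measured by `M.P n κ` -/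

namespace Within

theorem one_le_κ (h : Within q n κ) : 1 ≤ κ := (one_le_len _).trans h.len_le

theorem lt_two_pow (h : Within q n κ) : q < 2 ^ κ := by
  simpa using (len_le_iff h.one_le_κ).1 h.len_le

theorem mul_le (_h : Within q n κ) : (n * κ : ℝ) ≤ M.P n κ := M.le_P n κ

theorem κ_le (h : Within q n κ) : (κ : ℝ) ≤ M.P n κ := by
  have h1 : (1 : ℝ) ≤ n := by exact_mod_cast h.one_le
  have h2 : (0 : ℝ) ≤ κ := by positivity
  have := h.mul_le (M := M)
  nlinarith

theorem one_le_P (h : Within q n κ) : 1 ≤ M.P n κ := by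
  have h1 : (1 : ℝ) ≤ κ := by exact_mod_cast h.one_le_κ
  exact h1.trans h.κ_le

theorem P_le (h : Within q n κ) {d : ℕ} (hd : d ≤ n) : M.P d (len q) ≤ M.P n κ :=
  M.P_le hd h.len_le

/-- Unreduced products have almost `2 n` coefficients and a polynomial of degree `n` has `n + 1`;
the doubling property pays for both with a factor `c`. -/
theorem P_le' (h : Within q n κ) (hM : M.Tame c) {d : ℕ} (hd : d ≤ 2 * n) :
    M.P d (len q) ≤ c * M.P n κ :=
  (M.P_le hd h.len_le).trans (hM.double _ _)

theorem P_le_mul (_h : Within q n κ) (hM : M.Tame c) : M.P n κ ≤ c * M.P n κ :=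
  le_mul_of_one_le_left (M.P_nonneg _ _) (by linarith [hM.two_le])

theorem pdivPrice_le (h : Within q n κ) (hM : M.Tame c) {a g : (ZMod q)[X]} (ha : plen a ≤ 2 * n)
    (hg : plen g ≤ 2 * n) : pdivPrice M a g ≤ 2 * c * M.P n κ := by
  have := CrtRoot.pdivPrice_le (M := M) a g
  have := h.P_le' hM ha
  have := h.P_le' hM hg
  linarith

theorem mulMod_spec (hw : Within q n κ) (hM : M.Tame c) {h a b : (ZMod q)[X]} (hh : h.Monic)
    (hn : h.natDegree ≤ n) (ha : plen a ≤ n) (hb : plen b ≤ n) :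
    h ∣ (mulMod M h a b).val - a * b ∧ plen (mulMod M h a b).val ≤ n ∧
      (mulMod M h a b).time ≤ 3 * c * M.P n κ := by
  refine ⟨dvd_modByMonic_sub _, plen_modByMonic_le hh hn hw.one_le _, ?_⟩
  have h1 : plen (a * b) ≤ 2 * n := by
    have := natDegree_mul_le (p := a) (q := b)
    simp only [plen] at *
    omega
  have h2 := hw.pdivPrice_le hM h1 (g := h) (by simp only [plen]; have := hw.one_le; omega)
  have h3 := hw.P_le (M := M) (max_le ha hb)
  have h4 := hw.P_le_mul hM
  simp only [mulMod, pmul, pmod, Timed.time_bind, tick_time, tick_val]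
  linarith

theorem powMod_spec (hw : Within q n κ) (hM : M.Tame c) {h a : (ZMod q)[X]} (hh : h.Monic)
    (hn : h.natDegree ≤ n) (ha : plen a ≤ n) {k j : ℕ} (hk : k < 2 ^ j) :
    h ∣ (powMod M h a k).val - a ^ k ∧ plen (powMod M h a k).val ≤ n ∧
      (powMod M h a k).time ≤ 6 * c * j * M.P n κ := by
  have hc : 0 ≤ c * M.P n κ := mul_nonneg (by linarith [hM.two_le]) (M.P_nonneg _ _)
  have key := powT_spec (mul := mulMod M h) (one := 1) (x := a) (B := 3 * c * M.P n κ)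
    (P := fun i y => h ∣ y - a ^ i ∧ plen y ≤ n) (by linarith) k
    (by simpa [plen] using hw.one_le) (fun _ => by simpa using ha)
    (fun i j x y _ hx hy => by
      obtain ⟨h1, h2, -⟩ := hw.mulMod_spec hM hh hn hx.2 hy.2
      refine ⟨?_, h2⟩
      have h3 : h ∣ x * y - a ^ (i + j) := by
        have := dvd_add (hx.1.mul_right y) (hy.1.mul_left (a ^ i))
        rwa [show (x - a ^ i) * y + a ^ i * (y - a ^ j) = x * y - a ^ (i + j) by ring] at this
      simpa using dvd_add h1 h3)
    (fun i j x y _ hx hy => (hw.mulMod_spec hM hh hn hx.2 hy.2).2.2)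
  refine ⟨key.1.1, key.1.2, key.2.trans ?_⟩
  have h4 : (Nat.size k : ℝ) ≤ j := by exact_mod_cast Nat.size_le.2 hk
  calc 2 * (Nat.size k : ℝ) * (3 * c * M.P n κ) = 6 * Nat.size k * (c * M.P n κ) := by ring
    _ ≤ 6 * j * (c * M.P n κ) := by gcongr
    _ = _ := by ring

/-- `Y` absorbs both logarithms of the Euclidean algorithm, as `lg (len q) ≤ κ`. It also dominates
`κ`, the length of the exponent in a `q`-th power, and so serves as a common factor for the price of
one step of the factorisation. -/
theorem euclidPrice_le (hw : Within q n κ) (hM : M.Tame c) {Y : ℝ} (hY : (κ : ℝ) + lg (n + 1) ≤ Y)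
    {d : ℕ} (hd : d ≤ n + 1) : euclidPrice M q d ≤ c * Y * M.P n κ := by
  have h1 := hw.P_le' hM (d := d) (by have := hw.one_le; omega)
  have h2 : (lg d : ℝ) ≤ lg (n + 1) := by exact_mod_cast lg_mono hd
  have h3 : (lg (len q) : ℝ) ≤ κ := by
    exact_mod_cast (lg_le_self (one_le_len _)).trans hw.len_le
  unfold euclidPrice
  calc M.P d (len q) * ((lg d : ℝ) + lg (len q)) ≤ (c * M.P n κ) * (lg (n + 1) + κ) := by
        gcongr
        exact mul_nonneg (by linarith [hM.two_le]) (M.P_nonneg _ _)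
    _ ≤ (c * M.P n κ) * Y := by
        refine mul_le_mul_of_nonneg_left (by linarith) ?_
        exact mul_nonneg (by linarith [hM.two_le]) (M.P_nonneg _ _)
    _ = _ := by ring

theorem padd_time_le (hw : Within q n κ) {a b : (ZMod q)[X]} (ha : plen a ≤ n) (hb : plen b ≤ n) :
    (padd a b).time ≤ M.P n κ := by
  refine le_trans ?_ hw.mul_le
  simp only [padd, tick_time]
  exact_mod_cast Nat.mul_le_mul (max_le ha hb) hw.len_le

theorem psub_time_le (hw : Within q n κ) {a b : (ZMod q)[X]} (ha : plen a ≤ n + 1)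
    (hb : plen b ≤ n + 1) : (psub a b).time ≤ 2 * M.P n κ := by
  have h1 := hw.mul_le (M := M)
  have h2 := hw.κ_le (M := M)
  have h3 : ((max (plen a) (plen b) * len q : ℕ) : ℝ) ≤ ((n + 1) * κ : ℕ) := by
    exact_mod_cast Nat.mul_le_mul (max_le ha hb) hw.len_le
  simp only [psub, tick_time]
  push_cast at *
  linarith

/-- The order `q ^ d` of a residue field is computed within the length `d κ`. -/
theorem zpow_spec (hw : Within q n κ) (hM : M.Tame c) {d : ℕ} (hd : 1 ≤ d) :
    (zpow M q d).val = (q : ℤ) ^ d ∧ (zpow M q d).time ≤ 2 * c * (d * κ : ℕ) ^ 2 := by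
  have hdκ : 1 ≤ d * κ := Nat.mul_pos hd hw.one_le_κ
  have hl : ∀ i ≤ d, len ((q : ℤ) ^ i) ≤ d * κ := fun i hi =>
    (len_pow_le _ hi hd).trans (Nat.mul_le_mul_left _ hw.len_le)
  -- Since `powT_spec` meets only exponents with `i + j ≤ d`, every intermediate power stays within
  -- the length of the final one.
  have key := powT_spec (mul := zmul M) (one := 1) (x := (q : ℤ)) (B := M.Z (d * κ))
    (P := fun i y => y = (q : ℤ) ^ i) (M.Z_nonneg _) d (by simp) (by simp)
    (fun i j x y _ hx hy => by simp [zmul, hx, hy, pow_add])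
    (fun i j x y hij hx hy => by
      subst hx hy
      exact M.Z_mono (max_le (hl _ (by omega)) (hl _ (by omega))))
  refine ⟨key.1, key.2.trans ?_⟩
  have h1 := hM.quad (d * κ)
  have h2 : (Nat.size d : ℝ) ≤ lg (d * κ) := by
    exact_mod_cast (size_le_lg d).trans (lg_mono (Nat.le_mul_of_pos_right _ hw.one_le_κ))
  have h3 := M.Z_nonneg (d * κ)
  calc 2 * (Nat.size d : ℝ) * M.Z (d * κ) ≤ 2 * lg (d * κ) * M.Z (d * κ) := by gcongr
    _ ≤ _ := by linarith

theorem len_pow_le (hw : Within q n κ) {d : ℕ} (hd : 1 ≤ d) : len ((q : ℤ) ^ d) ≤ d * κ :=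
  (CrtRoot.len_pow_le _ le_rfl hd).trans (Nat.mul_le_mul_left _ hw.len_le)

end Within

/-! ## Residue fields -/

section ResidueField

variable {p : (ZMod q)[X]}

theorem dvd_sub_iff_mk_eq {h a b : (ZMod q)[X]} :
    h ∣ a - b ↔ AdjoinRoot.mk h a = AdjoinRoot.mk h b := by
  rw [AdjoinRoot.mk_eq_mk]

theorem natCard_adjoinRoot (hp : p ≠ 0) : Nat.card (AdjoinRoot p) = q ^ p.natDegree := by
  have := (AdjoinRoot.powerBasis hp).basis
  rw [Nat.card_congr this.equivFun.toEquiv]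
  simp [AdjoinRoot.powerBasis_dim]

theorem finite_adjoinRoot (hp : p ≠ 0) : Finite (AdjoinRoot p) :=
  Nat.finite_of_card_ne_zero (by
    rw [natCard_adjoinRoot hp]; exact pow_ne_zero _ (Fact.out : q.Prime).ne_zero)

theorem adjoinRoot_pow_card_sub_one (hp : Irreducible p) {x : AdjoinRoot p} (hx : x ≠ 0) :
    x ^ (q ^ p.natDegree - 1) = 1 := by
  have : Fact (Irreducible p) := ⟨hp⟩
  have := finite_adjoinRoot hp.ne_zero
  have := Fintype.ofFinite (AdjoinRoot p)
  rw [← natCard_adjoinRoot hp.ne_zero, Nat.card_eq_fintype_card]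
  exact FiniteField.pow_card_sub_one_eq_one x hx

/-- Positivity of the exponents covers `x = 0`. For this reason `expRed` sends positive exponents to
positive exponents. -/
theorem adjoinRoot_pow_eq_pow (hp : Irreducible p) (x : AdjoinRoot p) {a b : ℕ} (ha : 0 < a)
    (hb : 0 < b) (hab : a ≡ b [MOD q ^ p.natDegree - 1]) : x ^ a = x ^ b := by
  have : Fact (Irreducible p) := ⟨hp⟩
  rcases eq_or_ne x 0 with rfl | hx
  · rw [zero_pow ha.ne', zero_pow hb.ne']
  · exact pow_eq_pow_of_modEq hab (adjoinRoot_pow_card_sub_one hp hx)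

/-- Extraction of an `e`-th root by means of an inverse of `e` modulo the order of the group of
units. -/
theorem adjoinRoot_root (hp : Irreducible p) {x y : AdjoinRoot p} {e d : ℕ} (hxy : x ^ e = y)
    (hd : e * d ≡ 1 [MOD q ^ p.natDegree - 1]) (he : 0 < e) (hd0 : 0 < d) : y ^ d = x := by
  rw [← hxy, ← pow_mul, adjoinRoot_pow_eq_pow hp x (Nat.mul_pos he hd0) one_pos hd, pow_one]

end ResidueField

end Poly

end CrtRoot

namespace CrtRoot

/-! ## Correctness of the factorisation -/

section Factor

variable {M : MulCost} {q : ℕ} [Fact q.Prime] {c Y : ℝ} {n κ : ℕ}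

/-- `hd.1` is a non-trivial monic product of irreducible polynomials of degree `hd.2`. -/
structure EqualDegree (hd : (ZMod q)[X] × ℕ) : Prop where
  monic : hd.1.Monic
  ne_one : hd.1 ≠ 1
  natDegree_eq : ∀ p, Irreducible p → p ∣ hd.1 → p.natDegree = hd.2

theorem not_isUnit_of_monic {h : (ZMod q)[X]} (hh : h.Monic) (h1 : h ≠ 1) : ¬ IsUnit h :=
  fun hu => h1 (hh.eq_one_of_isUnit hu)

namespace EqualDegree

variable {hd : (ZMod q)[X] × ℕ}

theorem exists_factor (H : EqualDegree hd) :
    ∃ p, Irreducible p ∧ p ∣ hd.1 ∧ p.natDegree = hd.2 := by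
  obtain ⟨p, hp, hdvd⟩ := WfDvdMonoid.exists_irreducible_factor
    (not_isUnit_of_monic H.monic H.ne_one) H.monic.ne_zero
  exact ⟨p, hp, hdvd, H.natDegree_eq p hp hdvd⟩

theorem le_natDegree (H : EqualDegree hd) : hd.2 ≤ hd.1.natDegree := by
  obtain ⟨p, -, hdvd, hdeg⟩ := H.exists_factor
  exact hdeg ▸ natDegree_le_of_dvd hdvd H.monic.ne_zero

theorem one_le (H : EqualDegree hd) : 1 ≤ hd.2 := by
  obtain ⟨p, hp, -, hdeg⟩ := H.exists_factor
  exact hdeg ▸ hp.natDegree_pos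

theorem irreducible (H : EqualDegree hd) (h : hd.1.natDegree ≤ hd.2) : Irreducible hd.1 := by
  obtain ⟨p, hp, hdvd, hdeg⟩ := H.exists_factor
  have := associated_of_dvd_of_natDegree_le hdvd H.monic.ne_zero (by omega)
  exact this.irreducible hp

theorem of_dvd (H : EqualDegree hd) {g : (ZMod q)[X]} (hg : g.Monic) (h1 : g ≠ 1) (hdvd : g ∣ hd.1) :
    EqualDegree (g, hd.2) :=
  ⟨hg, h1, fun p hp hpg => H.natDegree_eq p hp (hpg.trans hdvd)⟩

/-- A reducible product of distinct irreducible polynomials has two coprime irreducible factors. -/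
theorem exists_two_factors (H : EqualDegree hd) (hs : Squarefree hd.1) (h : hd.2 < hd.1.natDegree) :
    ∃ p₁ p₂, Irreducible p₁ ∧ Irreducible p₂ ∧ IsCoprime p₁ p₂ ∧ p₁ * p₂ ∣ hd.1 := by
  obtain ⟨p, hp, ⟨r, hr⟩, hdeg⟩ := H.exists_factor
  have hr0 : r ≠ 0 := fun h0 => H.monic.ne_zero (by rw [hr, h0, mul_zero])
  have hrdeg : hd.1.natDegree = p.natDegree + r.natDegree := by
    rw [hr, natDegree_mul hp.ne_zero hr0]
  obtain ⟨p', hp', hdvd'⟩ := WfDvdMonoid.exists_irreducible_factor (a := r)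
    (fun hu => by have := natDegree_eq_zero_of_isUnit hu; omega) hr0
  have hmul : p * p' ∣ hd.1 := hr ▸ mul_dvd_mul_left p hdvd'
  refine ⟨p, p', hp, hp', (hp.coprime_iff_not_dvd).2 fun hpp => ?_, hmul⟩
  exact hp.not_isUnit (hs p ((mul_dvd_mul_left p hpp).trans hmul))

end EqualDegree

theorem monic_pgcd (a : (ZMod q)[X]) {b : (ZMod q)[X]} (hb : b ≠ 0) : (pgcd M a b).val.Monic := by
  refine monic_normalize fun h => hb ?_
  have := EuclideanDomain.gcd_dvd_right a b
  rwa [h, zero_dvd_iff] at this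

theorem dvd_pgcd_iff {p a b : (ZMod q)[X]} : p ∣ (pgcd M a b).val ↔ p ∣ a ∧ p ∣ b := by
  simp only [pgcd, tick_val, dvd_normalize_iff]
  exact ⟨fun h => ⟨h.trans (EuclideanDomain.gcd_dvd_left a b),
    h.trans (EuclideanDomain.gcd_dvd_right a b)⟩, fun h => EuclideanDomain.dvd_gcd h.1 h.2⟩

theorem pgcd_dvd_right (a b : (ZMod q)[X]) : (pgcd M a b).val ∣ b := (dvd_pgcd_iff.1 dvd_rfl).2

theorem mul_divByMonic_of_dvd {a h : (ZMod q)[X]} (hh : h.Monic) (hdvd : h ∣ a) : h * (a /ₘ h) = a := by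
  have := modByMonic_add_div a h
  rwa [(modByMonic_eq_zero_iff_dvd hh).2 hdvd, zero_add] at this

theorem monic_divByMonic_of_dvd {a h : (ZMod q)[X]} (ha : a.Monic) (hh : h.Monic) (hdvd : h ∣ a) :
    (a /ₘ h).Monic :=
  hh.of_mul_monic_left (by rwa [mul_divByMonic_of_dvd hh hdvd])

theorem two_le_of_within (hw : Within q n κ) (hY : (κ : ℝ) + lg (n + 1) ≤ Y) : 2 ≤ Y := by
  have h1 : (1 : ℝ) ≤ κ := by exact_mod_cast hw.one_le_κ
  have h2 : (1 : ℝ) ≤ lg (n + 1) := by exact_mod_cast one_le_lg _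
  linarith

/-- An irreducible `p` divides `X ^ q ^ (i + 1) - X` exactly if its degree divides `i + 1`. All
factors of `rem` have degree greater than `i`, so for them this means degree equal to `i + 1`, and
the gcd collects precisely these factors. When `i + fuel` reaches the degree of `f`, nothing can
remain. A round is dominated by the `q`-th power, which takes `6` of the `9` units `c * Y * M.P n
κ`. -/
theorem ddf_spec (hw : Within q n κ) (hM : M.Tame c) (hY : (κ : ℝ) + lg (n + 1) ≤ Y)
    {f : (ZMod q)[X]} (hf : f.Monic) (hs : Squarefree f) (hn : f.natDegree ≤ n) (fuel : ℕ) :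
    ∀ (i : ℕ) (g rem : (ZMod q)[X]), rem.Monic → rem ∣ f → (∀ p, Irreducible p → p ∣ rem → i < p.natDegree) →
      f ∣ g - X ^ q ^ i → plen g ≤ n → f.natDegree ≤ i + fuel →
      (∀ hd ∈ (ddf M f fuel i g rem).val, EqualDegree hd) ∧
      ((ddf M f fuel i g rem).val.map Prod.fst).prod = rem ∧
      (ddf M f fuel i g rem).time ≤ fuel * (9 * c * Y * M.P n κ) := by
  have hc := hM.two_le
  have hW := M.P_nonneg n κ
  have hY2 := two_le_of_within hw hY
  induction fuel with
  | zero =>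
    intro i g rem hrem hdvd hirr _ _ hdeg
    refine ⟨by simp [ddf], ?_, by simp [ddf]⟩
    simp only [ddf, Timed.val_pure, List.map_nil, List.prod_nil]
    by_contra h1
    obtain ⟨p, hp, hpd⟩ := WfDvdMonoid.exists_irreducible_factor
      (not_isUnit_of_monic hrem (Ne.symm h1)) hrem.ne_zero
    have h2 := hirr p hp hpd
    have h3 := natDegree_le_of_dvd (hpd.trans hdvd) hf.ne_zero
    omega
  | succ fuel ih =>
    intro i g rem hrem hdvd hirr hg hgn hdeg
    unfold ddf
    split_ifs with h1
    · subst h1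
      simp only [Timed.val_pure, Timed.time_pure]
      exact ⟨by simp, by simp, by positivity⟩
    · obtain ⟨a1, a2, a3⟩ := hw.powMod_spec hM hf hn hgn hw.lt_two_pow
      set g' := (powMod M f g q).val with hg'
      set w := (psub g' X).val with hw'
      set h := (pgcd M w rem).val with hh'
      have hmon : h.Monic := monic_pgcd _ hrem.ne_zero
      have hhrem : h ∣ rem := pgcd_dvd_right _ _
      have hmul : h * (rem /ₘ h) = rem := mul_divByMonic_of_dvd hmon hhrem
      have hg'2 : f ∣ g' - X ^ q ^ (i + 1) := by
        have h2 : f ∣ g ^ q - (X ^ q ^ i) ^ q := hg.trans (sub_dvd_pow_sub_pow _ _ _)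
        rw [← pow_mul, ← pow_succ] at h2
        simpa using dvd_add a1 h2
      have hkey : ∀ p, Irreducible p → p ∣ rem → (p ∣ h ↔ p.natDegree = i + 1) := by
        intro p hp hpr
        have h3 : p ∣ w ↔ p ∣ X ^ q ^ (i + 1) - X := by
          have h4 : p ∣ g' - X ^ q ^ (i + 1) := (hpr.trans hdvd).trans hg'2
          have h5 : w = (g' - X ^ q ^ (i + 1)) + (X ^ q ^ (i + 1) - X) := by
            simp [hw', psub]
          rw [h5, dvd_add_right h4]
        rw [dvd_pgcd_iff, and_iff_left hpr, h3]
        have h6 := hp.natDegree_dvd_iff_dvd_X_pow_card_pow_sub_X (n := i + 1)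
        rw [Nat.card_zmod] at h6
        rw [← h6]
        refine ⟨fun h7 => ?_, fun h7 => h7 ▸ dvd_rfl⟩
        have := hirr p hp hpr
        have := Nat.le_of_dvd (by omega) h7
        omega
      obtain ⟨b1, b2, b3⟩ := ih (i + 1) g' (rem /ₘ h) (monic_divByMonic_of_dvd hrem hmon hhrem)
        ((Dvd.intro_left _ hmul).trans hdvd) (fun p hp hpr => by
          have h2 : p ∣ rem := hpr.trans (Dvd.intro_left _ hmul)
          have h3 := hirr p hp h2
          -- If a factor of degree `i + 1` survived the division by `h`, it would divide both `h`
          -- and the quotient, and its square would divide the squarefree polynomial `f`.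
          refine lt_of_le_of_ne h3 fun h4 => hp.not_isUnit (hs p ?_)
          refine (mul_dvd_mul ((hkey p hp h2).2 h4.symm) hpr).trans ?_
          rwa [hmul]) hg'2 a2 (by omega)
      simp only [Timed.val_bind, Timed.time_bind, Timed.val_pure, Timed.time_pure]
      simp only [pdiv, tick_val, tick_time]
      rw [← hg', ← hw', ← hh']
      refine ⟨?_, ?_, ?_⟩
      · split_ifs with h2
        · exact b1
        · intro hd hmem
          rcases List.mem_cons.1 hmem with rfl | hmem
          · exact ⟨hmon, h2, fun p hp hph => (hkey p hp (hph.trans hhrem)).1 hph⟩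
          · exact b1 hd hmem
      · split_ifs with h2
        · rw [b2]; rw [h2, one_mul] at hmul; rw [h2]; exact hmul
        · rw [List.map_cons, List.prod_cons, b2, hmul]
      · have hwn : plen w ≤ n + 1 := by
          have h2 : w.natDegree ≤ max g'.natDegree 1 := by
            simpa [hw', psub] using natDegree_sub_le g' (X : (ZMod q)[X])
          have := hw.one_le
          simp only [plen] at *
          omega
        have hX : plen (X : (ZMod q)[X]) ≤ n + 1 := by simpa [plen] using hw.one_le
        have hrn : plen rem ≤ n + 1 := by
          have := natDegree_le_of_dvd hdvd hf.ne_zero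
          simp only [plen]; omega
        have hhn : plen h ≤ n + 1 := by
          have := natDegree_le_of_dvd hhrem hrem.ne_zero
          simp only [plen] at *; omega
        have h2n : n + 1 ≤ 2 * n := by have := hw.one_le; omega
        have t2 : (psub g' X).time ≤ 2 * M.P n κ := hw.psub_time_le (by omega) hX
        have t3 : (pgcd M w rem).time ≤ c * Y * M.P n κ := hw.euclidPrice_le hM hY (max_le hwn hrn)
        have t4 := hw.pdivPrice_le hM (hrn.trans h2n) (hhn.trans h2n)
        have t5 : c * κ * M.P n κ ≤ c * Y * M.P n κ := by
          have : (0 : ℝ) ≤ lg (n + 1) := by positivity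
          gcongr; linarith
        have t6 : c * 2 * M.P n κ ≤ c * Y * M.P n κ := by gcongr
        have t7 : 2 * M.P n κ ≤ c * M.P n κ := by gcongr
        push_cast
        linarith

/-! ### Equal-degree factorisation: effect of one attempt to split -/

theorem mul_half_pow {d : ℕ} : (((q : ℤ) ^ d - 1) / 2).toNat = (q ^ d - 1) / 2 := by
  have : 1 ≤ q ^ d := Nat.one_le_pow _ _ (Fact.out : q.Prime).pos
  rw [← Nat.cast_pow]
  generalize q ^ d = Q at *
  omega

/-- An attempt to split `hd` either fails and returns `hd`, or yields two factors. -/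
theorem splitOne_val_cases {hd : (ZMod q)[X] × ℕ} (H : EqualDegree hd) (a : (ZMod q)[X]) :
    (splitOne M a hd).val = [hd] ∨ ∃ g g', (splitOne M a hd).val = [(g, hd.2), (g', hd.2)] ∧
      EqualDegree (g, hd.2) ∧ EqualDegree (g', hd.2) ∧ g * g' = hd.1 := by
  unfold splitOne
  split_ifs with h1
  · exact Or.inl rfl
  · simp only [Timed.val_bind, Timed.val_pure]
    split_ifs with h2
    · exact Or.inl rfl
    · push Not at h2
      simp only [pdiv, tick_val] at h2 ⊢
      set g := (pgcd M _ hd.1).val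
      have hg : g.Monic := monic_pgcd _ H.monic.ne_zero
      have hdvd : g ∣ hd.1 := pgcd_dvd_right _ _
      have hmul := mul_divByMonic_of_dvd hg hdvd
      exact Or.inr ⟨g, _, rfl, H.of_dvd hg h2.1 hdvd,
        H.of_dvd (monic_divByMonic_of_dvd H.monic hg hdvd) h2.2 (Dvd.intro_left _ hmul), hmul⟩

/-- The attempt succeeds if `a ^ ((q ^ d - 1) / 2)` is `1` modulo exactly one of two irreducible
factors. -/
theorem splitOne_val_ne (hw : Within q n κ) (hM : M.Tame c) {hd : (ZMod q)[X] × ℕ}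
    (H : EqualDegree hd) (hn : hd.1.natDegree ≤ n) (hlt : hd.2 < hd.1.natDegree)
    {a p₁ p₂ : (ZMod q)[X]} (hp₁ : Irreducible p₁) (hd₁ : p₁ ∣ hd.1) (hd₂ : p₂ ∣ hd.1)
    (h₁ : p₁ ∣ a ^ ((q ^ hd.2 - 1) / 2) - 1) (h₂ : ¬ p₂ ∣ a ^ ((q ^ hd.2 - 1) / 2) - 1) :
    (splitOne M a hd).val ≠ [hd] := by
  unfold splitOne
  rw [if_neg (by omega)]
  simp only [Timed.val_bind, Timed.val_pure]
  have hz := (hw.zpow_spec hM H.one_le).1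
  simp only [hz, zsub, zdiv, pmod, psub, pdiv, tick_val, mul_half_pow]
  set E := (q ^ hd.2 - 1) / 2 with hE
  have hlt2 : E < 2 ^ (hd.2 * κ) := by
    calc E ≤ q ^ hd.2 - 1 := Nat.div_le_self _ _
      _ < q ^ hd.2 := Nat.sub_lt (Nat.pow_pos (Fact.out : q.Prime).pos) one_pos
      _ ≤ (2 ^ κ) ^ hd.2 := Nat.pow_le_pow_left hw.lt_two_pow.le _
      _ = _ := by rw [← pow_mul, mul_comm]
  have hb := (hw.powMod_spec hM H.monic hn (plen_modByMonic_le H.monic hn hw.one_le a) hlt2).1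
  have hb2 : hd.1 ∣ (powMod M hd.1 (a %ₘ hd.1) E).val - a ^ E := by
    have := dvd_add hb ((dvd_modByMonic_sub (h := hd.1) a).trans (sub_dvd_pow_sub_pow _ _ E))
    simpa using this
  have hiff : ∀ p, p ∣ hd.1 → (p ∣ (powMod M hd.1 (a %ₘ hd.1) E).val - 1 ↔ p ∣ a ^ E - 1) := by
    intro p hp
    rw [← dvd_add_right (hp.trans hb2) (c := a ^ E - 1)]
    simp
  set g := (pgcd M ((powMod M hd.1 (a %ₘ hd.1) E).val - 1) hd.1).val with hg'
  have hg : g.Monic := monic_pgcd _ H.monic.ne_zero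
  have hmul := mul_divByMonic_of_dvd hg (pgcd_dvd_right _ _)
  have hp₁g : p₁ ∣ g := dvd_pgcd_iff.2 ⟨(hiff p₁ hd₁).2 h₁, hd₁⟩
  have hp₂g : ¬ p₂ ∣ g := fun h => h₂ ((hiff p₂ hd₂).1 (dvd_pgcd_iff.1 h).1)
  rw [if_neg]
  · simp
  · rintro (h | h)
    · exact hp₁.not_isUnit (isUnit_of_dvd_one (h ▸ hp₁g))
    · rw [h, mul_one] at hmul
      exact hp₂g (hmul ▸ hd₂)

/-- Together, the members of the list are the product `f`. -/
structure FactorList (f : (ZMod q)[X]) (L : List ((ZMod q)[X] × ℕ)) : Prop where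
  eqDeg : ∀ hd ∈ L, EqualDegree hd
  prod_eq : (L.map Prod.fst).prod = f

theorem FactorList.split {f : (ZMod q)[X]} {L : List ((ZMod q)[X] × ℕ)} (H : FactorList f L)
    (a : (ZMod q)[X]) : FactorList f (forList (splitOne M a) L).val.flatten := by
  obtain ⟨h1, h2⟩ := H
  rw [forList_val]
  subst h2
  induction L with
  | nil => exact ⟨by simp, by simp⟩
  | cons hd L ih =>
    obtain ⟨b1, b2⟩ := ih fun x hx => h1 x (List.mem_cons_of_mem _ hx)
    have hH := h1 hd List.mem_cons_self
    rcases splitOne_val_cases (M := M) hH a with h | ⟨g, g', h, hg, hg', hmul⟩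
    · refine ⟨fun x hx => ?_, ?_⟩
      · rw [List.map_cons, List.flatten_cons, h, List.singleton_append, List.mem_cons] at hx
        rcases hx with rfl | hx
        · exact hH
        · exact b1 x hx
      · rw [List.map_cons, List.flatten_cons, h, List.singleton_append, List.map_cons,
          List.prod_cons, b2, List.map_cons, List.prod_cons]
    · refine ⟨fun x hx => ?_, ?_⟩
      · rw [List.map_cons, List.flatten_cons, h, List.cons_append, List.singleton_append,
          List.mem_cons, List.mem_cons] at hx
        rcases hx with rfl | rfl | hx
        · exact hg
        · exact hg'
        · exact b1 x hx
      · rw [List.map_cons, List.flatten_cons, h, List.cons_append, List.singleton_append,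
          List.map_cons, List.map_cons, List.prod_cons, List.prod_cons, b2, List.map_cons,
          List.prod_cons, ← mul_assoc, hmul]

/-- `S` lists the monic irreducible factors of `f`. -/
structure IsFactorization (f : (ZMod q)[X]) (S : List (ZMod q)[X]) : Prop where
  monic : ∀ h ∈ S, h.Monic
  irreducible : ∀ h ∈ S, Irreducible h
  prod_eq : S.prod = f

theorem FactorList.isFactorization {f : (ZMod q)[X]} {L : List ((ZMod q)[X] × ℕ)}
    (H : FactorList f L) (h : ∀ hd ∈ L, hd.1.natDegree ≤ hd.2) :
    IsFactorization f (L.map Prod.fst) := by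
  refine ⟨fun g hg => ?_, fun g hg => ?_, H.prod_eq⟩ <;> obtain ⟨hd, hmem, rfl⟩ := List.mem_map.1 hg
  · exact (H.eqDeg hd hmem).monic
  · exact (H.eqDeg hd hmem).irreducible (h hd hmem)

theorem edf_val {m : ℕ} (τs : List (Fin m → Fin q)) {f : (ZMod q)[X]} :
    ∀ {L : List ((ZMod q)[X] × ℕ)}, FactorList f L → ∀ {S}, (edf M τs L).val = some S →
      IsFactorization f S := by
  induction τs with
  | nil =>
    intro L H S hS
    simp only [edf, Timed.val_pure, Option.ite_none_right_eq_some, Option.some.injEq] at hS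
    exact hS.2 ▸ H.isFactorization hS.1
  | cons τ τs ih =>
    intro L H S hS
    unfold edf at hS
    split_ifs at hS with h
    · simp only [Timed.val_pure, Option.some.injEq] at hS
      exact hS ▸ H.isFactorization h
    · exact ih (H.split _) hS

theorem factorList_ddf (hw : Within q n κ) (hM : M.Tame c) (hY : (κ : ℝ) + lg (n + 1) ≤ Y)
    {f : (ZMod q)[X]} (hf : f.Monic) (hs : Squarefree f) (hn : f.natDegree ≤ n) :
    FactorList f (ddf M f f.natDegree 0 (X %ₘ f) f).val ∧
      (ddf M f f.natDegree 0 (X %ₘ f) f).time ≤ n * (9 * c * Y * M.P n κ) := by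
  obtain ⟨h1, h2, h3⟩ := ddf_spec hw hM hY hf hs hn f.natDegree 0 (X %ₘ f) f hf dvd_rfl
    (fun p hp _ => hp.natDegree_pos) (by simpa using dvd_modByMonic_sub (h := f) X)
    (plen_modByMonic_le hf hn hw.one_le _) (by simp)
  refine ⟨⟨h1, h2⟩, h3.trans ?_⟩
  have := hM.two_le
  have := M.P_nonneg n κ
  have := two_le_of_within hw hY
  gcongr

theorem factor_val (hw : Within q n κ) (hM : M.Tame c) (hY : (κ : ℝ) + lg (n + 1) ≤ Y)
    {f : (ZMod q)[X]} (hf : f.Monic) (hs : Squarefree f) (hn : f.natDegree ≤ n) {m : ℕ}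
    {τs : List (Fin m → Fin q)} {S : List (ZMod q)[X]} (hS : (factor M τs f).val = some S) :
    IsFactorization f S :=
  edf_val τs (factorList_ddf hw hM hY hf hs hn).1 hS

end Factor

end CrtRoot

noncomputable section
namespace CrtRoot

/-! ## The probability that an attempt to split succeeds -/

/-- All fibres of a surjective homomorphism have the same size, so the image of a uniformly
distributed element is uniformly distributed. This is applied to the two residues of a random
polynomial. -/
theorem card_preimage_mul_card {G H : Type*} [AddGroup G] [AddGroup H] [Fintype G] [Fintype H]
    [DecidableEq H] (f : G →+ H) (hf : Function.Surjective f) (S : Finset H) :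
    (Finset.univ.filter fun g => f g ∈ S).card * Fintype.card H = S.card * Fintype.card G := by
  have hfib : ∀ y, (Finset.univ.filter fun g => f g = y).card
      = (Finset.univ.filter fun g => f g = 0).card := fun y =>
    AddMonoidHom.card_fiber_eq_of_mem_range f (hf y) (hf 0)
  have h1 : (Finset.univ.filter fun g => f g ∈ S).card
      = S.card * (Finset.univ.filter fun g => f g = 0).card := by
    rw [Finset.card_eq_sum_card_fiberwise (f := f) (t := S) (by intro g; simp)]
    rw [Finset.sum_congr rfl (g := fun _ => (Finset.univ.filter fun g => f g = 0).card)]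
    · simp
    · intro y hy
      rw [← hfib y, Finset.filter_filter]
      congr 1
      ext g
      simp only [Finset.mem_filter, Finset.mem_univ, true_and, and_iff_right_iff_imp]
      rintro rfl; exact hy
  have h2 : Fintype.card G = Fintype.card H * (Finset.univ.filter fun g => f g = 0).card := by
    rw [← Finset.card_univ, Finset.card_eq_sum_card_fiberwise (f := f) (t := Finset.univ) (by simp)]
    simp [hfib]
  rw [h1, h2]; ring

/-- In a finite field with `Q` elements, `Q` odd, exactly `(Q - 1) / 2` elements satisfy
`x ^ ((Q - 1) / 2) = 1`. -/
theorem card_pow_half_eq_one {F : Type*} [Field F] [Fintype F] [DecidableEq F]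
    (hF : Fintype.card F % 2 = 1) :
    (Finset.univ.filter fun x : F => x ^ (Fintype.card F / 2) = 1).card = Fintype.card F / 2 := by
  have hchar : ringChar F ≠ 2 := fun h => by
    have := FiniteField.even_card_iff_char_two.1 h; omega
  have h0 : Fintype.card F / 2 ≠ 0 := by
    have := Fintype.one_lt_card (α := F); omega
  have h1 := quadraticChar_sum_zero hchar
  -- By Euler's criterion the character is `1` on the wanted set, `0` at `0` and `-1` elsewhere. As
  -- its values sum to zero, twice the size of the set is `|F| - 1`.
  have h2 : ∀ x : F, quadraticChar F x =
      2 * (if x ^ (Fintype.card F / 2) = 1 then 1 else 0) + (if x = 0 then 1 else 0) - 1 := by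
    intro x
    rcases eq_or_ne x 0 with rfl | hx
    · simp [zero_pow h0]
    · rw [quadraticChar_eq_pow_of_char_ne_two hchar hx]
      split_ifs <;> simp_all
  simp_rw [h2] at h1
  rw [Finset.sum_sub_distrib, Finset.sum_add_distrib, ← Finset.mul_sum, Finset.sum_boole,
    Finset.sum_boole] at h1
  have h3 : (Finset.univ.filter fun x : F => x = 0).card = 1 :=
    Finset.card_eq_one.2 ⟨0, by ext; simp⟩
  rw [h3] at h1
  simp only [Finset.sum_const, Finset.card_univ, nsmul_eq_mul, mul_one] at h1
  omega

section Split

variable {q : ℕ} [Fact q.Prime] {n : ℕ}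

/-- The random polynomial with given coefficients. -/
def randPoly (τ : Fin n → Fin q) : (ZMod q)[X] := ∑ i, C (((τ i : ℕ) : ZMod q)) * X ^ (i : ℕ)

/-- The polynomial with given coefficients, modulo `p₁` and modulo `p₂`. -/
def residues (p₁ p₂ : (ZMod q)[X]) : (Fin n → ZMod q) →+ AdjoinRoot p₁ × AdjoinRoot p₂ where
  toFun v := (AdjoinRoot.mk p₁ (∑ i, C (v i) * X ^ (i : ℕ)),
    AdjoinRoot.mk p₂ (∑ i, C (v i) * X ^ (i : ℕ)))
  map_zero' := by simp
  map_add' v w := by simp [add_mul, Finset.sum_add_distrib]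

/-- Bézout coefficients give a polynomial with prescribed residues. Its remainder modulo `p₁ * p₂`
has degree below `n`, so it is one of the polynomials that may be drawn. -/
theorem residues_surjective {p₁ p₂ : (ZMod q)[X]} (hcop : IsCoprime p₁ p₂)
    (hn : (p₁ * p₂).natDegree ≤ n) (hpos : (p₁ * p₂).natDegree ≠ 0) :
    Function.Surjective (residues (n := n) p₁ p₂) := by
  rintro ⟨x, y⟩
  obtain ⟨a, rfl⟩ := AdjoinRoot.mk_surjective x
  obtain ⟨b, rfl⟩ := AdjoinRoot.mk_surjective y
  obtain ⟨u, v, huv⟩ := hcop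
  set r := (b * (u * p₁) + a * (v * p₂)) % (p₁ * p₂) with hr
  have hrdvd : p₁ * p₂ ∣ r - (b * (u * p₁) + a * (v * p₂)) := by
    rw [dvd_sub_comm]
    exact ⟨_, (sub_eq_of_eq_add (EuclideanDomain.div_add_mod _ _).symm)⟩
  have hrn : r.natDegree < n := (natDegree_mod_lt _ hpos).trans_le hn
  have hsum : ∑ i : Fin n, C (r.coeff i) * X ^ (i : ℕ) = r := by
    rw [Fin.sum_univ_eq_sum_range (fun i => C (r.coeff i) * X ^ i)]
    exact (r.as_sum_range_C_mul_X_pow' hrn).symm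
  refine ⟨fun i => r.coeff i, ?_⟩
  simp only [residues, AddMonoidHom.coe_mk, ZeroHom.coe_mk, hsum]
  congr 1
  · rw [AdjoinRoot.mk_eq_mk]
    have := dvd_add ((dvd_mul_right p₁ p₂).trans hrdvd) (Dvd.intro_left ((b - a) * u) rfl :
      p₁ ∣ (b - a) * u * p₁)
    convert this using 1
    linear_combination a * huv
  · rw [AdjoinRoot.mk_eq_mk]
    have := dvd_add ((dvd_mul_left p₂ p₁).trans hrdvd) (Dvd.intro_left ((a - b) * v) rfl :
      p₂ ∣ (a - b) * v * p₂)
    convert this using 1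
    linear_combination b * huv

theorem natCast_fin_bijective : Function.Bijective fun i : Fin q => ((i : ℕ) : ZMod q) := by
  rw [Fintype.bijective_iff_injective_and_card]
  refine ⟨fun i j h => ?_, by simp [ZMod.card]⟩
  have := (ZMod.natCast_eq_natCast_iff' _ _ _).1 h
  rw [Nat.mod_eq_of_lt i.2, Nat.mod_eq_of_lt j.2] at this
  exact Fin.ext this

/-- A random polynomial has with probability at least `1/5` different quadratic characters modulo
two coprime irreducible polynomials of the same degree. -/
theorem card_le_five_mul_card_split (hq : Odd q) {p₁ p₂ : (ZMod q)[X]} {d : ℕ}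
    (hp₁ : Irreducible p₁) (hp₂ : Irreducible p₂) (hd₁ : p₁.natDegree = d) (hd₂ : p₂.natDegree = d)
    (hcop : IsCoprime p₁ p₂) (hn : (p₁ * p₂).natDegree ≤ n) :
    Fintype.card (Fin n → Fin q) ≤ 5 * Nat.card {τ : Fin n → Fin q //
      p₁ ∣ randPoly τ ^ ((q ^ d - 1) / 2) - 1 ∧ ¬ p₂ ∣ randPoly τ ^ ((q ^ d - 1) / 2) - 1 ∨
      ¬ p₁ ∣ randPoly τ ^ ((q ^ d - 1) / 2) - 1 ∧ p₂ ∣ randPoly τ ^ ((q ^ d - 1) / 2) - 1} := by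
  classical
  have : Fact (Irreducible p₁) := ⟨hp₁⟩
  have : Fact (Irreducible p₂) := ⟨hp₂⟩
  have := finite_adjoinRoot hp₁.ne_zero
  have := finite_adjoinRoot hp₂.ne_zero
  let _ := Fintype.ofFinite (AdjoinRoot p₁)
  let _ := Fintype.ofFinite (AdjoinRoot p₂)
  set Q := q ^ d with hQ
  have hQodd : Q % 2 = 1 := Nat.odd_iff.1 hq.pow
  have hQ3 : 2 < Q := by
    have h1 : 1 < Q := Nat.one_lt_pow (by have := hp₁.natDegree_pos; omega)
      (Fact.out : q.Prime).one_lt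
    omega
  set E := (Q - 1) / 2 with hE
  have hE2 : E = Q / 2 := by omega
  have c₁ : Fintype.card (AdjoinRoot p₁) = Q := by
    rw [← Nat.card_eq_fintype_card, natCard_adjoinRoot hp₁.ne_zero, hd₁]
  have c₂ : Fintype.card (AdjoinRoot p₂) = Q := by
    rw [← Nat.card_eq_fintype_card, natCard_adjoinRoot hp₂.ne_zero, hd₂]
  have s₁ := card_pow_half_eq_one (F := AdjoinRoot p₁) (by rw [c₁]; exact hQodd)
  have s₂ := card_pow_half_eq_one (F := AdjoinRoot p₂) (by rw [c₂]; exact hQodd)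
  rw [c₁, ← hE2] at s₁
  rw [c₂, ← hE2] at s₂
  set A := Finset.univ.filter fun x : AdjoinRoot p₁ => x ^ E = 1
  set B := Finset.univ.filter fun x : AdjoinRoot p₂ => x ^ E = 1
  -- Success means that exactly one of the two residues has `E`-th power `1`.
  have hS : (A ×ˢ Bᶜ ∪ Aᶜ ×ˢ B).card = 2 * (E * (Q - E)) := by
    rw [Finset.card_union_of_disjoint, Finset.card_product, Finset.card_product,
      Finset.card_compl, Finset.card_compl, s₁, s₂, c₁, c₂]
    · ring
    · rw [Finset.disjoint_left]
      rintro ⟨x, y⟩ h1 h2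
      simp only [Finset.mem_product, Finset.mem_compl] at h1 h2
      exact h2.1 h1.1
  have hcount := card_preimage_mul_card (residues (n := n) p₁ p₂) (residues_surjective hcop hn (by
    rw [natDegree_mul hp₁.ne_zero hp₂.ne_zero]; have := hp₁.natDegree_pos; omega))
    (A ×ˢ Bᶜ ∪ Aᶜ ×ˢ B)
  rw [hS, Fintype.card_prod, c₁, c₂] at hcount
  have htrans : Nat.card {τ : Fin n → Fin q // p₁ ∣ randPoly τ ^ E - 1 ∧ ¬ p₂ ∣ randPoly τ ^ E - 1 ∨
      ¬ p₁ ∣ randPoly τ ^ E - 1 ∧ p₂ ∣ randPoly τ ^ E - 1}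
      = (Finset.univ.filter fun g => residues (n := n) p₁ p₂ g ∈ A ×ˢ Bᶜ ∪ Aᶜ ×ˢ B).card := by
    rw [← Nat.card_eq_finsetCard]
    refine Nat.card_congr (Equiv.subtypeEquiv
      (Equiv.piCongrRight fun _ => Equiv.ofBijective _ natCast_fin_bijective) fun τ => ?_)
    simp only [Finset.mem_filter, Finset.mem_univ, true_and, Finset.mem_union, Finset.mem_product,
      Finset.mem_compl, A, B, residues, AddMonoidHom.coe_mk, ZeroHom.coe_mk]
    rw [dvd_sub_iff_mk_eq, dvd_sub_iff_mk_eq]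
    simp only [map_pow, map_one]
    simp only [Equiv.piCongrRight_apply, Pi.map_apply, Equiv.ofBijective_apply, randPoly]
  have hcardV : Fintype.card (Fin n → Fin q) = Fintype.card (Fin n → ZMod q) := by
    simp [ZMod.card]
  rw [htrans, hcardV]
  generalize (Finset.univ.filter fun g => residues (n := n) p₁ p₂ g ∈ A ×ˢ Bᶜ ∪ Aᶜ ×ˢ B).card = x at *
  -- With `Q = 2k + 1` the success probability is `2k(k+1) / (2k+1)²`, which is close to one half;
  -- `1/5` is a crude lower bound that is convenient here.
  have h5 : Q * Q ≤ 5 * (2 * (E * (Q - E))) := by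
    obtain ⟨k, hk⟩ : ∃ k, Q = 2 * k + 1 := ⟨Q / 2, by omega⟩
    have : E = k := by omega
    have h6 : Q - E = k + 1 := by omega
    rw [h6, this, hk]
    have : 1 ≤ k := by omega
    nlinarith
  have hQQ : 0 < Q * Q := by positivity
  refine Nat.le_of_mul_le_mul_right (c := Q * Q) ?_ hQQ
  calc _ ≤ Fintype.card (Fin n → ZMod q) * (5 * (2 * (E * (Q - E)))) := by gcongr
    _ = 5 * (2 * (E * (Q - E)) * Fintype.card (Fin n → ZMod q)) := by ring
    _ = _ := by rw [← hcount]; ring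

end Split

end CrtRoot

end

noncomputable section
namespace CrtRoot

/-! ## The expected time of the equal-degree factorisation -/

section EdfTime

variable {M : MulCost} {q : ℕ} [Fact q.Prime] {c Y : ℝ} {n κ : ℕ}

theorem splitOne_nonneg (a : (ZMod q)[X]) (hd : (ZMod q)[X] × ℕ) :
    0 ≤ (splitOne M a hd).time := by
  unfold splitOne
  split_ifs
  · simp
  · exact Timed.bind_nonneg (zpow_nonneg' _ _) fun _ => Timed.bind_nonneg (Nat.cast_nonneg _) fun _ =>
      Timed.bind_nonneg (M.zdivPrice_nonneg _ _) fun _ => Timed.bind_nonneg (pdivPrice_nonneg _ _)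
      fun _ => Timed.bind_nonneg (powMod_nonneg _ _ _) fun _ => Timed.bind_nonneg (Nat.cast_nonneg _)
      fun _ => Timed.bind_nonneg (euclidPrice_nonneg _ _) fun _ =>
      Timed.bind_nonneg (pdivPrice_nonneg _ _) fun _ => le_rfl

theorem edf_nonneg {m : ℕ} (τs : List (Fin m → Fin q)) (L : List ((ZMod q)[X] × ℕ)) :
    0 ≤ (edf M τs L).time := by
  induction τs generalizing L with
  | nil => simp [edf]
  | cons τ τs ih =>
    unfold edf
    split_ifs
    · simp
    · exact Timed.bind_nonneg (Nat.cast_nonneg _) fun _ => Timed.bind_nonneg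
        (forList_nonneg (splitOne_nonneg _) _) fun _ => ih _

/-- If the supply of random polynomials is exhausted, then all of them have been paid for. -/
theorem length_le_edf_time {m : ℕ} (hm : 1 ≤ m) (τs : List (Fin m → Fin q))
    (L : List ((ZMod q)[X] × ℕ)) (h : (edf M τs L).val = none) :
    (τs.length : ℝ) ≤ (edf M τs L).time := by
  induction τs generalizing L with
  | nil => simp [edf]
  | cons τ τs ih =>
    unfold edf at h ⊢
    split_ifs at h ⊢ with h1
    simp only [Timed.val_bind, Timed.time_bind, tick_val, tick_time] at h ⊢
    have h2 := ih _ h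
    have h3 : 0 ≤ (forList (splitOne M (∑ i, C (((τ i : ℕ) : ZMod q)) * X ^ (i : ℕ))) L).time :=
      forList_nonneg (splitOne_nonneg _) _
    have h4 : (1 : ℝ) ≤ (m * len q : ℕ) := by exact_mod_cast Nat.mul_pos hm (one_le_len _)
    rw [List.length_cons]
    push_cast at h4 ⊢
    linarith

/-- The first term, proportional to the degree `hd.2`, pays for the power whose exponent has length
`hd.2 * κ` and for the computation of that exponent; the second covers divisions, the subtraction
and the gcd. -/
theorem splitOne_time_le (hw : Within q n κ) (hM : M.Tame c) (hY : (κ : ℝ) + lg (n + 1) ≤ Y)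
    {hd : (ZMod q)[X] × ℕ} (H : EqualDegree hd) (hn : hd.1.natDegree ≤ n) {a : (ZMod q)[X]}
    (ha : plen a ≤ n) :
    (splitOne M a hd).time ≤ hd.2 * (15 * c * κ * M.P n κ) + 7 * c * Y * M.P n κ := by
  have hc := hM.two_le
  have hW := M.P_nonneg n κ
  have hW1 := hw.one_le_P (M := M)
  have hY2 := two_le_of_within hw hY
  unfold splitOne
  split_ifs with h1
  · simp only [Timed.time_pure]; positivity
  obtain ⟨z1, z2⟩ := hw.zpow_spec hM H.one_le
  have hdn : hd.2 ≤ n := H.le_natDegree.trans hn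
  have hdκ : 1 ≤ hd.2 * κ := Nat.mul_pos H.one_le hw.one_le_κ
  have hdκW : ((hd.2 * κ : ℕ) : ℝ) ≤ M.P n κ :=
    le_trans (by push_cast; gcongr) (hw.mul_le (M := M))
  simp only [Timed.time_bind, Timed.time_pure, z1, zsub, zdiv, pmod, psub, pdiv,
    tick_val, tick_time, mul_half_pow]
  have hqd : 1 ≤ q ^ hd.2 := Nat.one_le_pow _ _ (Fact.out : q.Prime).pos
  have l1 : len ((q : ℤ) ^ hd.2) ≤ hd.2 * κ := hw.len_pow_le H.one_le
  have l2 : len ((q : ℤ) ^ hd.2 - 1) ≤ hd.2 * κ := by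
    refine (len_mono ?_).trans l1
    rw [← Nat.cast_pow]
    generalize q ^ hd.2 = Q at *
    omega
  have l3 : len 1 ≤ hd.2 * κ := le_trans (by decide) hdκ
  set E := (q ^ hd.2 - 1) / 2 with hE
  have hlt2 : E < 2 ^ (hd.2 * κ) := by
    calc E ≤ q ^ hd.2 - 1 := Nat.div_le_self _ _
      _ < q ^ hd.2 := Nat.sub_lt (Nat.pow_pos (Fact.out : q.Prime).pos) one_pos
      _ ≤ (2 ^ κ) ^ hd.2 := Nat.pow_le_pow_left hw.lt_two_pow.le _
      _ = _ := by rw [← pow_mul, mul_comm]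
  obtain ⟨-, b1, b2⟩ := hw.powMod_spec hM H.monic hn (plen_modByMonic_le H.monic hn hw.one_le a) hlt2
  set b := (powMod M hd.1 (a %ₘ hd.1) E).val
  have hb1 : plen (b - 1) ≤ n := by
    have := natDegree_sub_le b (1 : (ZMod q)[X])
    have := hw.one_le
    simp only [plen, natDegree_one] at *
    omega
  have hhn : plen hd.1 ≤ n + 1 := by simp only [plen]; omega
  set g := (pgcd M (b - 1) hd.1).val with hg
  have hgn : plen g ≤ n + 1 := by
    have : g.natDegree ≤ hd.1.natDegree := natDegree_le_of_dvd (pgcd_dvd_right _ _) H.monic.ne_zero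
    simp only [plen]; omega
  have h2n : n + 1 ≤ 2 * n := by have := hw.one_le; omega
  have t1 : ((max (len ((q : ℤ) ^ hd.2)) (len 1) : ℕ) : ℝ) ≤ (hd.2 * κ : ℕ) := by
    exact_mod_cast max_le l1 l3
  have t2 := hM.zdivPrice_le (a := (q : ℤ) ^ hd.2 - 1) (b := 2) l2 (t := 2) (by decide)
  have t3 := hw.pdivPrice_le hM (ha.trans (by omega)) (hhn.trans h2n)
  have t4 : ((max (plen b) (plen (1 : (ZMod q)[X])) * len q : ℕ) : ℝ) ≤ 2 * M.P n κ :=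
    hw.psub_time_le (M := M) (a := b) (b := 1) (by omega) (by simp [plen])
  have t5 : (pgcd M (b - 1) hd.1).time ≤ c * Y * M.P n κ :=
    hw.euclidPrice_le hM hY (max_le (by omega) hhn)
  have t6 := hw.pdivPrice_le hM (hhn.trans h2n) (hgn.trans h2n)
  set D : ℝ := ((hd.2 * κ : ℕ) : ℝ) with hD
  have hD0 : 0 ≤ D := Nat.cast_nonneg _
  have u1 : 2 * c * D ^ 2 ≤ 2 * c * D * M.P n κ := by
    rw [pow_two, ← mul_assoc]; gcongr
  have u2 : D ≤ c * D * M.P n κ := by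
    have : (1 : ℝ) ≤ c * M.P n κ := by nlinarith
    calc D = D * 1 := (mul_one _).symm
      _ ≤ D * (c * M.P n κ) := by gcongr
      _ = _ := by ring
  have u3 : c * D ≤ c * D * M.P n κ := le_mul_of_one_le_right (by positivity) hW1
  have u4 : c ≤ c * M.P n κ := le_mul_of_one_le_right (by positivity) hW1
  have u5 : c * M.P n κ * 2 ≤ c * M.P n κ * Y := by gcongr
  have u6 : 2 * M.P n κ ≤ c * M.P n κ := by gcongr
  have hDe : D = hd.2 * κ := by simp [hD]
  have e1 : hd.2 * (15 * c * κ * M.P n κ) = 15 * (c * D * M.P n κ) := by rw [hDe]; ring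
  rw [e1]
  push_cast at *
  linarith

/-- An upper bound for the expected time that is spent on `hd` and its factors. -/
def pot (Y₁ Y₂ : ℝ) (hd : (ZMod q)[X] × ℕ) : ℝ :=
  5 * ((hd.1.natDegree : ℝ) / hd.2 - 1) * (hd.2 * Y₁ + Y₂)

theorem EqualDegree.pot_nonneg {hd : (ZMod q)[X] × ℕ} (H : EqualDegree hd) {Y₁ Y₂ : ℝ} (h₁ : 0 ≤ Y₁)
    (h₂ : 0 ≤ Y₂) : 0 ≤ pot Y₁ Y₂ hd := by
  have h1 : (1 : ℝ) ≤ hd.2 := by exact_mod_cast H.one_le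
  have h2 : (hd.2 : ℝ) ≤ hd.1.natDegree := by exact_mod_cast H.le_natDegree
  have h3 : 1 ≤ (hd.1.natDegree : ℝ) / hd.2 := (one_le_div (by linarith)).2 h2
  unfold pot
  have : 0 ≤ (hd.1.natDegree : ℝ) / hd.2 - 1 := by linarith
  positivity

/-- The number of splittings is less than `natDegree / d` while the price of an attempt grows like
`d * Y₁`: the two factors `d` cancel, and the potential is linear in the degree. Summed over all
blocks it is therefore linear in the degree of `f`. -/
theorem EqualDegree.pot_le {hd : (ZMod q)[X] × ℕ} (H : EqualDegree hd) {Y₁ Y₂ : ℝ} (h₁ : 0 ≤ Y₁)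
    (h₂ : 0 ≤ Y₂) : pot Y₁ Y₂ hd ≤ hd.1.natDegree * (5 * (Y₁ + Y₂)) := by
  have h1 : (1 : ℝ) ≤ hd.2 := by exact_mod_cast H.one_le
  have h0 : (0 : ℝ) ≤ hd.1.natDegree := by positivity
  have h3 : (hd.1.natDegree : ℝ) / hd.2 ≤ hd.1.natDegree := div_le_self h0 h1
  have h4 : (hd.1.natDegree : ℝ) / hd.2 * hd.2 = hd.1.natDegree := by field_simp
  have e : pot Y₁ Y₂ hd = 5 * (((hd.1.natDegree : ℝ) / hd.2 * hd.2) * Y₁ - hd.2 * Y₁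
      + (hd.1.natDegree : ℝ) / hd.2 * Y₂ - Y₂) := by unfold pot; ring
  rw [e, h4]
  have h5 : (hd.1.natDegree : ℝ) / hd.2 * Y₂ ≤ hd.1.natDegree * Y₂ := by gcongr
  have h6 : 0 ≤ hd.2 * Y₁ := by positivity
  linarith

/-- A splitting lowers the potential by five times the price of an attempt. -/
theorem pot_split {Y₁ Y₂ : ℝ} {hd : (ZMod q)[X] × ℕ} {g g' : (ZMod q)[X]}
    (hg : EqualDegree (g, hd.2)) (hg' : EqualDegree (g', hd.2)) (hmul : g * g' = hd.1) :
    pot Y₁ Y₂ (g, hd.2) + pot Y₁ Y₂ (g', hd.2) = pot Y₁ Y₂ hd - 5 * (hd.2 * Y₁ + Y₂) := by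
  have h1 : hd.1.natDegree = g.natDegree + g'.natDegree := by
    rw [← hmul]; exact hg.monic.natDegree_mul hg'.monic
  simp only [pot, h1]
  push_cast
  ring

/-- The supermartingale property of the potential: price of an attempt plus the potential left
afterwards is on average at most the potential before. A success, which has probability at least
`1/5`, lowers the potential by five times the price bound, and a failure leaves it unchanged. The
surcharge `T`, levied on reducible members only, is reserved for the random draw. -/
theorem sum_splitOne_le (hw : Within q n κ) (hM : M.Tame c) (hq : Odd q)
    {hd : (ZMod q)[X] × ℕ} (H : EqualDegree hd) (hs : Squarefree hd.1) (hn : hd.1.natDegree ≤ n)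
    {Y₁ Y₂ T : ℝ} (hT : ∀ τ : Fin n → Fin q, (splitOne M (randPoly τ) hd).time + T ≤ hd.2 * Y₁ + Y₂)
    (hY : 0 ≤ hd.2 * Y₁ + Y₂) :
    ∑ τ : Fin n → Fin q, ((splitOne M (randPoly τ) hd).time + (if hd.1.natDegree ≤ hd.2 then 0 else T)
        + ((splitOne M (randPoly τ) hd).val.map (pot Y₁ Y₂)).sum)
      ≤ Fintype.card (Fin n → Fin q) * pot Y₁ Y₂ hd := by
  classical
  by_cases h1 : hd.1.natDegree ≤ hd.2
  · have h2 : ∀ τ : Fin n → Fin q, splitOne M (randPoly τ) hd = pure [hd] := fun τ => by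
      unfold splitOne; rw [if_pos h1]
    simp [h2, h1]
  · obtain ⟨p₁, p₂, hp₁, hp₂, hcop, hdvd⟩ := H.exists_two_factors hs (not_le.1 h1)
    have hd₁ : p₁ ∣ hd.1 := (dvd_mul_right _ _).trans hdvd
    have hd₂ : p₂ ∣ hd.1 := (dvd_mul_left _ _).trans hdvd
    have hcount := card_le_five_mul_card_split hq hp₁ hp₂ (H.natDegree_eq _ hp₁ hd₁)
      (H.natDegree_eq _ hp₂ hd₂) hcop ((natDegree_le_of_dvd hdvd H.monic.ne_zero).trans hn)
    set S := Finset.univ.filter fun τ : Fin n → Fin q => (splitOne M (randPoly τ) hd).val ≠ [hd] with hS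
    have hcount2 : Fintype.card (Fin n → Fin q) ≤ 5 * S.card := by
      refine hcount.trans (Nat.mul_le_mul_left 5 ?_)
      rw [Nat.card_eq_fintype_card, Fintype.card_subtype]
      refine Finset.card_le_card fun τ hτ => ?_
      rw [Finset.mem_filter] at hτ
      rw [hS, Finset.mem_filter]
      refine ⟨Finset.mem_univ _, ?_⟩
      rcases hτ.2 with h | h
      · exact splitOne_val_ne hw hM H hn (not_le.1 h1) hp₁ hd₁ hd₂ h.1 h.2
      · exact splitOne_val_ne hw hM H hn (not_le.1 h1) hp₂ hd₂ hd₁ h.2 h.1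
    have hpt : ∀ τ : Fin n → Fin q, (splitOne M (randPoly τ) hd).time
        + (if hd.1.natDegree ≤ hd.2 then 0 else T)
        + ((splitOne M (randPoly τ) hd).val.map (pot Y₁ Y₂)).sum
        ≤ (hd.2 * Y₁ + Y₂ + pot Y₁ Y₂ hd) - 5 * (hd.2 * Y₁ + Y₂) * (if τ ∈ S then 1 else 0) := by
      intro τ
      rw [if_neg h1]
      have h2 := hT τ
      rcases splitOne_val_cases (M := M) H (randPoly τ) with h | ⟨g, g', h, hg, hg', hmul⟩
      · have : τ ∉ S := by simp [hS, h]
        rw [if_neg this, h]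
        simp only [List.map_cons, List.map_nil, List.sum_cons, List.sum_nil]
        linarith
      · have h3 := pot_split (Y₁ := Y₁) (Y₂ := Y₂) hg hg' hmul
        have h4 : (if τ ∈ S then (1 : ℝ) else 0) ≤ 1 := by split_ifs <;> norm_num
        have h5 : 5 * (hd.2 * Y₁ + Y₂) * (if τ ∈ S then (1 : ℝ) else 0) ≤ 5 * (hd.2 * Y₁ + Y₂) * 1 := by
          gcongr
        rw [h]
        simp only [List.map_cons, List.map_nil, List.sum_cons, List.sum_nil]
        linarith
    refine (Finset.sum_le_sum fun τ _ => hpt τ).trans ?_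
    rw [Finset.sum_sub_distrib, ← Finset.mul_sum, Finset.sum_boole, Finset.sum_const, nsmul_eq_mul,
      Finset.card_univ]
    have h6 : (Fintype.card (Fin n → Fin q) : ℝ) ≤ 5 * S.card := by exact_mod_cast hcount2
    have h7 : Finset.univ.filter (fun τ => τ ∈ S) = S := by ext; simp
    rw [h7]
    have h8 : (Fintype.card (Fin n → Fin q) : ℝ) * (hd.2 * Y₁ + Y₂) ≤ 5 * S.card * (hd.2 * Y₁ + Y₂) := by
      gcongr
    linarith

theorem sum_fin_succ_tuple {α : Type} [Fintype α] {N : ℕ} (g : List α → ℝ) :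
    ∑ τs : Fin (N + 1) → α, g (List.ofFn τs) = ∑ τ : α, ∑ τs : Fin N → α, g (τ :: List.ofFn τs) := by
  rw [← (Fin.consEquiv fun _ => α).sum_comp, Fintype.sum_prod_type]
  simp [Fin.consEquiv]

theorem le_sum_map_of_mem {α : Type} {l : List α} {g : α → ℝ} (hg : ∀ x ∈ l, 0 ≤ g x) {a : α}
    (ha : a ∈ l) : g a ≤ (l.map g).sum :=
  List.single_le_sum (by simpa using hg) _ (List.mem_map_of_mem ha)

theorem randPoly_plen_le (hn : 1 ≤ n) (τ : Fin n → Fin q) : plen (randPoly τ) ≤ n := by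
  have : (randPoly τ).natDegree ≤ n - 1 := natDegree_sum_le_of_forall_le _ _ fun i _ =>
    (natDegree_C_mul_X_pow_le _ _).trans (by have := i.2; omega)
  simp only [plen]; omega

theorem FactorList.dvd {f : (ZMod q)[X]} {L : List ((ZMod q)[X] × ℕ)} (H : FactorList f L)
    {hd : (ZMod q)[X] × ℕ} (h : hd ∈ L) : hd.1 ∣ f :=
  H.prod_eq ▸ List.dvd_prod (List.mem_map_of_mem h)

/-- Induction on the supply, separating the first draw from the remaining ones: after a round the
expected remaining time is at most the new total potential, and `sum_splitOne_le` is summed over the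
list. The `8` in the second parameter of `pot` is the `7` of `splitOne_time_le` plus one unit for
the draw. -/
theorem sum_edf_time_le (hw : Within q n κ) (hM : M.Tame c) (hY : (κ : ℝ) + lg (n + 1) ≤ Y)
    (hq : Odd q) {f : (ZMod q)[X]} (hf : f ≠ 0) (hs : Squarefree f) (hn : f.natDegree ≤ n) (N : ℕ) :
    ∀ {L : List ((ZMod q)[X] × ℕ)}, FactorList f L →
      ∑ τs : Fin N → Fin n → Fin q, (edf M (List.ofFn τs) L).time
        ≤ (Fintype.card (Fin n → Fin q) : ℝ) ^ N *
          (L.map (pot (15 * c * κ * M.P n κ) (8 * c * Y * M.P n κ))).sum := by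
  have hc := hM.two_le
  have hW := M.P_nonneg n κ
  have hY2 := two_le_of_within hw hY
  set Y₁ := 15 * c * κ * M.P n κ with hY₁
  set Y₂ := 8 * c * Y * M.P n κ with hY₂
  have hY₁0 : 0 ≤ Y₁ := by positivity
  have hY₂0 : 0 ≤ Y₂ := by positivity
  set A : ℝ := (Fintype.card (Fin n → Fin q) : ℝ) with hA
  have hpot : ∀ {L : List ((ZMod q)[X] × ℕ)}, FactorList f L → 0 ≤ (L.map (pot Y₁ Y₂)).sum :=
    fun H => List.sum_nonneg (by
      rintro _ hx
      obtain ⟨hd, hmem, rfl⟩ := List.mem_map.1 hx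
      exact (H.eqDeg hd hmem).pot_nonneg hY₁0 hY₂0)
  induction N with
  | zero =>
    intro L H
    simpa [edf] using hpot H
  | succ N ih =>
    intro L H
    rw [sum_fin_succ_tuple (fun l => (edf M l L).time)]
    by_cases hall : ∀ hd ∈ L, hd.1.natDegree ≤ hd.2
    · have : ∀ (τ : Fin n → Fin q) (l : List (Fin n → Fin q)), (edf M (τ :: l) L).time = 0 := by
        intro τ l; unfold edf; rw [if_pos hall]; rfl
      simp only [this, Finset.sum_const_zero]
      have := hpot H
      positivity
    · have hedf : ∀ (τ : Fin n → Fin q) (l : List (Fin n → Fin q)), (edf M (τ :: l) L).time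
          = (n * len q : ℕ) + ((L.map fun hd => (splitOne M (randPoly τ) hd).time).sum
            + (edf M l (forList (splitOne M (randPoly τ)) L).val.flatten).time) := by
        intro τ l
        rw [edf, if_neg hall]
        simp only [Timed.time_bind, tick_val, tick_time, forList_time]
        rfl
      simp only [hedf, Finset.sum_add_distrib, Finset.sum_const, Finset.card_univ, nsmul_eq_mul]
      have hcardN : (Fintype.card (Fin N → Fin n → Fin q) : ℝ) = A ^ N := by
        simp [hA]
      rw [hcardN]
      have h1 : ∑ τ : Fin n → Fin q, ∑ τs : Fin N → Fin n → Fin q,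
          (edf M (List.ofFn τs) (forList (splitOne M (randPoly τ)) L).val.flatten).time
          ≤ ∑ τ : Fin n → Fin q, A ^ N *
            (L.map fun hd => ((splitOne M (randPoly τ) hd).val.map (pot Y₁ Y₂)).sum).sum := by
        refine Finset.sum_le_sum fun τ _ => (ih (H.split _)).trans_eq ?_
        rw [forList_val, List.map_flatten, List.sum_flatten, List.map_map, List.map_map]
        rfl
      have h2 : ∀ hd ∈ L, ∑ τ : Fin n → Fin q, ((splitOne M (randPoly τ) hd).time
          + (if hd.1.natDegree ≤ hd.2 then 0 else M.P n κ)
          + ((splitOne M (randPoly τ) hd).val.map (pot Y₁ Y₂)).sum) ≤ A * pot Y₁ Y₂ hd := by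
        intro hd hmem
        have hdvd := H.dvd hmem
        have hdn := (natDegree_le_of_dvd hdvd hf).trans hn
        refine sum_splitOne_le hw hM hq (H.eqDeg hd hmem) (hs.squarefree_of_dvd hdvd) hdn
          (fun τ => ?_) (by positivity)
        have h3 := splitOne_time_le hw hM hY (H.eqDeg hd hmem) hdn (randPoly_plen_le hw.one_le τ)
        have h4 : 1 * M.P n κ ≤ (c * Y) * M.P n κ := by gcongr; nlinarith
        linarith
      -- The draw is made once for the whole list. It is charged to a single reducible member, which
      -- exists because the algorithm has not stopped.
      have h3 : A * (n * len q : ℕ) ≤ ∑ τ : Fin n → Fin q,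
          (L.map fun hd => if hd.1.natDegree ≤ hd.2 then 0 else M.P n κ).sum := by
        push Not at hall
        obtain ⟨hd, hmem, hlt⟩ := hall
        have h4 : ((n * len q : ℕ) : ℝ) ≤ (L.map fun hd => if hd.1.natDegree ≤ hd.2 then 0 else M.P n κ).sum := by
          have h5 := le_sum_map_of_mem (g := fun hd : (ZMod q)[X] × ℕ =>
            if hd.1.natDegree ≤ hd.2 then 0 else M.P n κ) (fun x _ => by split_ifs; exacts [le_rfl, hW]) hmem
          simp only [not_le.2 hlt, if_false] at h5
          refine le_trans ?_ h5
          refine le_trans ?_ (hw.mul_le (M := M))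
          have := hw.len_le
          push_cast
          gcongr
        rw [Finset.sum_const, nsmul_eq_mul, Finset.card_univ]
        gcongr
      have h6 : ∑ τ : Fin n → Fin q, (L.map fun hd => (splitOne M (randPoly τ) hd).time).sum
          + ∑ τ : Fin n → Fin q, (L.map fun hd => if hd.1.natDegree ≤ hd.2 then 0 else M.P n κ).sum
          + ∑ τ : Fin n → Fin q, (L.map fun hd => ((splitOne M (randPoly τ) hd).val.map (pot Y₁ Y₂)).sum).sum
          ≤ A * (L.map (pot Y₁ Y₂)).sum := by
        rw [← Finset.sum_add_distrib, ← Finset.sum_add_distrib]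
        simp only [← List.sum_map_add]
        clear H hall h1 h3 hpot ih hedf
        induction L with
        | nil => simp
        | cons hd L ihL =>
          simp only [List.map_cons, List.sum_cons, Finset.sum_add_distrib] at ihL ⊢
          have h7 := h2 hd List.mem_cons_self
          simp only [Finset.sum_add_distrib] at h2 h7
          have h8 := ihL fun x hx => h2 x (List.mem_cons_of_mem _ hx)
          rw [mul_add]
          linarith
      rw [← Finset.mul_sum] at h1
      rw [← Finset.mul_sum, pow_succ]
      have h9 : 0 ≤ A ^ N := by positivity
      have h10 := mul_le_mul_of_nonneg_left h6 h9
      have h11 := mul_le_mul_of_nonneg_left h3 h9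
      simp only [mul_add] at h10
      linarith

theorem FactorList.sum_natDegree {f : (ZMod q)[X]} {L : List ((ZMod q)[X] × ℕ)} (H : FactorList f L) :
    (L.map fun hd => (hd.1.natDegree : ℝ)).sum = f.natDegree := by
  obtain ⟨h1, rfl⟩ := H
  have key : (L.map Prod.fst).prod.Monic ∧
      (L.map fun hd => (hd.1.natDegree : ℝ)).sum = ((L.map Prod.fst).prod.natDegree : ℝ) := by
    induction L with
    | nil => simp
    | cons hd L ih =>
      obtain ⟨a1, a2⟩ := ih fun x hx => h1 x (List.mem_cons_of_mem _ hx)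
      have h2 := (h1 hd List.mem_cons_self).monic
      refine ⟨by simpa using h2.mul a1, ?_⟩
      rw [List.map_cons, List.sum_cons, List.map_cons, List.prod_cons, h2.natDegree_mul a1, a2]
      push_cast; rfl
  exact key.2

/-- The average time of the factorisation over all supplies of random polynomials. -/
theorem sum_factor_time_le (hw : Within q n κ) (hM : M.Tame c) (hY : (κ : ℝ) + lg (n + 1) ≤ Y)
    (hq : Odd q) {f : (ZMod q)[X]} (hf : f.Monic) (hs : Squarefree f) (hn : f.natDegree ≤ n) (N : ℕ) :
    ∑ τs : Fin N → Fin n → Fin q, (factor M (List.ofFn τs) f).time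
      ≤ (Fintype.card (Fin N → Fin n → Fin q) : ℝ) * (n * (126 * c * Y * M.P n κ)) := by
  have hc := hM.two_le
  have hW := M.P_nonneg n κ
  have hY2 := two_le_of_within hw hY
  have hn1 : (1 : ℝ) ≤ n := by exact_mod_cast hw.one_le
  obtain ⟨h1, h2⟩ := factorList_ddf hw hM hY hf hs hn
  have h3 := sum_edf_time_le hw hM hY hq hf.ne_zero hs hn N h1
  have h2n : n + 1 ≤ 2 * n := by have := hw.one_le; omega
  have h4 := hw.pdivPrice_le hM (a := X) (g := f) (by simpa [plen] using hw.one_le)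
    (by simp only [plen]; omega)
  have h5 : ∀ τs : Fin N → Fin n → Fin q, (factor M (List.ofFn τs) f).time
      = pdivPrice M X f + ((ddf M f f.natDegree 0 (X %ₘ f) f).time
        + (edf M (List.ofFn τs) (ddf M f f.natDegree 0 (X %ₘ f) f).val).time) := fun _ => rfl
  simp only [h5, Finset.sum_add_distrib, Finset.sum_const, Finset.card_univ, nsmul_eq_mul]
  set Y₁ := 15 * c * κ * M.P n κ
  set Y₂ := 8 * c * Y * M.P n κ
  have hκY : (κ : ℝ) ≤ Y := by
    have : (0 : ℝ) ≤ lg (n + 1) := by positivity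
    linarith
  have h6 : ((ddf M f f.natDegree 0 (X %ₘ f) f).val.map (pot Y₁ Y₂)).sum ≤ n * (5 * (Y₁ + Y₂)) := by
    refine (List.sum_le_sum fun hd hmem => (h1.eqDeg hd hmem).pot_le (Y₁ := Y₁) (Y₂ := Y₂)
      (by positivity) (by positivity)).trans ?_
    rw [List.sum_map_mul_right, h1.sum_natDegree]
    gcongr
  have h7 : Y₁ ≤ 15 * c * Y * M.P n κ := by simp only [Y₁]; gcongr
  -- `115 = 5 * (15 + 8)`. With `9` for the distinct-degree stage and `2` for the initial division
  -- this gives the total `126`.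
  have h8 : n * (5 * (Y₁ + Y₂)) ≤ n * (115 * c * Y * M.P n κ) := by
    refine mul_le_mul_of_nonneg_left ?_ (by positivity)
    have : Y₂ = 8 * c * Y * M.P n κ := rfl
    linarith
  have h9 : 2 * c * M.P n κ ≤ n * (2 * c * Y * M.P n κ) := by
    have : 1 * (1 * (2 * c * M.P n κ)) ≤ n * (Y * (2 * c * M.P n κ)) := by gcongr; linarith
    linarith
  have h10 : (Fintype.card (Fin N → Fin n → Fin q) : ℝ) = (Fintype.card (Fin n → Fin q) : ℝ) ^ N := by
    rw [Fintype.card_fun, Fintype.card_fin, Nat.cast_pow]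
  rw [← h10] at h3
  have h11 : (0 : ℝ) ≤ (Fintype.card (Fin N → Fin n → Fin q) : ℝ) := by positivity
  have h12 := mul_le_mul_of_nonneg_left (h6.trans h8) h11
  have h13 := mul_le_mul_of_nonneg_left (h4.trans h9) h11
  have h14 := mul_le_mul_of_nonneg_left h2 h11
  have h15 : 0 ≤ (Fintype.card (Fin N → Fin n → Fin q) : ℝ) * (n * (c * Y * M.P n κ)) := by positivity
  linarith

end EdfTime

end CrtRoot
end

noncomputable section
namespace CrtRoot

/-! ## The root modulo one prime -/

section Root

variable {M : MulCost} {q : ℕ} [Fact q.Prime] {c Y : ℝ} {n κ r : ℕ}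

theorem mk_modByMonic (h a : (ZMod q)[X]) : AdjoinRoot.mk h (a %ₘ h) = AdjoinRoot.mk h a :=
  dvd_sub_iff_mk_eq.1 (dvd_modByMonic_sub a)

theorem mk_mulMod (h a b : (ZMod q)[X]) :
    AdjoinRoot.mk h (mulMod M h a b).val = AdjoinRoot.mk h a * AdjoinRoot.mk h b := by
  rw [← map_mul, ← mk_modByMonic h (a * b)]; rfl

theorem mk_powMod (hw : Within q n κ) (hM : M.Tame c) {h a : (ZMod q)[X]} (hh : h.Monic)
    (hn : h.natDegree ≤ n) (ha : plen a ≤ n) (k : ℕ) :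
    AdjoinRoot.mk h (powMod M h a k).val = AdjoinRoot.mk h a ^ k := by
  rw [← map_pow]
  exact dvd_sub_iff_mk_eq.1 (hw.powMod_spec hM hh hn ha (Nat.lt_two_pow_self (n := k))).1

theorem mk_foldT_mulMod (h : (ZMod q)[X]) (l : List (ZMod q)[X]) :
    AdjoinRoot.mk h (foldT (mulMod M h) 1 l).val = (l.map (AdjoinRoot.mk h)).prod := by
  rw [foldT_val]
  induction l with
  | nil => simp
  | cons a l ih => simp [mk_mulMod, ih]

theorem expRed_val (a : ℕ) {m : ℕ} (ha : a ≠ 0) :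
    (expRed M a m).val.toNat = (a - 1) % m + 1 := by
  have h0 : (a : ℤ) ≠ 0 := by exact_mod_cast ha
  simp only [expRed, if_neg h0, Timed.val_bind, zsub, zmod, zadd, tick_val]
  have : ((a : ℤ) - 1) % m = (((a - 1) % m : ℕ) : ℤ) := by
    push_cast [Nat.one_le_iff_ne_zero.2 ha]; rfl
  rw [this]
  omega

theorem expRed_zero (m : ℤ) : (expRed M 0 m).val.toNat = 0 := by simp [expRed]

theorem expRed_nonneg (a m : ℤ) : 0 ≤ (expRed M a m).time := by
  unfold expRed
  split_ifs
  · simp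
  · exact Timed.bind_nonneg (Nat.cast_nonneg _) fun _ =>
      Timed.bind_nonneg (M.zdivPrice_nonneg _ _) fun _ => Nat.cast_nonneg _

theorem expRed_time_le (hM : M.Tame c) {a m D E : ℕ} (hm : 0 < m) (hD : len (m : ℤ) ≤ D)
    (hE : len (a : ℤ) ≤ E) : (expRed M a m).time ≤ E + c * (E + D) * D + D := by
  have hc := hM.two_le
  unfold expRed
  split_ifs with h0
  · simp only [Timed.time_pure]; positivity
  · simp only [Timed.time_bind, zsub, zmod, zadd, tick_time, tick_val]
    have hE1 : len (1 : ℤ) ≤ E := le_trans (by decide) ((one_le_len _).trans hE)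
    have hD1 : len (1 : ℤ) ≤ D := le_trans (by decide) ((one_le_len _).trans hD)
    have h1 : ((max (len (a : ℤ)) (len 1) : ℕ) : ℝ) ≤ E := by exact_mod_cast max_le hE hE1
    have h2 : len ((a : ℤ) - 1) ≤ E := (len_mono (by omega)).trans hE
    have h3 := hM.zdivPrice_le h2 hD
    have h4 : ((max (len (((a : ℤ) - 1) % m)) (len 1) : ℕ) : ℝ) ≤ D := by
      exact_mod_cast max_le ((len_emod_le _ hm).trans hD) hD1
    linarith

theorem rootAt_nonneg (e : ℕ) (a : Fin r → ℕ) (u : Fin r → (ZMod q)[X]) (h : (ZMod q)[X]) :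
    0 ≤ (rootAt M e a u h).time := by
  unfold rootAt
  exact Timed.bind_nonneg (zpow_nonneg' _ _) fun _ => Timed.bind_nonneg (Nat.cast_nonneg _) fun _ =>
    Timed.bind_nonneg (forFin_nonneg fun _ => Timed.bind_nonneg (pdivPrice_nonneg _ _) fun _ =>
      Timed.bind_nonneg (expRed_nonneg _ _) fun _ => powMod_nonneg _ _ _) fun _ =>
    Timed.bind_nonneg (foldT_time_nonneg (mulMod_nonneg _) _ _) fun _ =>
    Timed.bind_nonneg (M.zdivPrice_nonneg _ _) fun _ => Timed.bind_nonneg (zinv_time_nonneg _ _)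
    fun _ => powMod_nonneg _ _ _

/-- Positivity relies on `2 ≤ m`, since modulo `1` the reduced inverse is `0`. A positive exponent
is required to get the root `0` of `0` right. -/
theorem zinv_emod_spec {e m : ℕ} (hm : 2 ≤ m) (he : Nat.Coprime e m) :
    0 < (zinv M ((e : ℤ) % m) m).val.toNat ∧ (zinv M ((e : ℤ) % m) m).val.toNat < m ∧
      e * (zinv M ((e : ℤ) % m) m).val.toNat ≡ 1 [MOD m] := by
  have hcop : IsCoprime ((e : ℤ) % m) m := by
    obtain ⟨u, v, huv⟩ := Nat.isCoprime_iff_coprime.2 he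
    refine ⟨u, v + u * (e / m), ?_⟩
    rw [← huv]
    linear_combination u * Int.emod_add_mul_ediv (e : ℤ) m
  have h1 := mul_zinv_modEq (M := M) hcop
  set z := (zinv M ((e : ℤ) % m) m).val with hz
  have hz0 : 0 ≤ z := Int.emod_nonneg _ (by omega)
  have hzm : z < m := Int.emod_lt_of_pos _ (by omega)
  have h2 : (e : ℤ) * z ≡ 1 [ZMOD m] := ((Int.mod_modEq _ _).symm.mul_right z).trans h1
  have h3 : e * z.toNat ≡ 1 [MOD m] := by
    rw [← Int.natCast_modEq_iff]
    push_cast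
    rwa [Int.toNat_of_nonneg hz0]
  refine ⟨?_, by omega, h3⟩
  rcases Nat.eq_zero_or_pos z.toNat with h4 | h4
  · rw [h4, mul_zero] at h3
    have := (Nat.modEq_iff_dvd' (by omega)).1 h3
    have := Nat.le_of_dvd (by omega) this
    omega
  · exact h4

/-- Because `e` is invertible modulo the order of the unit group, raising to the inverse power
recovers any `ξ` from `ξ ^ e`; thus the root in the residue field is unique. All integer exponents
have length at most `h.natDegree * κ`, so the price is proportional to the degree of `h` and can be
summed over the factors of `f`. `E` enters through the reduction of the given exponents and of `e`.
-/
theorem rootAt_spec (hw : Within q n κ) (hM : M.Tame c) (hq : Odd q) {e : ℕ} (he : 0 < e)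
    {a : Fin r → ℕ} {u : Fin r → (ZMod q)[X]} (hu : ∀ i, plen (u i) ≤ n) {h : (ZMod q)[X]}
    (hh : h.Monic) (hirr : Irreducible h) (hn : h.natDegree ≤ n)
    (hcop : Nat.Coprime e (q ^ h.natDegree - 1)) :
    (∀ ξ, h ∣ ξ ^ e - ∏ i, u i ^ a i → h ∣ (rootAt M e a u h).val - ξ) ∧
    plen (rootAt M e a u h).val ≤ n ∧
    ∀ E : ℕ, 0 < r → (∀ i, len (a i : ℤ) ≤ E) → len (e : ℤ) ≤ E →
      (rootAt M e a u h).time ≤ h.natDegree * (r * (c * κ * (24 * M.P n κ + 3 * E))) := by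
  have hc := hM.two_le
  set d := h.natDegree with hd
  have hd1 : 1 ≤ d := hirr.natDegree_pos
  -- Oddness of `q` excludes `q ^ d = 2`, for which the group order `m` would be `1`.
  have hqd3 : 3 ≤ q ^ d := by
    have h1 : 1 < q ^ d := Nat.one_lt_pow (by omega) (Fact.out : q.Prime).one_lt
    have h2 : q ^ d % 2 = 1 := Nat.odd_iff.1 hq.pow
    omega
  obtain ⟨m, hm⟩ : ∃ m, m = q ^ d - 1 := ⟨_, rfl⟩
  have hm2 : 2 ≤ m := by omega
  have hmz : (q : ℤ) ^ d - 1 = (m : ℤ) := by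
    rw [hm, Nat.cast_sub (by omega)]; push_cast; rfl
  obtain ⟨z1, z2⟩ := hw.zpow_spec hM hd1
  set D := d * κ with hD
  have lN : len ((q : ℤ) ^ d) ≤ D := hw.len_pow_le hd1
  have lm : len (m : ℤ) ≤ D := (len_mono (by
    have : (q : ℤ) ^ d = ((q ^ d : ℕ) : ℤ) := by push_cast; rfl
    rw [this]; omega)).trans lN
  have hmD : m < 2 ^ D := by
    simpa using (len_le_iff ((one_le_len _).trans lm)).1 lm
  rw [← hm] at hcop
  have hun : ∀ i, plen (u i %ₘ h) ≤ n := fun i => plen_modByMonic_le hh hn hw.one_le _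
  have hexp : ∀ i, (expRed M (a i) m).val.toNat < 2 ^ D := by
    intro i
    rcases Nat.eq_zero_or_pos (a i) with h0 | h0
    · rw [h0, Nat.cast_zero, expRed_zero]; positivity
    · rw [expRed_val _ h0.ne']
      have := Nat.mod_lt (a i - 1) (show m > 0 by omega)
      omega
  obtain ⟨d1, d2, d3⟩ := zinv_emod_spec (M := M) hm2 hcop
  set w : Fin r → (ZMod q)[X] := fun i => (powMod M h (u i %ₘ h) (expRed M (a i) m).val.toNat).val
    with hwdef
  have hwn : ∀ i, plen (w i) ≤ n := fun i => (hw.powMod_spec hM hh hn (hun i) (hexp i)).2.1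
  obtain ⟨y1, y2⟩ := foldT_time_le (op := mulMod M h) (init := 1) (l := List.ofFn w)
    (Q := fun y => plen y ≤ n) (B := 3 * c * M.P n κ) (by simpa [plen] using hw.one_le)
    (fun x hx y hy => by
      obtain ⟨i, rfl⟩ := (List.mem_ofFn' _ _).1 hx
      exact (hw.mulMod_spec hM hh hn (hwn i) hy).2.1)
    (fun x hx y hy => by
      obtain ⟨i, rfl⟩ := (List.mem_ofFn' _ _).1 hx
      exact (hw.mulMod_spec hM hh hn (hwn i) hy).2.2)
  set y := (foldT (mulMod M h) 1 (List.ofFn w)).val with hy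
  have hval : (rootAt M e a u h).val = (powMod M h y (zinv M ((e : ℤ) % m) m).val.toNat).val := by
    simp only [rootAt, Timed.val_bind, forFin_val, ← hd, z1, zsub, zmod, pmod, tick_val, hmz]
    rfl
  obtain ⟨p1, p2, p3⟩ := hw.powMod_spec hM hh hn y1 (d2.trans hmD)
  refine ⟨fun ξ hξ => ?_, by rw [hval]; exact p2, fun E hr hE heE => ?_⟩
  · rw [dvd_sub_iff_mk_eq] at hξ ⊢
    rw [hval, mk_powMod hw hM hh hn y1]
    refine adjoinRoot_root hirr ?_ (by rw [← hd, ← hm]; exact d3) he d1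
    rw [hy, mk_foldT_mulMod, ← map_pow, hξ, map_prod, List.map_ofFn, List.prod_ofFn]
    refine Finset.prod_congr rfl fun i _ => ?_
    simp only [Function.comp, hwdef]
    rw [mk_powMod hw hM hh hn (hun i), mk_modByMonic, map_pow]
    rcases Nat.eq_zero_or_pos (a i) with h0 | h0
    · rw [h0, Nat.cast_zero, expRed_zero]
    · rw [expRed_val _ h0.ne']
      refine adjoinRoot_pow_eq_pow hirr _ h0 (Nat.succ_pos _) ?_
      rw [← hd, ← hm]
      have := ((Nat.mod_modEq (a i - 1) m).add_right 1).symm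
      rwa [Nat.sub_add_cancel h0] at this
  · have htime : (rootAt M e a u h).time = (zpow M q d).time + ((max (len ((q : ℤ) ^ d)) (len 1) : ℕ)
        + (∑ i, (pdivPrice M (u i) h + ((expRed M (a i) m).time
            + (powMod M h (u i %ₘ h) (expRed M (a i) m).val.toNat).time))
        + ((foldT (mulMod M h) 1 (List.ofFn w)).time + (zdivPrice M e m
        + ((zinv M ((e : ℤ) % m) m).time
          + (powMod M h y (zinv M ((e : ℤ) % m) m).val.toNat).time))))) := by
      simp only [rootAt, Timed.time_bind, Timed.val_bind, forFin_val, forFin_time, ← hd, z1, zsub,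
        zmod, pmod, tick_val, tick_time, hmz]
      rfl
    have hW1 := hw.one_le_P (M := M)
    have hW := M.P_nonneg n κ
    have hD1 : 1 ≤ D := Nat.mul_pos hd1 hw.one_le_κ
    have hDW : (D : ℝ) ≤ M.P n κ :=
      le_trans (by rw [hD]; push_cast; gcongr) (hw.mul_le (M := M))
    have hD1' : (1 : ℝ) ≤ D := by exact_mod_cast hD1
    have h2n : n ≤ 2 * n := by omega
    have t1 : ((max (len ((q : ℤ) ^ d)) (len 1) : ℕ) : ℝ) ≤ D := by
      exact_mod_cast max_le lN (le_trans (by decide) hD1)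
    have t2 : ∀ i, pdivPrice M (u i) h + ((expRed M (a i) m).time
            + (powMod M h (u i %ₘ h) (expRed M (a i) m).val.toNat).time)
        ≤ 2 * c * M.P n κ + ((E + c * (E + D) * D + D) + 6 * c * D * M.P n κ) := fun i =>
      add_le_add (hw.pdivPrice_le hM ((hu i).trans h2n)
          (by simp only [plen]; have := hw.one_le; omega))
        (add_le_add (expRed_time_le hM (by omega) lm (hE i))
          (hw.powMod_spec hM hh hn (hun i) (hexp i)).2.2)
    have t3 := Finset.sum_le_sum fun i (_ : i ∈ Finset.univ) => t2 i
    rw [Finset.sum_const, Finset.card_univ, Fintype.card_fin, nsmul_eq_mul] at t3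
    have t4 := hM.zdivPrice_le heE lm
    have t5 : (zinv M ((e : ℤ) % m) m).time ≤ c * (D : ℝ) ^ 2 := by
      have h1 : max (len ((e : ℤ) % m)) (len (m : ℤ)) ≤ D :=
        max_le ((len_emod_le _ (by omega)).trans lm) lm
      refine le_trans ?_ (hM.quad D)
      simp only [zinv, tick_time]
      have := M.Z_nonneg D
      exact mul_le_mul (M.Z_mono h1) (by exact_mod_cast lg_mono h1) (Nat.cast_nonneg _) this
    rw [List.length_ofFn] at y2
    rw [htime]
    set W := M.P n κ with hWdef
    have hr1 : (1 : ℝ) ≤ r := by exact_mod_cast hr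
    have hE0 : (0 : ℝ) ≤ E := Nat.cast_nonneg _
    have v1 : c * (D : ℝ) ^ 2 ≤ c * D * W := by rw [pow_two, ← mul_assoc]; gcongr
    have v2 : (D : ℝ) ≤ c * D * W := by
      have : (1 : ℝ) ≤ c * W := by nlinarith
      calc (D : ℝ) = D * 1 := (mul_one _).symm
        _ ≤ D * (c * W) := by gcongr
        _ = _ := by ring
    have v3 : (E : ℝ) ≤ c * E * D := by
      have : (1 : ℝ) ≤ c * D := by nlinarith
      calc (E : ℝ) = E * 1 := (mul_one _).symm
        _ ≤ E * (c * D) := by gcongr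
        _ = _ := by ring
    have v4 : c * W ≤ c * D * W := by
      rw [mul_right_comm]; exact le_mul_of_one_le_right (by positivity) hD1'
    have v5 : 2 * c * W + ((E + c * (E + D) * D + D) + 6 * c * D * W) ≤ 10 * (c * D * W) + 2 * (c * E * D) := by
      linarith
    have v6 := mul_le_mul_of_nonneg_left v5 (show (0 : ℝ) ≤ r by positivity)
    have v7 : (r : ℝ) * (3 * c * W) ≤ r * (3 * (c * D * W)) :=
      mul_le_mul_of_nonneg_left (by linarith) (by positivity)
    have v8 : 11 * (c * D * W) + c * E * D ≤ r * (11 * (c * D * W) + c * E * D) :=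
      le_mul_of_one_le_left (by positivity) hr1
    have e1 : (d : ℝ) * (r * (c * κ * (24 * W + 3 * E))) = r * (24 * (c * D * W) + 3 * (c * E * D)) := by
      rw [hD]; push_cast; ring
    rw [e1]
    linarith

/-! ### Recombination -/

theorem IsFactorization.pairwise {f : (ZMod q)[X]} {S : List (ZMod q)[X]} (H : IsFactorization f S)
    (hs : Squarefree f) : S.Pairwise IsCoprime := by
  obtain ⟨-, h2, rfl⟩ := H
  induction S with
  | nil => exact List.Pairwise.nil
  | cons h S ih =>
    rw [List.prod_cons] at hs
    refine List.Pairwise.cons (fun g hg => ?_) (ih (fun x hx => h2 x (List.mem_cons_of_mem _ hx))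
      (hs.squarefree_of_dvd (dvd_mul_left _ _)))
    have hh := h2 h List.mem_cons_self
    refine hh.coprime_iff_not_dvd.2 fun hdvd => hh.not_isUnit (hs h ?_)
    exact mul_dvd_mul_left h (hdvd.trans (List.dvd_prod hg))

theorem IsFactorization.dvd {f : (ZMod q)[X]} {S : List (ZMod q)[X]} (H : IsFactorization f S)
    {h : (ZMod q)[X]} (hh : h ∈ S) : h ∣ f := H.prod_eq ▸ List.dvd_prod hh

theorem IsFactorization.sum_natDegree {f : (ZMod q)[X]} {S : List (ZMod q)[X]}
    (H : IsFactorization f S) : (S.map fun h => (h.natDegree : ℝ)).sum = f.natDegree := by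
  obtain ⟨h1, -, rfl⟩ := H
  have key : S.prod.Monic ∧ (S.map fun h => (h.natDegree : ℝ)).sum = (S.prod.natDegree : ℝ) := by
    induction S with
    | nil => simp
    | cons h S ih =>
      obtain ⟨a1, a2⟩ := ih fun x hx => h1 x (List.mem_cons_of_mem _ hx)
      have h2 := h1 h List.mem_cons_self
      refine ⟨by simpa using h2.mul a1, ?_⟩
      rw [List.map_cons, List.sum_cons, List.prod_cons, h2.natDegree_mul a1, a2]
      push_cast; rfl
  exact key.2

theorem IsFactorization.length_le {f : (ZMod q)[X]} {S : List (ZMod q)[X]}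
    (H : IsFactorization f S) : (S.length : ℝ) ≤ f.natDegree := by
  rw [← H.sum_natDegree]
  have : (S.map fun _ => (1 : ℝ)).sum ≤ (S.map fun h => (h.natDegree : ℝ)).sum :=
    List.sum_le_sum fun h hh => by exact_mod_cast (H.irreducible h hh).natDegree_pos
  simpa using this

/-- The Euclidean gcd is not normalised: for coprime arguments it is some non-zero constant, and the
inverse of its coefficient at `0` corrects the Bézout identity. -/
theorem mul_pinv_dvd {c' h : (ZMod q)[X]} (hcop : IsCoprime c' h) :
    h ∣ c' * (pinv M c' h).val - 1 := by
  have h1 : IsUnit (EuclideanDomain.gcd c' h) := EuclideanDomain.gcd_isUnit_iff.2 hcop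
  obtain ⟨g, hg, hgC⟩ := Polynomial.isUnit_iff.1 h1
  have h2 := EuclideanDomain.gcd_eq_gcd_ab c' h
  have h3 : C ((EuclideanDomain.gcd c' h).coeff 0)⁻¹ * EuclideanDomain.gcd c' h = 1 := by
    rw [← hgC, coeff_C_zero, ← C_mul, inv_mul_cancel₀ hg.ne_zero, C_1]
  rw [dvd_sub_iff_mk_eq, map_mul]
  simp only [pinv, tick_val]
  rw [mk_modByMonic, ← map_mul, ← dvd_sub_iff_mk_eq]
  generalize C ((EuclideanDomain.gcd c' h).coeff 0)⁻¹ = k at h3 ⊢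
  refine ⟨-(k * EuclideanDomain.gcdB c' h), ?_⟩
  rw [h2] at h3
  linear_combination h3

/-- The summand of the recombination that belongs to the factor `h`. -/
def crtTerm (M : MulCost) (f : (ZMod q)[X]) (hx : (ZMod q)[X] × (ZMod q)[X]) : Timed (ZMod q)[X] := do
  let cof ← pdiv M f hx.1
  let c ← pmod M cof hx.1
  let iv ← pinv M c hx.1
  let s ← mulMod M hx.1 hx.2 iv
  pmul M s cof

theorem crtPoly_eq (f : (ZMod q)[X]) (L : List ((ZMod q)[X] × (ZMod q)[X])) :
    crtPoly M f L = forList (crtTerm M f) L >>= fun ts => foldT padd 0 ts := rfl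

theorem crtTerm_nonneg (f : (ZMod q)[X]) (hx : (ZMod q)[X] × (ZMod q)[X]) :
    0 ≤ (crtTerm M f hx).time :=
  Timed.bind_nonneg (pdivPrice_nonneg _ _) fun _ => Timed.bind_nonneg (pdivPrice_nonneg _ _) fun _ =>
    Timed.bind_nonneg (euclidPrice_nonneg _ _) fun _ => Timed.bind_nonneg (mulMod_nonneg _ _ _)
    fun _ => M.P_nonneg _ _

theorem crtPoly_nonneg (f : (ZMod q)[X]) (L : List ((ZMod q)[X] × (ZMod q)[X])) :
    0 ≤ (crtPoly M f L).time :=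
  Timed.bind_nonneg (forList_nonneg (crtTerm_nonneg f) _) fun _ =>
    foldT_time_nonneg (fun _ _ => Nat.cast_nonneg _) _ _

/-- The cofactor `f / h` vanishes modulo the other factors and, as `f` is squarefree, is invertible
modulo `h`. The reduced multiplier has degree below that of `h`, so the term has degree below `n`
and no reduction modulo `f` is needed. -/
theorem crtTerm_spec (hw : Within q n κ) (hM : M.Tame c) (hY : (κ : ℝ) + lg (n + 1) ≤ Y)
    {f : (ZMod q)[X]} (hf : f.Monic) (hs : Squarefree f) (hn : f.natDegree = n)
    {h x : (ZMod q)[X]} (hh : h.Monic) (hirr : Irreducible h) (hdvd : h ∣ f) (hx : plen x ≤ n) :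
    h ∣ (crtTerm M f (h, x)).val - x ∧ (∀ g, IsCoprime g h → g ∣ f → g ∣ (crtTerm M f (h, x)).val) ∧
    plen (crtTerm M f (h, x)).val ≤ n ∧ (crtTerm M f (h, x)).time ≤ 5 * c * Y * M.P n κ := by
  have hc := hM.two_le
  have hW := M.P_nonneg n κ
  have hY2 := two_le_of_within hw hY
  have hmul := mul_divByMonic_of_dvd hh hdvd
  set cof := f /ₘ h with hcof
  have hcofmon : cof.Monic := monic_divByMonic_of_dvd hf hh hdvd
  have hdeg : h.natDegree + cof.natDegree = n := by
    rw [← hn, ← hmul, hh.natDegree_mul hcofmon]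
  have hd1 := hirr.natDegree_pos
  have hcop : IsCoprime (cof %ₘ h) h := by
    refine IsCoprime.symm (hirr.coprime_iff_not_dvd.2 fun h1 => hirr.not_isUnit (hs h ?_))
    have h2 : h ∣ cof := (dvd_sub_right h1).1 (dvd_modByMonic_sub cof)
    exact hmul ▸ mul_dvd_mul_left h h2
  have hiv := mul_pinv_dvd (M := M) hcop
  set iv := (pinv M (cof %ₘ h) h).val with hivdef
  have hivn : plen iv ≤ n := plen_modByMonic_le hh (by omega) hw.one_le _
  obtain ⟨s1, s2, s3⟩ := hw.mulMod_spec hM hh (by omega) hx hivn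
  set s := (mulMod M h x iv).val with hsdef
  have hval : (crtTerm M f (h, x)).val = s * cof := rfl
  refine ⟨?_, fun g hg hgf => ?_, ?_, ?_⟩
  · rw [dvd_sub_iff_mk_eq] at s1 hiv ⊢
    rw [map_mul, mk_modByMonic] at hiv
    rw [hval, map_mul, s1, map_mul, mul_assoc, mul_comm (AdjoinRoot.mk h iv), hiv, map_one, mul_one]
  · rw [hval]
    exact Dvd.dvd.mul_left (hg.dvd_of_dvd_mul_left (hmul.symm ▸ hgf)) _
  · have h1 : s.natDegree ≤ h.natDegree - 1 := by
      have h2 : h ≠ 1 := fun h3 => hirr.not_isUnit (h3 ▸ isUnit_one)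
      have := natDegree_modByMonic_lt (x * iv) hh h2
      change s.natDegree < _ at this
      omega
    have h3 := natDegree_mul_le (p := s) (q := cof)
    rw [hval]; simp only [plen]; omega
  · have h2n : n + 1 ≤ 2 * n := by have := hw.one_le; omega
    have hfn : plen f ≤ n + 1 := by simp only [plen]; omega
    have hhn : plen h ≤ n + 1 := by simp only [plen]; omega
    have hcofn : plen cof ≤ n := by simp only [plen]; omega
    have t1 := hw.pdivPrice_le hM (hfn.trans h2n) (hhn.trans h2n)
    have t2 := hw.pdivPrice_le hM (a := cof) (by omega) (hhn.trans h2n)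
    have t3 : euclidPrice M q (max (plen (cof %ₘ h)) (plen h)) ≤ c * Y * M.P n κ :=
      hw.euclidPrice_le hM hY (max_le ((plen_modByMonic_le hh (by omega) hw.one_le _).trans (by omega)) hhn)
    have t4 := hw.P_le (M := M) (max_le s2 hcofn)
    have htime : (crtTerm M f (h, x)).time = pdivPrice M f h + (pdivPrice M cof h
      + (euclidPrice M q (max (plen (cof %ₘ h)) (plen h)) + ((mulMod M h x iv).time
      + M.P (max (plen s) (plen cof)) (len q)))) := rfl
    rw [htime]
    have u1 : c * 2 * M.P n κ ≤ c * Y * M.P n κ := by gcongr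
    have u2 : 2 * M.P n κ ≤ c * M.P n κ := by gcongr
    linarith

theorem crtPoly_spec (hw : Within q n κ) (hM : M.Tame c) (hY : (κ : ℝ) + lg (n + 1) ≤ Y)
    {f : (ZMod q)[X]} (hf : f.Monic) (hs : Squarefree f) (hn : f.natDegree = n)
    {S : List (ZMod q)[X]} (hS : IsFactorization f S) {x : (ZMod q)[X] → (ZMod q)[X]}
    (hx : ∀ h ∈ S, plen (x h) ≤ n) :
    (∀ ξ, (∀ h ∈ S, h ∣ x h - ξ) → f ∣ (crtPoly M f (S.map fun h => (h, x h))).val - ξ) ∧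
    plen (crtPoly M f (S.map fun h => (h, x h))).val ≤ n ∧
    (crtPoly M f (S.map fun h => (h, x h))).time ≤ n * (6 * c * Y * M.P n κ) := by
  have hc := hM.two_le
  have hW := M.P_nonneg n κ
  have hY2 := two_le_of_within hw hY
  have hterm := fun h (hh : h ∈ S) => crtTerm_spec (M := M) hw hM hY hf hs hn (hS.monic h hh)
    (hS.irreducible h hh) (hS.dvd hh) (hx h hh)
  have hts : (forList (crtTerm M f) (S.map fun h => (h, x h))).val
      = S.map fun h => (crtTerm M f (h, x h)).val := by
    rw [forList_val, List.map_map]; rfl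
  obtain ⟨b1, b2⟩ := foldT_time_le (op := padd (q := q)) (init := 0)
    (l := S.map fun h => (crtTerm M f (h, x h)).val)
    (Q := fun y => plen y ≤ n) (B := M.P n κ) (by simpa [plen] using hw.one_le)
    (fun y hy z hz => by
      obtain ⟨h, hh, rfl⟩ := List.mem_map.1 hy
      have h1 := (hterm h hh).2.2.1
      have := natDegree_add_le (crtTerm M f (h, x h)).val z
      simp only [padd, tick_val, plen] at *
      omega)
    (fun y hy z hz => by
      obtain ⟨h, hh, rfl⟩ := List.mem_map.1 hy
      exact hw.padd_time_le (hterm h hh).2.2.1 hz)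
  have hval : (crtPoly M f (S.map fun h => (h, x h))).val
      = (foldT padd 0 (S.map fun h => (crtTerm M f (h, x h)).val)).val := by
    rw [crtPoly_eq, Timed.val_bind, hts]
  have htime : (crtPoly M f (S.map fun h => (h, x h))).time
      = (S.map fun h => (crtTerm M f (h, x h)).time).sum
        + (foldT padd 0 (S.map fun h => (crtTerm M f (h, x h)).val)).time := by
    rw [crtPoly_eq, Timed.time_bind, hts, forList_time, List.map_map]; rfl
  refine ⟨fun ξ hξ => ?_, hval ▸ b1, ?_⟩
  · classical
    have hpw := hS.pairwise hs
    have hnodup : S.Nodup := hpw.imp_of_mem fun {a b} ha _ hab h => by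
      subst h
      exact (hS.irreducible a ha).not_isUnit (isCoprime_self.1 hab)
    have hsum : (crtPoly M f (S.map fun h => (h, x h))).val
        = ∑ h ∈ S.toFinset, (crtTerm M f (h, x h)).val := by
      rw [hval, foldT_val, List.sum_toFinset _ hnodup]
      generalize S.map (fun h => (crtTerm M f (h, x h)).val) = l
      induction l with
      | nil => simp
      | cons a l ih => rw [List.foldr_cons, ih, List.sum_cons]; rfl
    have hcop : ∀ g ∈ S, ∀ h ∈ S, g ≠ h → IsCoprime g h := fun g hg h hh hne =>
      @List.Pairwise.forall _ IsCoprime S ⟨fun _ _ h => h.symm⟩ hpw g hg h hh hne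
    have hprod : f = ∏ h ∈ S.toFinset, h := by
      rw [← hS.prod_eq, List.prod_toFinset (fun h => h) hnodup, List.map_id']
    rw [hsum]
    refine (dvd_of_eq hprod).trans (Finset.prod_dvd_of_coprime (fun g hg h hh hne => hcop g (by simpa using hg) h
      (by simpa using hh) hne) fun g hg => ?_)
    rw [List.mem_toFinset] at hg
    rw [← Finset.add_sum_erase _ _ (List.mem_toFinset.2 hg), add_sub_right_comm]
    refine dvd_add ?_ (Finset.dvd_sum fun h hh => ?_)
    · have := dvd_add (hterm g hg).1 (hξ g hg)
      simpa using this
    · have h1 : h ∈ S := List.mem_toFinset.1 (Finset.mem_of_mem_erase hh)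
      exact (hterm h h1).2.1 g (hcop g hg h h1 (Finset.ne_of_mem_erase hh).symm) (hS.dvd hg)
  · rw [htime]
    have hlen := hS.length_le
    rw [hn] at hlen
    have h1 : (S.map fun h => (crtTerm M f (h, x h)).time).sum
        ≤ (S.map fun _ => 5 * c * Y * M.P n κ).sum :=
      List.sum_le_sum fun h hh => (hterm h hh).2.2.2
    rw [List.map_const', List.sum_replicate, nsmul_eq_mul] at h1
    rw [List.length_map] at b2
    have h2 : M.P n κ ≤ c * Y * M.P n κ := le_mul_of_one_le_left hW (by nlinarith)
    have h3 : (S.length : ℝ) * M.P n κ ≤ n * (c * Y * M.P n κ) := by gcongr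
    have h4 : (S.length : ℝ) * (5 * c * Y * M.P n κ) ≤ n * (5 * c * Y * M.P n κ) := by gcongr
    linarith

/-! ### The root modulo `f` -/

/-- The steps of `rootModPoly` that follow the factorisation. -/
def rootFromFactors (M : MulCost) (f : (ZMod q)[X]) (e : ℕ) (a : Fin r → ℕ)
    (u : Fin r → (ZMod q)[X]) (S : List (ZMod q)[X]) : Timed (ZMod q)[X] := do
  let xs ← forList (fun h => do
    let x ← rootAt M e a u h
    pure (h, x)) S
  crtPoly M f xs

theorem rootFromFactors_nonneg (f : (ZMod q)[X]) (e : ℕ) (a : Fin r → ℕ)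
    (u : Fin r → (ZMod q)[X]) (S : List (ZMod q)[X]) : 0 ≤ (rootFromFactors M f e a u S).time :=
  Timed.bind_nonneg (forList_nonneg (fun _ => Timed.bind_nonneg (rootAt_nonneg _ _ _ _)
    fun _ => le_rfl) _) fun _ => crtPoly_nonneg _ _

theorem rootFromFactors_spec (hw : Within q n κ) (hM : M.Tame c) (hY : (κ : ℝ) + lg (n + 1) ≤ Y)
    (hq : Odd q) {e : ℕ} (he : 0 < e) {a : Fin r → ℕ} {u : Fin r → (ZMod q)[X]}
    (hu : ∀ i, plen (u i) ≤ n) {f : (ZMod q)[X]} (hf : f.Monic) (hs : Squarefree f)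
    (hn : f.natDegree = n)
    (hcop : ∀ h, Irreducible h → h ∣ f → Nat.Coprime e (q ^ h.natDegree - 1))
    {S : List (ZMod q)[X]} (hS : IsFactorization f S) :
    (∀ ξ, f ∣ ξ ^ e - ∏ i, u i ^ a i → f ∣ (rootFromFactors M f e a u S).val - ξ) ∧
    plen (rootFromFactors M f e a u S).val ≤ n ∧
    ∀ E : ℕ, 0 < r → (∀ i, len (a i : ℤ) ≤ E) → len (e : ℤ) ≤ E →
      (rootFromFactors M f e a u S).time
        ≤ n * (r * (c * κ * (24 * M.P n κ + 3 * E))) + n * (6 * c * Y * M.P n κ) := by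
  have hroot := fun h (hh : h ∈ S) => rootAt_spec (M := M) hw hM hq he (a := a) hu (hS.monic h hh)
    (hS.irreducible h hh) ((natDegree_le_of_dvd (hS.dvd hh) hf.ne_zero).trans hn.le)
    (hcop h (hS.irreducible h hh) (hS.dvd hh))
  obtain ⟨c1, c2, c3⟩ := crtPoly_spec (M := M) hw hM hY hf hs hn hS
    (x := fun h => (rootAt M e a u h).val) fun h hh => (hroot h hh).2.1
  have hlist : (forList (fun h => do
      let x ← rootAt M e a u h
      pure (h, x)) S).val = S.map fun h => (h, (rootAt M e a u h).val) := by
    rw [forList_val]; rfl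
  have hval : (rootFromFactors M f e a u S).val
      = (crtPoly M f (S.map fun h => (h, (rootAt M e a u h).val))).val := by
    rw [rootFromFactors, Timed.val_bind, hlist]
  have htime : (rootFromFactors M f e a u S).time = (S.map fun h => (rootAt M e a u h).time).sum
      + (crtPoly M f (S.map fun h => (h, (rootAt M e a u h).val))).time := by
    rw [rootFromFactors, Timed.time_bind, hlist, forList_time]
    simp only [Timed.time_bind, Timed.time_pure, add_zero]
  refine ⟨fun ξ hξ => ?_, hval ▸ c2, fun E hr hE heE => ?_⟩
  · rw [hval]
    exact c1 ξ fun h hh => (hroot h hh).1 ξ ((hS.dvd hh).trans hξ)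
  · rw [htime]
    refine add_le_add ?_ c3
    refine (List.sum_le_sum fun h hh => (hroot h hh).2.2 E hr hE heE).trans ?_
    rw [List.sum_map_mul_right, hS.sum_natDegree, hn]

/-- This isolates the randomness: the draws influence only the factorisation, and everything
afterwards is bounded uniformly in the list of factors. -/
theorem rootModPoly_eq (τs : List (Fin n → Fin q)) (f : (ZMod q)[X]) (e : ℕ) (a : Fin r → ℕ)
    (u : Fin r → (ZMod q)[X]) : (rootModPoly M τs f e a u).val
      = (factor M τs f).val.map (fun S => (rootFromFactors M f e a u S).val) ∧
    (rootModPoly M τs f e a u).time = (factor M τs f).time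
      + (match (factor M τs f).val with
        | none => 0
        | some S => (rootFromFactors M f e a u S).time) := by
  unfold rootModPoly
  simp only [Timed.val_bind, Timed.time_bind]
  cases (factor M τs f).val with
  | none => exact ⟨rfl, rfl⟩
  | some S => exact ⟨rfl, by simp only [rootFromFactors, Timed.time_bind, Timed.time_pure, add_zero]⟩

theorem ddf_nonneg (f : (ZMod q)[X]) (fuel : ℕ) :
    ∀ (i : ℕ) (g rem : (ZMod q)[X]), 0 ≤ (ddf M f fuel i g rem).time := by
  induction fuel with
  | zero => intro i g rem; simp [ddf]
  | succ fuel ih =>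
    intro i g rem
    unfold ddf
    split_ifs
    · simp
    · exact Timed.bind_nonneg (powMod_nonneg _ _ _) fun _ => Timed.bind_nonneg (Nat.cast_nonneg _)
        fun _ => Timed.bind_nonneg (euclidPrice_nonneg _ _) fun _ =>
        Timed.bind_nonneg (pdivPrice_nonneg _ _) fun _ => Timed.bind_nonneg (ih _ _ _) fun _ => le_rfl

theorem factor_nonneg (τs : List (Fin n → Fin q)) (f : (ZMod q)[X]) :
    0 ≤ (factor M τs f).time :=
  Timed.bind_nonneg (pdivPrice_nonneg _ _) fun _ => Timed.bind_nonneg (ddf_nonneg _ _ _ _ _)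
    fun _ => edf_nonneg _ _

theorem rootModPoly_nonneg (τs : List (Fin n → Fin q)) (f : (ZMod q)[X]) (e : ℕ) (a : Fin r → ℕ)
    (u : Fin r → (ZMod q)[X]) : 0 ≤ (rootModPoly M τs f e a u).time := by
  rw [(rootModPoly_eq τs f e a u).2]
  refine add_nonneg (factor_nonneg _ _) ?_
  cases (factor M τs f).val with
  | none => exact le_rfl
  | some S => exact rootFromFactors_nonneg _ _ _ _ _

theorem length_le_rootModPoly_time (hn : 1 ≤ n) {τs : List (Fin n → Fin q)} {f : (ZMod q)[X]}
    {e : ℕ} {a : Fin r → ℕ} {u : Fin r → (ZMod q)[X]} (h : (rootModPoly M τs f e a u).val = none) :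
    (τs.length : ℝ) ≤ (rootModPoly M τs f e a u).time := by
  rw [(rootModPoly_eq τs f e a u).1, Option.map_eq_none_iff] at h
  rw [(rootModPoly_eq τs f e a u).2, h]
  simp only [add_zero]
  have h1 := length_le_edf_time (M := M) hn τs _ h
  have h2 := pdivPrice_nonneg (M := M) X f
  have h3 := ddf_nonneg (M := M) f f.natDegree 0 (X %ₘ f) f
  simp only [factor, Timed.time_bind]
  simp only [pmod, tick_val, tick_time] at h1 ⊢
  linarith

theorem rootModPoly_val (hw : Within q n κ) (hM : M.Tame c) (hY : (κ : ℝ) + lg (n + 1) ≤ Y)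
    (hq : Odd q) {e : ℕ} (he : 0 < e) {a : Fin r → ℕ} {u : Fin r → (ZMod q)[X]}
    (hu : ∀ i, plen (u i) ≤ n) {f : (ZMod q)[X]} (hf : f.Monic) (hs : Squarefree f)
    (hn : f.natDegree = n)
    (hcop : ∀ h, Irreducible h → h ∣ f → Nat.Coprime e (q ^ h.natDegree - 1))
    {τs : List (Fin n → Fin q)} {x ξ : (ZMod q)[X]} (hx : (rootModPoly M τs f e a u).val = some x)
    (hξ : f ∣ ξ ^ e - ∏ i, u i ^ a i) : f ∣ x - ξ ∧ plen x ≤ n := by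
  rw [(rootModPoly_eq τs f e a u).1, Option.map_eq_some_iff] at hx
  obtain ⟨S, hS, rfl⟩ := hx
  have := rootFromFactors_spec (M := M) hw hM hY hq he (a := a) hu hf hs hn hcop
    (factor_val hw hM hY hf hs hn.le hS)
  exact ⟨this.1 ξ hξ, this.2.1⟩

/-- `132 = 126 + 6`, for factorisation and recombination; the first term is the sum of the root
extractions, in which the degrees of the factors add up to `n`. -/
theorem sum_rootModPoly_time_le (hw : Within q n κ) (hM : M.Tame c)
    (hY : (κ : ℝ) + lg (n + 1) ≤ Y) (hq : Odd q) {e : ℕ} (he : 0 < e) {a : Fin r → ℕ}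
    {u : Fin r → (ZMod q)[X]} (hu : ∀ i, plen (u i) ≤ n) {f : (ZMod q)[X]} (hf : f.Monic)
    (hs : Squarefree f) (hn : f.natDegree = n)
    (hcop : ∀ h, Irreducible h → h ∣ f → Nat.Coprime e (q ^ h.natDegree - 1))
    {E : ℕ} (hr : 0 < r) (hE : ∀ i, len (a i : ℤ) ≤ E) (heE : len (e : ℤ) ≤ E) (N : ℕ) :
    ∑ τs : Fin N → Fin n → Fin q, (rootModPoly M (List.ofFn τs) f e a u).time
      ≤ (Fintype.card (Fin N → Fin n → Fin q) : ℝ) *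
        (n * (r * (c * κ * (24 * M.P n κ + 3 * E))) + n * (132 * c * Y * M.P n κ)) := by
  have hc := hM.two_le
  have hW := M.P_nonneg n κ
  have hY2 := two_le_of_within hw hY
  have h1 := sum_factor_time_le hw hM hY hq hf hs hn.le N
  have h2 : ∀ τs : Fin N → Fin n → Fin q, (rootModPoly M (List.ofFn τs) f e a u).time
      ≤ (factor M (List.ofFn τs) f).time
        + (n * (r * (c * κ * (24 * M.P n κ + 3 * E))) + n * (6 * c * Y * M.P n κ)) := by
    intro τs
    rw [(rootModPoly_eq _ f e a u).2]
    gcongr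
    cases hS : (factor M (List.ofFn τs) f).val with
    | none => dsimp only; positivity
    | some S => exact (rootFromFactors_spec (M := M) hw hM hY hq he (a := a) hu hf hs hn hcop
        (factor_val hw hM hY hf hs hn.le hS)).2.2 E hr hE heE
  refine (Finset.sum_le_sum fun τs _ => h2 τs).trans ?_
  rw [Finset.sum_add_distrib, Finset.sum_const, Finset.card_univ, nsmul_eq_mul]
  linarith

end Root

end CrtRoot
end

noncomputable section
namespace CrtRoot

/-! ## Reduction of the number field modulo a good prime -/

namespace OrderData

variable {K : Type*} [Field K] [NumberField K] (D : OrderData K)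

theorem isIntegral_α : IsIntegral ℤ D.α := D.isIntegral _ D.α_mem

/-- The generator of the field as an algebraic integer. -/
def θ : 𝓞 K := ⟨D.α, D.isIntegral_α⟩

theorem aeval_α_eq_zero_iff {g : ℤ[X]} : aeval D.α g = 0 ↔ D.f ∣ g := by
  constructor
  · intro h
    have h1 := minpoly.isIntegrallyClosed_dvd D.isIntegral_α D.root
    have h2 := minpoly.isIntegrallyClosed_dvd D.isIntegral_α h
    have h3 : Associated (minpoly ℤ D.α) D.f :=
      (D.irreducible.dvd_iff.1 h1).resolve_left (minpoly.not_isUnit ℤ D.α) |>.symm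
    exact h3.symm.dvd.trans h2
  · rintro ⟨g', rfl⟩
    simp [D.root]

theorem minpoly_θ : minpoly ℤ D.θ = D.f := by
  have hm : minpoly ℤ D.θ = minpoly ℤ D.α :=
    (minpoly.algebraMap_eq RingOfIntegers.coe_injective D.θ).symm
  rw [hm]
  have h1 := minpoly.isIntegrallyClosed_dvd D.isIntegral_α D.root
  exact eq_of_monic_of_associated (minpoly.monic D.isIntegral_α) D.monic
    ((D.irreducible.dvd_iff.1 h1).resolve_left (minpoly.not_isUnit ℤ D.α)).symm

theorem one_le_n : 1 ≤ D.n := by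
  rw [n, ← D.minpoly_θ]
  exact minpoly.natDegree_pos D.θ.isIntegral

/-- The basis of the order, indexed by `Fin D.n`. -/
def basis : Module.Basis (Fin D.n) ℤ D.O := D.ω

theorem elt_eq_sum (z : Fin D.n → ℤ) : D.elt z = ∑ i, (z i : K) * (D.basis i : K) := rfl

theorem basis_eq (i : Fin D.n) :
    (D.basis i : K) = ∑ j : Fin D.n, algebraMap ℚ K (D.Ω i j) * D.α ^ (j : ℕ) := D.ω_eq i

theorem pow_eq_sum (i : Fin D.n) :
    D.α ^ (i : ℕ) = ∑ j : Fin D.n, (D.T i j : K) * (D.basis j : K) := D.pow_eq i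

theorem coe_sum_smul (z : Fin D.n → ℤ) :
    ((∑ i, z i • D.basis i : D.O) : K) = D.elt z := by
  rw [AddSubmonoidClass.coe_finsetSum]
  simp [elt_eq_sum, zsmul_eq_mul]

theorem elt_mem (z : Fin D.n → ℤ) : D.elt z ∈ D.O := by
  rw [← D.coe_sum_smul]
  exact Subtype.property _

theorem exists_elt_eq {y : K} (hy : y ∈ D.O) : ∃ z : Fin D.n → ℤ, D.elt z = y :=
  ⟨D.basis.repr ⟨y, hy⟩, by rw [← D.coe_sum_smul, D.basis.sum_repr]⟩

theorem elt_injective : Function.Injective D.elt := by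
  intro z w h
  rw [← D.coe_sum_smul, ← D.coe_sum_smul, Subtype.coe_inj] at h
  have := congrArg (fun y => (D.basis.repr y : Fin D.n → ℤ)) h
  simpa only [D.basis.repr_sum_self] using this

/-! ### The index of `ℤ[α]` at a prime with squarefree reduction -/

theorem exists_int_poly_mul_basis : ∃ m : ℕ, 0 < m ∧ ∀ i : Fin D.n,
    ∃ g : ℤ[X], (m : K) * (D.basis i : K) = aeval D.α g := by
  let d : ℕ := ∏ p : Fin D.n × Fin D.n, (D.Ω p.1 p.2).den
  have hd : 0 < d := Finset.prod_pos fun p _ => (D.Ω p.1 p.2).den_pos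
  refine ⟨d, hd, fun i => ?_⟩
  have hz : ∀ j : Fin D.n, ∃ z : ℤ, (d : K) * algebraMap ℚ K (D.Ω i j) = z := by
    intro j
    obtain ⟨t, ht⟩ : (D.Ω i j).den ∣ d :=
      Finset.dvd_prod_of_mem (fun p : Fin D.n × Fin D.n => (D.Ω p.1 p.2).den)
        (Finset.mem_univ (i, j))
    refine ⟨t * (D.Ω i j).num, ?_⟩
    have h2 : (d : ℚ) * D.Ω i j = ((t * (D.Ω i j).num : ℤ) : ℚ) := by
      rw [ht]; push_cast
      rw [mul_right_comm, mul_comm ((D.Ω i j).den : ℚ), Rat.mul_den_eq_num]; ring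
    have := congrArg (algebraMap ℚ K) h2
    simpa using this
  choose z hz using hz
  refine ⟨∑ j : Fin D.n, C (z j) * X ^ (j : ℕ), ?_⟩
  rw [D.basis_eq, Finset.mul_sum, map_sum]
  exact Finset.sum_congr rfl fun j _ => by rw [← mul_assoc, hz]; simp

/-- `f₀` carries an algebraic integer into the order, and a common denominator of `Ω` carries the
order into `ℤ[α]`. -/
theorem exists_pos_mul_mem : ∃ m : ℕ, 0 < m ∧ ∀ x : K, IsIntegral ℤ x →
    ∃ g : ℤ[X], (m : K) * x = aeval D.α g := by
  obtain ⟨d, hd, hω⟩ := D.exists_int_poly_mul_basis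
  choose g hg using hω
  refine ⟨d * D.f₀, Nat.mul_pos hd D.f₀_pos, fun x hx => ?_⟩
  obtain ⟨z, hz⟩ := D.exists_elt_eq (D.f₀_mul_mem x hx)
  refine ⟨∑ i, C (z i) * g i, ?_⟩
  push_cast
  rw [mul_assoc, ← hz, elt_eq_sum, Finset.mul_sum, map_sum]
  refine Finset.sum_congr rfl fun i _ => ?_
  rw [map_mul, ← hg]
  simp [mul_left_comm]

/-- Scaling an integral equation of `x` by `q` gives a monic equation for `g(α) = q x` that becomes
`X ^ N` modulo `q`. Hence `f` divides a power of `g` modulo `q`, and by squarefreeness it divides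
`g` itself. So the remainder of `g` modulo `f` is divisible by `q`, and `q` can be cancelled. -/
theorem exists_eq_of_mul_eq {q : ℕ} [Fact q.Prime] (hsq : Squarefree (D.fbar q)) {x : K}
    (hx : IsIntegral ℤ x) {g : ℤ[X]} (hg : (q : K) * x = aeval D.α g) :
    ∃ g' : ℤ[X], x = aeval D.α g' := by
  have hq0 : (q : K) ≠ 0 := Nat.cast_ne_zero.2 (Fact.out : q.Prime).ne_zero
  obtain ⟨p, hp, hpx⟩ := hx
  have h0 : aeval D.α ((scaleRoots p (q : ℤ)).comp g) = 0 := by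
    rw [aeval_comp, ← hg]
    have := scaleRoots_aeval_eq_zero (p := p) (a := x) (r := (q : ℤ)) hpx
    simpa using this
  have h1 : D.fbar q ∣ (g.map (Int.castRingHom (ZMod q))) ^ p.natDegree := by
    have h2 := Polynomial.map_dvd (Int.castRingHom (ZMod q)) (D.aeval_α_eq_zero_iff.1 h0)
    have h3 : (scaleRoots p (q : ℤ)).map (Int.castRingHom (ZMod q)) = X ^ p.natDegree := by
      ext i
      rw [coeff_map, coeff_scaleRoots, coeff_X_pow]
      rcases lt_trichotomy i p.natDegree with h | h | h
      · simp [h.ne, (Nat.sub_pos_of_lt h).ne']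
      · simp [h, hp.coeff_natDegree]
      · simp [h.ne', coeff_eq_zero_of_natDegree_lt h]
    rw [Polynomial.map_comp, h3] at h2
    simpa [fbar] using h2
  have h4 : D.fbar q ∣ g.map (Int.castRingHom (ZMod q)) := by
    by_cases hp0 : p.natDegree = 0
    · rw [hp0, pow_zero] at h1
      exact h1.trans (one_dvd _)
    · exact (hsq.dvd_pow_iff_dvd hp0).1 h1
  have h5 : (g %ₘ D.f).map (Int.castRingHom (ZMod q)) = 0 := by
    rw [map_modByMonic _ D.monic]
    exact (modByMonic_eq_zero_iff_dvd (D.monic.map _)).2 h4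
  have h6 : C (q : ℤ) ∣ g %ₘ D.f := by
    rw [C_dvd_iff_dvd_coeff]
    intro i
    have := congrArg (fun p => p.coeff i) h5
    simpa [coeff_map, ZMod.intCast_zmod_eq_zero_iff_dvd] using this
  obtain ⟨g', hg'⟩ := h6
  refine ⟨g', mul_left_cancel₀ hq0 ?_⟩
  have h7 : aeval D.α g = aeval D.α (g %ₘ D.f) := by
    conv_lhs => rw [← modByMonic_add_div g D.f]
    simp [D.root]
  rw [hg, h7, hg']
  simp

/-- The factors `q` of the multiplier in `exists_pos_mul_mem` are removed one at a time by
`exists_eq_of_mul_eq`. -/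
theorem exists_not_dvd_mul_mem {q : ℕ} [Fact q.Prime] (hsq : Squarefree (D.fbar q)) :
    ∃ m : ℕ, ¬ q ∣ m ∧ ∀ x : K, IsIntegral ℤ x → ∃ g : ℤ[X], (m : K) * x = aeval D.α g := by
  obtain ⟨m, hm, h⟩ := D.exists_pos_mul_mem
  obtain ⟨k, m', hm', rfl⟩ := Nat.exists_eq_pow_mul_and_not_dvd hm.ne' q
    (Fact.out : q.Prime).ne_one
  refine ⟨m', hm', ?_⟩
  clear hm
  induction k with
  | zero => simpa using h
  | succ k ih =>
    refine ih fun x hx => ?_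
    obtain ⟨g, hg⟩ := h x hx
    refine D.exists_eq_of_mul_eq hsq (x := ((q ^ k * m' : ℕ) : K) * x) ?_ (g := g) ?_
    · exact IsIntegral.mul (by exact_mod_cast isIntegral_algebraMap (R := ℤ) (A := K) (x := ((q ^ k * m' : ℕ) : ℤ))) hx
    · rw [← hg]; push_cast; ring

/-- The multiplier of `exists_not_dvd_mul_mem` is an integer in the conductor that is prime to `q`.
This is the hypothesis under which the Dedekind–Kummer isomorphism `O_K / q ≅ 𝔽_q[t]/(f)` is
available. -/
theorem not_dvd_exponent {q : ℕ} [Fact q.Prime] (hsq : Squarefree (D.fbar q)) :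
    ¬ q ∣ RingOfIntegers.exponent D.θ := by
  obtain ⟨m, hm, h⟩ := D.exists_not_dvd_mul_mem hsq
  rw [RingOfIntegers.not_dvd_exponent_iff, ← Ideal.isCoprime_iff_codisjoint,
    Ideal.isCoprime_iff_exists]
  have hcop : IsCoprime (m : ℤ) q :=
    (Nat.isCoprime_iff_coprime).2 ((Nat.Prime.coprime_iff_not_dvd Fact.out).2 hm).symm
  obtain ⟨a, b, hab⟩ := hcop
  refine ⟨a * m, ?_, b * q, Ideal.mem_span_singleton.2 (dvd_mul_left _ _), hab⟩
  refine Ideal.mul_mem_left _ _ ?_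
  rw [Ideal.mem_comap, mem_conductor_iff]
  intro x
  obtain ⟨g, hg⟩ := h x x.isIntegral_coe
  have : algebraMap ℤ (𝓞 K) m * x = aeval D.θ g := by
    apply RingOfIntegers.coe_injective
    have h2 : algebraMap (𝓞 K) K (aeval D.θ g) = aeval D.α g := (aeval_algebraMap_apply K D.θ g).symm
    rw [h2, ← hg]; simp
  rw [this]
  exact aeval_mem_adjoin_singleton _ _

/-- Reduction of the algebraic integers modulo a prime at which `f` is squarefree. -/
theorem exists_reduction {q : ℕ} [Fact q.Prime] (hsq : Squarefree (D.fbar q)) :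
    ∃ φ : 𝓞 K →+* AdjoinRoot (D.fbar q), ∀ g : ℤ[X],
      φ (aeval D.θ g) = AdjoinRoot.mk _ (g.map (Int.castRingHom (ZMod q))) := by
  have he := D.not_dvd_exponent hsq
  have hf : (minpoly ℤ D.θ).map (Int.castRingHom (ZMod q)) = D.fbar q := by
    rw [D.minpoly_θ]; rfl
  rw [← hf]
  refine ⟨(RingOfIntegers.ZModXQuotSpanEquivQuotSpan he).symm.toRingHom.comp
    (Ideal.Quotient.mk _), fun g => ?_⟩
  have := RingOfIntegers.ZModXQuotSpanEquivQuotSpan_mk_apply he g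
  exact (RingEquiv.symm_apply_eq _).2 this.symm

end OrderData

/-- Composing the reduction with the projection to `𝔽_q[t]/(h)` gives a surjection onto a field with
`q ^ deg h` elements. Its kernel is a prime ideal above `q` whose norm, and therefore residue
degree, can be read off; condition `(*)` for this ideal is the claim. -/
theorem GoodPrime.coprime {K : Type*} [Field K] [NumberField K] {D : OrderData K} {ℓ q m : ℕ}
    [Fact q.Prime] (hg : GoodPrime D ℓ q) (hℓ : ℓ.Prime) {h : (ZMod q)[X]} (hi : Irreducible h)
    (hd : h ∣ D.fbar q) : Nat.Coprime (ℓ ^ m) (q ^ h.natDegree - 1) := by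
  obtain ⟨φ, hφ⟩ := D.exists_reduction hg.squarefree
  have : Fact (Irreducible h) := ⟨hi⟩
  let ψ : 𝓞 K →+* AdjoinRoot h :=
    (Ideal.Quotient.factor (Ideal.span_singleton_le_span_singleton.2 hd)).comp φ
  have hψ : ∀ g : ℤ[X], ψ (aeval D.θ g) = AdjoinRoot.mk h (g.map (Int.castRingHom (ZMod q))) := by
    intro g
    exact congrArg (Ideal.Quotient.factor (Ideal.span_singleton_le_span_singleton.2 hd)) (hφ g)
  have hsurj : Function.Surjective ψ := by
    intro y
    obtain ⟨p, rfl⟩ := AdjoinRoot.mk_surjective y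
    obtain ⟨g, rfl⟩ := Polynomial.map_surjective (Int.castRingHom (ZMod q))
      ZMod.intCast_surjective p
    exact ⟨_, hψ g⟩
  have hprime : (RingHom.ker ψ).IsPrime := RingHom.ker_isPrime ψ
  have hq : (q : 𝓞 K) ∈ RingHom.ker ψ := by
    rw [RingHom.mem_ker]
    have h1 := hψ (C (q : ℤ))
    simpa using h1
  have hlies : (RingHom.ker ψ).LiesOver (Ideal.span {(q : ℤ)}) := by
    constructor
    refine (Int.ideal_span_isMaximal_of_prime q).eq_of_le (hprime.comap _).ne_top ?_
    rw [Ideal.span_le, Set.singleton_subset_iff]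
    simpa using hq
  have hnorm : q ^ (RingHom.ker ψ).inertiaDeg ℤ = q ^ h.natDegree := by
    rw [Ideal.pow_inertiaDeg, Ideal.absNorm_apply, Submodule.cardQuot_apply,
      Nat.card_congr (RingHom.quotientKerEquivOfSurjective hsurj).toEquiv,
      natCard_adjoinRoot hi.ne_zero]
  refine Nat.Coprime.pow_left _ ((hℓ.coprime_iff_not_dvd).2 fun hdvd => ?_)
  refine hg.not_modEq _ hprime hq ?_
  rw [hnorm]
  exact ((Nat.modEq_iff_dvd' (Nat.one_le_pow _ _ (Fact.out : q.Prime).pos)).2 hdvd).symm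

theorem ratRed_val_mul (M : MulCost) {q : ℕ} [Fact q.Prime] {b : ℚ} (hb : ¬ q ∣ b.den) :
    (ratRed M q b).val * (b.den : ZMod q) = (b.num : ZMod q) := by
  have hcop : IsCoprime ((b.den : ℤ) % q) (q : ℤ) := by
    have h1 : IsCoprime (b.den : ℤ) q :=
      Nat.isCoprime_iff_coprime.2 ((Nat.Prime.coprime_iff_not_dvd Fact.out).2 hb).symm
    rw [Int.emod_def, sub_eq_add_neg, ← mul_neg]
    exact h1.add_mul_left_left _
  have h2 := mul_zinv_modEq (M := M) hcop
  have h3 := (ZMod.intCast_eq_intCast_iff _ _ _).2 h2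
  simp only [ratRed, zred, zmod, zmul, Timed.val_bind, Timed.val_pure, tick_val]
  simp only [ZMod.intCast_mod, Int.cast_mul]
  push_cast at h3
  linear_combination (b.num : ZMod q) * h3

/-! ### Coordinates on the basis of the order modulo a good prime -/

namespace OrderData

variable {K : Type*} [Field K] [NumberField K] (D : OrderData K)

theorem eq_zero_of_aeval_rat {p : ℚ[X]} (h : aeval D.α p = 0) (hp : p.degree < (D.n : ℕ)) :
    p = 0 := by
  have hirr : Irreducible (D.f.map (algebraMap ℤ ℚ)) :=
    (D.monic.irreducible_iff_irreducible_map_fraction_map).1 D.irreducible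
  have hmin : D.f.map (algebraMap ℤ ℚ) = minpoly ℚ D.α :=
    minpoly.eq_of_irreducible_of_monic hirr (by rw [aeval_map_algebraMap, D.root])
      (D.monic.map _)
  by_contra h0
  have h1 := minpoly.degree_le_of_ne_zero ℚ D.α h0 h
  rw [← hmin, D.monic.degree_map, degree_eq_natDegree D.monic.ne_zero] at h1
  exact absurd hp (not_lt.2 h1)

theorem isUnit_natCast {q m : ℕ} [Fact q.Prime] (hm : ¬ q ∣ m) :
    IsUnit ((m : ℕ) : AdjoinRoot (D.fbar q)) := by
  have h1 : IsUnit (m : ZMod q) :=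
    (ZMod.isUnit_iff_coprime _ _).2 ((Nat.Prime.coprime_iff_not_dvd Fact.out).2 hm).symm
  simpa using h1.map (algebraMap (ZMod q) (AdjoinRoot (D.fbar q)))

theorem exists_mul_aeval_eq {q : ℕ} [Fact q.Prime] (hsq : Squarefree (D.fbar q)) :
    ∃ m : ℕ, ¬ q ∣ m ∧ ∀ x : 𝓞 K, ∃ g : ℤ[X], g.natDegree < D.n ∧ (m : 𝓞 K) * x = aeval D.θ g := by
  obtain ⟨m, hm, h⟩ := D.exists_not_dvd_mul_mem hsq
  refine ⟨m, hm, fun x => ?_⟩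
  obtain ⟨g, hg⟩ := h x x.isIntegral_coe
  refine ⟨g %ₘ D.f, natDegree_modByMonic_lt _ D.monic fun h1 =>
    D.irreducible.not_isUnit (by simp [h1]), ?_⟩
  apply RingOfIntegers.coe_injective
  have h2 : algebraMap (𝓞 K) K (aeval D.θ (g %ₘ D.f)) = aeval D.α (g %ₘ D.f) :=
    (aeval_algebraMap_apply K D.θ _).symm
  have h7 : aeval D.α g = aeval D.α (g %ₘ D.f) := by
    conv_lhs => rw [← modByMonic_add_div g D.f]
    simp [D.root]
  rw [h2, ← h7, ← hg]
  simp

/-- The element of the order with given coordinates, as an algebraic integer. -/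
def eltInt (z : Fin D.n → ℤ) : 𝓞 K := ⟨D.elt z, D.isIntegral _ (D.elt_mem z)⟩

/-- The polynomial with the reductions modulo `q` of row `l` of the matrix `Ω` as coefficients. -/
def redBasis (M : MulCost) (q : ℕ) [Fact q.Prime] (l : Fin D.n) : (ZMod q)[X] :=
  ∑ j : Fin D.n, C (ratRed M q (D.Ω l j)).val * X ^ (j : ℕ)

/-- The members of the basis of the order, as algebraic integers. -/
def basisInt (l : Fin D.n) : 𝓞 K := ⟨D.basis l, D.isIntegral _ (D.basis l).2⟩

theorem eltInt_eq (z : Fin D.n → ℤ) : D.eltInt z = ∑ l, (z l : 𝓞 K) * D.basisInt l := by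
  apply RingOfIntegers.coe_injective
  rw [map_sum]
  simp only [map_mul, map_intCast]
  rfl

variable {D}

/-- Some multiple `m ω_l` with `q ∤ m` lies in `ℤ[α]`. As the powers of `α` are independent over
`ℚ`, its integer coefficients are `m` times the row of `Ω`. So the denominators of `Ω` are prime to
`q`, the reduction of `Ω` is meaningful, and `m` can be cancelled modulo `q`. -/
theorem map_basisInt (M : MulCost) {q : ℕ} [Fact q.Prime] (hsq : Squarefree (D.fbar q))
    {φ : 𝓞 K →+* AdjoinRoot (D.fbar q)} (hφ : ∀ g : ℤ[X],
      φ (aeval D.θ g) = AdjoinRoot.mk _ (g.map (Int.castRingHom (ZMod q)))) (l : Fin D.n) :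
    φ (D.basisInt l) = AdjoinRoot.mk _ (D.redBasis M q l) := by
  obtain ⟨m, hm, h⟩ := D.exists_mul_aeval_eq hsq
  obtain ⟨g, hgn, hg⟩ := h (D.basisInt l)
  have hm0 : (m : ZMod q) ≠ 0 := by rwa [Ne, ZMod.natCast_eq_zero_iff]
  have hΩ : ∀ j : Fin D.n, (m : ℚ) * D.Ω l j = g.coeff j := by
    have h0 : (∑ j : Fin D.n, C ((m : ℚ) * D.Ω l j - g.coeff j) * X ^ (j : ℕ) : ℚ[X]) = 0 := by
      refine D.eq_zero_of_aeval_rat ?_ (degree_sum_fin_lt _)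
      have h1 : aeval D.α g = (m : K) * (D.basis l : K) := by
        have h3 : algebraMap (𝓞 K) K (aeval D.θ g) = aeval D.α g :=
          (aeval_algebraMap_apply K D.θ _).symm
        rw [← h3, ← hg, map_mul, map_natCast]; rfl
      have h2 : aeval D.α g = ∑ j : Fin D.n, (g.coeff j : K) * D.α ^ (j : ℕ) := by
        rw [aeval_eq_sum_range' hgn, Finset.sum_range]
        simp
      rw [h2, D.basis_eq, Finset.mul_sum, ← sub_eq_zero, ← Finset.sum_sub_distrib] at h1
      rw [map_sum, ← neg_eq_zero, ← h1, ← Finset.sum_neg_distrib]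
      refine Finset.sum_congr rfl fun j _ => ?_
      simp; ring
    intro j
    have := congrArg (fun p => p.coeff j) h0
    simp only [finsetSum_coeff, coeff_C_mul, coeff_X_pow, coeff_zero, Fin.val_inj, mul_ite,
      mul_one, mul_zero, Finset.sum_ite_eq, Finset.mem_univ, if_true] at this
    exact sub_eq_zero.1 this
  have hW : ∀ j : Fin D.n, (m : ZMod q) * (ratRed M q (D.Ω l j)).val = (g.coeff j : ZMod q) := by
    intro j
    set b := D.Ω l j
    have h1 : (m : ℤ) * b.num = g.coeff j * b.den := by
      have h2 := hΩ j
      have h3 : b * b.den = b.num := Rat.mul_den_eq_num b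
      have : ((m : ℤ) * b.num : ℚ) = ((g.coeff j * b.den : ℤ) : ℚ) := by
        push_cast
        rw [← h2, ← h3]; ring
      exact_mod_cast this
    have hden : ¬ q ∣ b.den := by
      have h2 : (b.den : ℤ) ∣ m := by
        have h3 : (b.den : ℤ) ∣ (m : ℤ) * b.num := ⟨_, h1.trans (mul_comm _ _)⟩
        refine IsCoprime.dvd_of_dvd_mul_right ?_ h3
        rw [Int.isCoprime_iff_nat_coprime]
        simpa using b.reduced.symm
      exact fun h4 => hm (h4.trans (Int.natCast_dvd_natCast.1 h2))
    have hden0 : (b.den : ZMod q) ≠ 0 := by rwa [Ne, ZMod.natCast_eq_zero_iff]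
    refine mul_right_cancel₀ hden0 ?_
    rw [mul_assoc, ratRed_val_mul M hden]
    have := congrArg (Int.cast : ℤ → ZMod q) h1
    push_cast at this
    exact this
  refine (D.isUnit_natCast hm).mul_left_cancel ?_
  rw [← map_natCast φ, ← map_mul, hg, hφ, map_natCast φ, ← map_natCast (AdjoinRoot.mk (D.fbar q)), ← map_mul]
  congr 1
  rw [redBasis, Finset.mul_sum]
  have : g.map (Int.castRingHom (ZMod q)) =
      ∑ j : Fin D.n, C (g.coeff j : ZMod q) * X ^ (j : ℕ) := by
    conv_lhs => rw [as_sum_range' g _ hgn, Polynomial.map_sum, Finset.sum_range]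
    simp [← C_mul_X_pow_eq_monomial]
  rw [this]
  refine Finset.sum_congr rfl fun j _ => ?_
  rw [← hW, C_mul, mul_assoc]
  simp

/-- Injectivity of the order modulo `q` into `𝔽_q[t]/(f)`. A multiple `m z` with `q ∤ m` is a
polynomial in `α` of degree below `n`; it vanishes modulo `f` and `q`, so all its coefficients are
divisible by `q`. As `ℤ[α]` is contained in the order, `q` divides the coordinates of `m z`, hence
those of `z`. -/
theorem dvd_coord_of_map_eltInt_eq_zero {q : ℕ} [Fact q.Prime] (hsq : Squarefree (D.fbar q))
    {φ : 𝓞 K →+* AdjoinRoot (D.fbar q)} (hφ : ∀ g : ℤ[X],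
      φ (aeval D.θ g) = AdjoinRoot.mk _ (g.map (Int.castRingHom (ZMod q)))) {z : Fin D.n → ℤ}
    (hz : φ (D.eltInt z) = 0) (j : Fin D.n) : (q : ℤ) ∣ z j := by
  obtain ⟨m, hm, h⟩ := D.exists_mul_aeval_eq hsq
  obtain ⟨g, hgn, hg⟩ := h (D.eltInt z)
  have h1 : D.fbar q ∣ g.map (Int.castRingHom (ZMod q)) := by
    rw [← AdjoinRoot.mk_eq_zero, ← hφ, ← hg, map_mul, hz, mul_zero]
  have h2 : g.map (Int.castRingHom (ZMod q)) = 0 := by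
    refine eq_zero_of_dvd_of_natDegree_lt h1 ?_
    rw [fbar, D.monic.natDegree_map]
    exact natDegree_map_le.trans_lt hgn
  have h6 : C (q : ℤ) ∣ g := by
    rw [C_dvd_iff_dvd_coeff]
    intro i
    have := congrArg (fun p => p.coeff i) h2
    simpa [coeff_map, ZMod.intCast_zmod_eq_zero_iff_dvd] using this
  obtain ⟨g', rfl⟩ := h6
  obtain ⟨w, hw⟩ := D.exists_elt_eq (y := aeval D.α g')
    (Algebra.adjoin_le (by simpa using D.α_mem) (aeval_mem_adjoin_singleton ℤ D.α))
  have h7 : D.elt (fun j => m * z j) = D.elt (fun j => q * w j) := by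
    have h8 := congrArg (algebraMap (𝓞 K) K) hg
    have h3 : algebraMap (𝓞 K) K (aeval D.θ (C (q : ℤ) * g')) = aeval D.α (C (q : ℤ) * g') :=
      (aeval_algebraMap_apply K D.θ _).symm
    have h4 : algebraMap (𝓞 K) K (D.eltInt z) = D.elt z := rfl
    rw [h3, map_mul, map_mul, h4, ← hw] at h8
    simpa [elt, Finset.mul_sum, mul_assoc] using h8
  have h9 := congrFun (D.elt_injective h7) j
  have h10 : (q : ℤ) ∣ m * z j := ⟨_, h9⟩
  refine (Int.Prime.dvd_mul' Fact.out h10).resolve_left fun h => hm (Int.natCast_dvd_natCast.1 h)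

/-- The coordinates of an element of the order modulo `q`, from a polynomial in `α` that represents
it modulo `q`. -/
theorem coord_eq {q : ℕ} [Fact q.Prime] (hsq : Squarefree (D.fbar q))
    {φ : 𝓞 K →+* AdjoinRoot (D.fbar q)} (hφ : ∀ g : ℤ[X],
      φ (aeval D.θ g) = AdjoinRoot.mk _ (g.map (Int.castRingHom (ZMod q)))) {z : Fin D.n → ℤ}
    {x : 𝓞 K} (hz : D.eltInt z = D.f₀ * x) {p : (ZMod q)[X]} (hp : plen p ≤ D.n)
    (hx : φ x = AdjoinRoot.mk _ p) (j : Fin D.n) :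
    (z j : ZMod q) = D.f₀ * ∑ l : Fin D.n, p.coeff l * (D.T l j : ZMod q) := by
  -- `p` is lifted to `ℤ[t]`, and `w` lists the coordinates of `f₀` times the value of the lift at
  -- `α`. Then `z - w` reduces to zero, and the preceding lemma applies.
  let w : Fin D.n → ℤ := fun j => D.f₀ * ∑ l : Fin D.n, (p.coeff l).val * D.T l j
  let g : ℤ[X] := C (D.f₀ : ℤ) * ∑ l : Fin D.n, C ((p.coeff l).val : ℤ) * X ^ (l : ℕ)
  have h1 : D.eltInt w = aeval D.θ g := by
    apply RingOfIntegers.coe_injective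
    have h3 : algebraMap (𝓞 K) K (aeval D.θ g) = aeval D.α g :=
      (aeval_algebraMap_apply K D.θ _).symm
    have h4 : algebraMap (𝓞 K) K (D.eltInt w) = D.elt w := rfl
    rw [h3, h4, map_mul, map_sum]
    simp only [map_mul, map_pow, aeval_X, D.pow_eq_sum]
    simp only [elt_eq_sum, w]
    push_cast
    simp only [Finset.mul_sum, Finset.sum_mul]
    rw [Finset.sum_comm]
    refine Finset.sum_congr rfl fun l _ => Finset.sum_congr rfl fun i _ => ?_
    simp only [map_natCast]
    ring
  have h2 : φ (D.eltInt (z - w)) = 0 := by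
    have h3 : D.eltInt (z - w) = D.eltInt z - D.eltInt w := by
      simp [eltInt_eq, sub_mul]
    have h5 : (∑ l : Fin D.n, C (p.coeff l) * X ^ (l : ℕ)) = p := by
      conv_rhs => rw [as_sum_range' p D.n (Nat.lt_of_succ_le hp), Finset.sum_range]
      simp [C_mul_X_pow_eq_monomial]
    rw [h3, map_sub, h1, hφ, hz, map_mul, hx, map_natCast, sub_eq_zero,
      ← map_natCast (AdjoinRoot.mk (D.fbar q)), ← map_mul]
    congr 1
    conv_lhs => rw [← h5]
    simp only [g, Polynomial.map_mul, Polynomial.map_sum, Polynomial.map_pow, map_X, map_C]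
    simp
  have h3 := dvd_coord_of_map_eltInt_eq_zero hsq hφ h2 j
  rw [← ZMod.intCast_zmod_eq_zero_iff_dvd] at h3
  simp only [Pi.sub_apply, Int.cast_sub, sub_eq_zero] at h3
  rw [h3]
  simp [w]

end OrderData
end CrtRoot
end

noncomputable section
namespace CrtRoot

/-! ## Coordinates and conjugates -/

namespace OrderData

variable {K : Type*} [Field K] [NumberField K] (D : OrderData K)

/-- The matrix of the conjugates of the basis. -/
def conj : Matrix (Fin D.n) (Fin D.n) ℂ := Matrix.of fun i j => D.σ j (D.basis i : K)

/-- A kernel vector would be a linear relation between the embeddings, valid on the order and, since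
every element of `K` has a non-zero integer multiple in the order, on all of `K`. Dedekind's
independence of characters excludes it. -/
theorem det_conj_ne_zero : D.conj.det ≠ 0 := by
  intro h0
  obtain ⟨v, hv, hmv⟩ := Matrix.exists_mulVec_eq_zero_iff.2 h0
  have h1 : ∀ z : Fin D.n → ℤ, ∑ j : Fin D.n, v j * D.σ j (D.elt z) = 0 := by
    intro z
    have h2 : ∀ i, ∑ j : Fin D.n, D.σ j (D.basis i : K) * v j = 0 := fun i => congrFun hmv i
    calc ∑ j : Fin D.n, v j * D.σ j (D.elt z)
        = ∑ i, (z i : ℂ) * ∑ j : Fin D.n, D.σ j (D.basis i : K) * v j := by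
          simp only [elt_eq_sum, map_sum, map_mul, map_intCast, Finset.mul_sum]
          rw [Finset.sum_comm]
          exact Finset.sum_congr rfl fun _ _ => Finset.sum_congr rfl fun _ _ => by ring
      _ = 0 := by simp [h2]
  have h3 : ∀ x : K, ∑ j : Fin D.n, v j * D.σ j x = 0 := by
    intro x
    obtain ⟨d, hd, hx⟩ := exists_integral_multiples ℤ ℚ ({x} : Finset K)
    obtain ⟨z, hz⟩ := D.exists_elt_eq (D.f₀_mul_mem _ (hx x (by simp)))
    have h4 := h1 z
    rw [hz] at h4
    have h5 : ((D.f₀ : ℂ) * d) * ∑ j : Fin D.n, v j * D.σ j x = 0 := by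
      rw [← h4, Finset.mul_sum]
      refine Finset.sum_congr rfl fun j _ => ?_
      rw [zsmul_eq_mul]
      simp only [map_mul, map_natCast, map_intCast]
      ring
    have h6 : (D.f₀ : ℂ) * d ≠ 0 :=
      mul_ne_zero (Nat.cast_ne_zero.2 D.f₀_pos.ne') (Int.cast_ne_zero.2 hd)
    exact (mul_eq_zero.1 h5).resolve_left h6
  have hli := linearIndependent_monoidHom K ℂ
  have h4 : LinearIndependent ℂ fun j : Fin D.n => ((D.σ j : K →* ℂ) : K → ℂ) :=
    hli.comp (fun j : Fin D.n => (D.σ j : K →* ℂ)) fun i j hij =>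
      D.σ.injective (RingHom.ext fun x => DFunLike.congr_fun hij x)
  refine hv (funext fun j => ?_)
  refine Fintype.linearIndependent_iff.1 h4 v ?_ j
  funext x
  simpa using h3 x

/-- The coordinate vector is the row vector of conjugates times the inverse matrix, so column sums
of that inverse matter, and `Cinf` bounds these. -/
theorem abs_coord_le {z : Fin D.n → ℤ} {R : ℝ} (h : ∀ φ : K →+* ℂ, ‖φ (D.elt z)‖ ≤ R)
    (i : Fin D.n) : |(z i : ℝ)| ≤ D.Cinf * R := by
  have hR : 0 ≤ R := by
    have j : Fin D.n := i
    exact (norm_nonneg _).trans (h (D.σ j))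
  have h1 : (fun i => (z i : ℂ)) = Matrix.vecMul (fun j : Fin D.n => D.σ j (D.elt z)) D.conj⁻¹ := by
    have h2 : (fun j : Fin D.n => D.σ j (D.elt z)) =
        Matrix.vecMul (fun i => (z i : ℂ)) D.conj := by
      funext j
      simp [elt_eq_sum, Matrix.vecMul, dotProduct, conj]
    rw [h2, Matrix.vecMul_vecMul, Matrix.mul_nonsing_inv _ (isUnit_iff_ne_zero.2 D.det_conj_ne_zero),
      Matrix.vecMul_one]
  have h3 : |(z i : ℝ)| = ‖∑ j : Fin D.n, D.σ j (D.elt z) * D.conj⁻¹ j i‖ := by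
    have := congrFun h1 i
    simp only [Matrix.vecMul, dotProduct] at this
    rw [← this, Complex.norm_intCast]
  rw [h3]
  have h4 : ∑ j, ‖D.conj⁻¹ j i‖ ≤ (D.Cinf : ℝ) := D.sum_norm_le i
  calc ‖∑ j : Fin D.n, D.σ j (D.elt z) * D.conj⁻¹ j i‖
      ≤ ∑ j : Fin D.n, R * ‖D.conj⁻¹ j i‖ := by
        refine norm_sum_le_of_le _ fun j _ => ?_
        rw [norm_mul]
        exact mul_le_mul_of_nonneg_right (h _) (norm_nonneg _)
    _ ≤ D.Cinf * R := by
        rw [← Finset.mul_sum, mul_comm]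
        exact mul_le_mul_of_nonneg_right h4 hR

theorem one_le_house {z : Fin D.n → ℤ} (hz : z ≠ 0) : 1 ≤ house (D.elt z) := by
  refine one_le_house_of_isIntegral (D.isIntegral _ (D.elt_mem z)) fun h => hz ?_
  refine D.elt_injective (h.trans ?_)
  simp [elt_eq_sum]

/-- As `b i ≥ 1`, each exponent `a i < e` may be raised to `e` in the upper bound; then `e`-th roots
are taken. The result does not depend on the size of the exponents. -/
theorem norm_le_prod {r e : ℕ} {u : Fin r → Fin D.n → ℤ} {a b : Fin r → ℕ} (he : 0 < e)
    (hu : ∀ i, u i ≠ 0) (ha : ∀ i, a i < e) (hb : ∀ i, house (D.elt (u i)) ≤ b i) {x : K}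
    (hx : x ^ e = ∏ i, D.elt (u i) ^ a i) (φ : K →+* ℂ) : ‖φ x‖ ≤ ∏ i, (b i : ℝ) := by
  have hb1 : ∀ i, (1 : ℝ) ≤ b i := fun i => (D.one_le_house (hu i)).trans (hb i)
  have h0 : 0 ≤ ∏ i, (b i : ℝ) := Finset.prod_nonneg fun i _ => zero_le_one.trans (hb1 i)
  refine le_of_pow_le_pow_left₀ he.ne' h0 ?_
  rw [← norm_pow, ← map_pow, hx, map_prod, norm_prod, ← Finset.prod_pow]
  refine Finset.prod_le_prod (fun _ _ => norm_nonneg _) fun i _ => ?_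
  rw [map_pow, norm_pow]
  calc _ ≤ (b i : ℝ) ^ a i :=
        pow_le_pow_left₀ (norm_nonneg _) ((norm_embedding_le_house _ φ).trans (hb i)) _
    _ ≤ _ := pow_le_pow_right₀ (hb1 i) (ha i).le

theorem isIntegral_root {r e : ℕ} {u : Fin r → Fin D.n → ℤ} {a : Fin r → ℕ} (he : 0 < e) {x : K}
    (hx : x ^ e = ∏ i, D.elt (u i) ^ a i) : IsIntegral ℤ x := by
  refine IsIntegral.of_pow he ?_
  rw [hx]
  exact IsIntegral.prod _ fun i _ => (D.isIntegral _ (D.elt_mem _)).pow _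

theorem boundB_val (M : MulCost) {r : ℕ} (b : Fin r → ℕ) :
    (boundB M D b).val = D.f₀ * (D.Cinf * ∏ i, (b i : ℤ)) := by
  have h : ∀ l : List ℤ, (foldT (zmul M) 1 l).val = l.prod := by
    intro l
    rw [foldT_val]
    induction l with
    | nil => rfl
    | cons a l ih => simpa [zmul] using Or.inl ih
  simp [boundB, zmul, h, List.prod_ofFn]

theorem abs_coord_root_le (M : MulCost) {r e : ℕ} {u : Fin r → Fin D.n → ℤ} {a b : Fin r → ℕ}
    (he : 0 < e) (hu : ∀ i, u i ≠ 0) (ha : ∀ i, a i < e)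
    (hb : ∀ i, house (D.elt (u i)) ≤ b i) {x : K} (hx : x ^ e = ∏ i, D.elt (u i) ^ a i)
    {z : Fin D.n → ℤ} (hz : D.elt z = D.f₀ * x) (j : Fin D.n) : |z j| ≤ (boundB M D b).val := by
  have h1 := D.abs_coord_le (z := z) (R := D.f₀ * ∏ i, (b i : ℝ)) (fun φ => by
    rw [hz, map_mul, norm_mul, map_natCast, Complex.norm_natCast]
    exact mul_le_mul_of_nonneg_left (D.norm_le_prod he hu ha hb hx φ) (Nat.cast_nonneg _)) j
  rw [D.boundB_val]
  have : ((|z j| : ℤ) : ℝ) ≤ ((D.f₀ * (D.Cinf * ∏ i, (b i : ℤ)) : ℤ) : ℝ) := by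
    push_cast
    linarith
  exact_mod_cast this

end OrderData

/-! ## The root modulo one prime -/

section RootModPrime

variable {K : Type*} [Field K] [NumberField K] {D : OrderData K} {M : MulCost} {q : ℕ}
  [Fact q.Prime] {r : ℕ}

theorem zred_val (a : ℤ) : (zred M q a).val = (a : ZMod q) := by
  simp [zred, zmod]

theorem redPoly_val : (redPoly M D q).val = D.fbar q := by
  have h1 : (D.fbar q).natDegree < D.n + 1 := by
    rw [OrderData.fbar, D.monic.natDegree_map]
    exact Nat.lt_succ_self _
  rw [as_sum_range' (D.fbar q) _ h1, Finset.sum_range]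
  simp [redPoly, zred_val, forFin_val, C_mul_X_pow_eq_monomial, OrderData.fbar]

/-- The polynomial that represents the element with coordinates `c` modulo `q`. -/
def redElt (M : MulCost) (D : OrderData K) (q : ℕ) [Fact q.Prime] (c : Fin D.n → ℤ) : (ZMod q)[X] :=
  ∑ j : Fin D.n, C (∑ l : Fin D.n, ((c l : ℤ) : ZMod q) * (ratRed M q (D.Ω l j)).val) *
    X ^ (j : ℕ)

theorem plen_redElt_le (c : Fin D.n → ℤ) : plen (redElt M D q c) ≤ D.n := by
  have h := degree_sum_fin_lt fun j : Fin D.n =>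
    ∑ l : Fin D.n, ((c l : ℤ) : ZMod q) * (ratRed M q (D.Ω l j)).val
  have h2 : (redElt M D q c).natDegree < D.n := by
    by_cases h0 : redElt M D q c = 0
    · rw [h0]; exact D.one_le_n
    · exact (natDegree_lt_iff_degree_lt h0).2 h
  exact h2

theorem redElt_eq (c : Fin D.n → ℤ) :
    redElt M D q c = ∑ l : Fin D.n, C ((c l : ℤ) : ZMod q) * D.redBasis M q l := by
  simp only [redElt, OrderData.redBasis, Finset.mul_sum, map_sum, Finset.sum_mul]
  rw [Finset.sum_comm]
  exact Finset.sum_congr rfl fun _ _ => Finset.sum_congr rfl fun _ _ => by rw [C_mul, mul_assoc]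

/-- The coordinates modulo `q` that are read off from the polynomial `x`. -/
def coordsOf (D : OrderData K) (q : ℕ) (x : (ZMod q)[X]) (j : Fin D.n) : ZMod q :=
  D.f₀ * ∑ l : Fin D.n, x.coeff l * (D.T l j : ZMod q)

/-- The time for the reduction of the field data and of the `uᵢ` modulo `q`. -/
def dataTime (M : MulCost) (D : OrderData K) (q : ℕ) [Fact q.Prime] (r : ℕ) : ℝ :=
  (∑ i : Fin (D.n + 1), (zred M q (D.f.coeff i)).time) +
    (∑ i : Fin D.n, ∑ j : Fin D.n, (ratRed M q (D.Ω i j)).time) +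
    (∑ i : Fin D.n, ∑ j : Fin D.n, (zred M q (D.T i j)).time) + (zred M q D.f₀).time +
    r * (D.n * (D.n * (M.P 1 (len q) + len q)))

/-- The time for writing the root on the basis of the order. -/
def coordsTime (M : MulCost) (D : OrderData K) (q : ℕ) : ℝ :=
  D.n * (D.n * (M.P 1 (len q) + len q) + M.P 1 (len q))

theorem rootModPrime_val_eq (e : ℕ) (a : Fin r → ℕ) (τs : List (Fin D.n → Fin q))
    (c : Fin r → Fin D.n → ℤ) : (rootModPrime M D e a q τs c).val =
      (rootModPoly M τs (D.fbar q) e a fun i => redElt M D q (c i)).val.map fun x j =>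
        (((coordsOf D q x j).val : ℕ) : ℤ) := by
  unfold rootModPrime
  simp -implicitDefEqProofs only [Timed.val_bind, forFin_val, redPoly_val, fsum, fmul, tick_val,
    Timed.val_pure]
  simp only [redElt]
  split
  · rename_i h
    rw [h]; rfl
  · rename_i x h
    rw [h]
    simp only [Timed.val_bind, forFin_val, Timed.val_pure, Option.map_some, zred_val, coordsOf,
      Int.cast_natCast, tick_val]

theorem rootModPrime_time_eq (e : ℕ) (a : Fin r → ℕ) (τs : List (Fin D.n → Fin q))
    (c : Fin r → Fin D.n → ℤ) : (rootModPrime M D e a q τs c).time = dataTime M D q r +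
      (rootModPoly M τs (D.fbar q) e a fun i => redElt M D q (c i)).time +
      if (rootModPoly M τs (D.fbar q) e a fun i => redElt M D q (c i)).val.isSome then
        coordsTime M D q else 0 := by
  simp only [rootModPrime, Timed.val_bind, Timed.time_bind, forFin_val, forFin_time, redPoly_val,
    fsum, fmul, tick_val, tick_time, Timed.val_pure, Timed.time_pure]
  change _ + (_ + (_ + (_ + (_ + ((rootModPoly M τs (D.fbar q) e a fun i => redElt M D q (c i)).time
    + Timed.time (match (rootModPoly M τs (D.fbar q) e a fun i => redElt M D q (c i)).val with
    | none => _ | some x => _)))))) = _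
  have : (redPoly M D q).time = ∑ i : Fin (D.n + 1), (zred M q (D.f.coeff i)).time := by
    simp [redPoly, forFin_time]
  rw [this]
  generalize (rootModPoly M τs (D.fbar q) e a fun i => redElt M D q (c i)).val = o
  cases o with
  | none => simp [dataTime]; ring
  | some x => simp [dataTime, coordsTime, forFin_time]; ring

theorem coordsTime_nonneg : 0 ≤ coordsTime M D q := by
  have := M.P_nonneg 1 (len q)
  unfold coordsTime; positivity

theorem zred_nonneg (a : ℤ) : 0 ≤ (zred M q a).time :=
  Timed.bind_nonneg (M.zdivPrice_nonneg _ _) fun _ => Timed.pure_nonneg _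

theorem ratRed_nonneg (b : ℚ) : 0 ≤ (ratRed M q b).time :=
  Timed.bind_nonneg (M.zdivPrice_nonneg _ _) fun _ =>
    Timed.bind_nonneg (M.zdivPrice_nonneg _ _) fun _ =>
      Timed.bind_nonneg (zinv_time_nonneg _ _) fun _ =>
        Timed.bind_nonneg (M.Z_nonneg _) fun _ => zred_nonneg _

theorem dataTime_nonneg : 0 ≤ dataTime M D q r := by
  have h1 := M.P_nonneg 1 (len q)
  have h2 : 0 ≤ ∑ i : Fin (D.n + 1), (zred M q (D.f.coeff i)).time :=
    Finset.sum_nonneg fun _ _ => zred_nonneg _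
  have h3 : 0 ≤ ∑ i : Fin D.n, ∑ j : Fin D.n, (ratRed M q (D.Ω i j)).time :=
    Finset.sum_nonneg fun _ _ => Finset.sum_nonneg fun _ _ => ratRed_nonneg _
  have h4 : 0 ≤ ∑ i : Fin D.n, ∑ j : Fin D.n, (zred M q (D.T i j)).time :=
    Finset.sum_nonneg fun _ _ => Finset.sum_nonneg fun _ _ => zred_nonneg _
  have h5 := zred_nonneg (M := M) (q := q) D.f₀
  have h6 : 0 ≤ (r : ℝ) * (D.n * (D.n * (M.P 1 (len q) + len q))) := by positivity
  unfold dataTime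
  linarith

theorem rootModPoly_le_rootModPrime (e : ℕ) (a : Fin r → ℕ) (τs : List (Fin D.n → Fin q))
    (c : Fin r → Fin D.n → ℤ) :
    (rootModPoly M τs (D.fbar q) e a fun i => redElt M D q (c i)).time ≤
      (rootModPrime M D e a q τs c).time := by
  rw [rootModPrime_time_eq]
  have h1 := dataTime_nonneg (M := M) (D := D) (q := q) (r := r)
  have h2 := coordsTime_nonneg (M := M) (D := D) (q := q)
  split_ifs <;> linarith

theorem rootModPrime_nonneg (e : ℕ) (a : Fin r → ℕ) (τs : List (Fin D.n → Fin q))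
    (c : Fin r → Fin D.n → ℤ) : 0 ≤ (rootModPrime M D e a q τs c).time :=
  (rootModPoly_nonneg _ _ _ _ _).trans (rootModPoly_le_rootModPrime e a τs c)

theorem length_le_rootModPrime_time {e : ℕ} {a : Fin r → ℕ} {τs : List (Fin D.n → Fin q)}
    {c : Fin r → Fin D.n → ℤ} (h : (rootModPrime M D e a q τs c).val = none) :
    (τs.length : ℝ) ≤ (rootModPrime M D e a q τs c).time := by
  rw [rootModPrime_val_eq, Option.map_eq_none_iff] at h
  exact (length_le_rootModPoly_time D.one_le_n h).trans (rootModPoly_le_rootModPrime e a τs c)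

theorem rootModPrime_val_range {e : ℕ} {a : Fin r → ℕ} {τs : List (Fin D.n → Fin q)}
    {c : Fin r → Fin D.n → ℤ} {v : Fin D.n → ℤ} (h : (rootModPrime M D e a q τs c).val = some v)
    (j : Fin D.n) : len (v j) ≤ len q := by
  rw [rootModPrime_val_eq, Option.map_eq_some_iff] at h
  obtain ⟨x, -, rfl⟩ := h
  exact len_mono (ZMod.val_lt (coordsOf D q x j)).le

variable {ℓ m : ℕ} {c : ℝ} {κ : ℕ}

theorem natDegree_fbar : (D.fbar q).natDegree = D.n := D.monic.natDegree_map _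

/-- The reduction of `x` itself, represented by a polynomial `ξ`, is an `e`-th root modulo `f` of
the reduced product. Roots being unique modulo every factor, the computed polynomial agrees with `ξ`
modulo `f`, and `coord_eq` converts it into the coordinates of `f₀ x`. -/
theorem rootModPrime_val_modEq (hM : M.Tame c) (hg : GoodPrime D ℓ q) (hℓ : ℓ.Prime)
    {a : Fin r → ℕ} {u : Fin r → Fin D.n → ℤ} {x : K}
    (hx : x ^ (ℓ ^ m) = ∏ i, D.elt (u i) ^ a i) {z : Fin D.n → ℤ} (hz : D.elt z = D.f₀ * x)
    {cs : Fin r → Fin D.n → ℤ} (hc : ∀ i l, cs i l ≡ u i l [ZMOD q])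
    {τs : List (Fin D.n → Fin q)} {v : Fin D.n → ℤ}
    (h : (rootModPrime M D (ℓ ^ m) a q τs cs).val = some v) (j : Fin D.n) :
    v j ≡ z j [ZMOD q] := by
  rw [rootModPrime_val_eq, Option.map_eq_some_iff] at h
  obtain ⟨p, hp, rfl⟩ := h
  obtain ⟨φ, hφ⟩ := D.exists_reduction hg.squarefree
  let y : 𝓞 K := ⟨x, D.isIntegral_root (pow_pos hℓ.pos m) hx⟩
  have hy : y ^ (ℓ ^ m) = ∏ i, D.eltInt (u i) ^ a i := by
    apply RingOfIntegers.coe_injective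
    simp only [map_pow, map_prod]
    exact hx
  obtain ⟨ξ, hξ⟩ := AdjoinRoot.mk_surjective (φ y)
  have hu : ∀ i, φ (D.eltInt (u i)) = AdjoinRoot.mk _ (redElt M D q (cs i)) := by
    intro i
    rw [redElt_eq, D.eltInt_eq, map_sum, map_sum]
    refine Finset.sum_congr rfl fun l _ => ?_
    have h1 : C ((cs i l : ℤ) : ZMod q) = ((u i l : ℤ) : (ZMod q)[X]) := by
      rw [(ZMod.intCast_eq_intCast_iff _ _ _).2 (hc i l)]; simp
    rw [map_mul, map_mul, OrderData.map_basisInt M hg.squarefree hφ l, map_intCast, h1, map_intCast]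
  have hdvd : D.fbar q ∣ ξ ^ (ℓ ^ m) - ∏ i, redElt M D q (cs i) ^ a i := by
    rw [dvd_sub_iff_mk_eq, map_pow, hξ, ← map_pow, hy, map_prod, map_prod]
    exact Finset.prod_congr rfl fun i _ => by rw [map_pow, map_pow, hu]
  -- Only the value is of interest here, so the size parameters take their smallest admissible
  -- values.
  have hw : Within q D.n (len q) := ⟨D.one_le_n, le_rfl⟩
  obtain ⟨h1, h2⟩ := rootModPoly_val hw hM le_rfl hg.odd (pow_pos hℓ.pos m)
    (fun i => plen_redElt_le _) (D.monic.map _) hg.squarefree natDegree_fbar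
    (fun h hi hd => hg.coprime hℓ hi hd) hp hdvd
  have hzy : D.eltInt z = D.f₀ * y := by
    apply RingOfIntegers.coe_injective
    rw [map_mul, map_natCast]
    exact hz
  rw [← ZMod.intCast_eq_intCast_iff,
    OrderData.coord_eq hg.squarefree hφ hzy h2 (by rw [← hξ]; exact (dvd_sub_iff_mk_eq.1 h1).symm)]
  simp [coordsOf]

variable (D) in
/-- `X` bounds the lengths of the data of the number field. -/
structure DataLen (X : ℕ) : Prop where
  f : ∀ i : Fin (D.n + 1), len (D.f.coeff i) ≤ X
  num : ∀ i j : Fin D.n, len (D.Ω i j).num ≤ X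
  den : ∀ i j : Fin D.n, len ((D.Ω i j).den : ℤ) ≤ X
  T : ∀ i j : Fin D.n, len (D.T i j) ≤ X
  f₀ : len (D.f₀ : ℤ) ≤ X
  lg : lg (D.n + 1) ≤ X

variable (D) in
theorem exists_dataLen : ∃ X, DataLen D X := by
  have hF : ∀ {ι : Type} [Fintype ι] (g : ι → ℕ), ∃ X, ∀ i, g i ≤ X := fun g =>
    ⟨Finset.univ.sup g, fun i => Finset.le_sup (Finset.mem_univ i)⟩
  obtain ⟨X1, h1⟩ := hF fun i : Fin (D.n + 1) => len (D.f.coeff i)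
  obtain ⟨X2, h2⟩ := hF fun p : Fin D.n × Fin D.n => len (D.Ω p.1 p.2).num
  obtain ⟨X3, h3⟩ := hF fun p : Fin D.n × Fin D.n => len ((D.Ω p.1 p.2).den : ℤ)
  obtain ⟨X4, h4⟩ := hF fun p : Fin D.n × Fin D.n => len (D.T p.1 p.2)
  refine ⟨X1 + X2 + X3 + X4 + len (D.f₀ : ℤ) + CrtRoot.lg (D.n + 1),
    fun i => ?_, fun i j => ?_, fun i j => ?_, fun i j => ?_, ?_, ?_⟩
  · have := h1 i; omega
  · have := h2 (i, j); dsimp only at this; omega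
  · have := h3 (i, j); dsimp only at this; omega
  · have := h4 (i, j); dsimp only at this; omega
  all_goals omega

theorem zred_time_le (hM : M.Tame c) {a : ℤ} {X : ℕ} (ha : len a ≤ X) (hq : len (q : ℤ) ≤ κ) :
    (zred M q a).time ≤ c * (X + κ) * κ := by
  simpa [zred, zmod] using hM.zdivPrice_le ha hq

theorem ratRed_time_le (hM : M.Tame c) {b : ℚ} {X : ℕ} (hn : len b.num ≤ X)
    (hd : len (b.den : ℤ) ≤ X) (hq : len (q : ℤ) ≤ κ) :
    (ratRed M q b).time ≤ 2 * (c * (X + κ) * κ) + 5 * (c * κ * κ) := by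
  have hc := hM.two_le
  have hq0 : 0 < q := (Fact.out : q.Prime).pos
  simp only [ratRed, Timed.time_bind, zmod, zmul, zinv, tick_time, tick_val]
  have h1 := hM.zdivPrice_le hn hq
  have h2 := hM.zdivPrice_le hd hq
  have hmod : ∀ a : ℤ, len (a % q) ≤ κ := fun a => (len_emod_le a hq0).trans hq
  have hmax : ∀ a : ℤ, max (len (a % q)) (len (q : ℤ)) ≤ κ := fun a => max_le (hmod a) hq
  have h3 : M.Z (max (len ((b.den : ℤ) % q)) (len q)) *
      lg (max (len ((b.den : ℤ) % q)) (len q)) ≤ c * κ * κ := by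
    have h4 := hM.quad (max (len ((b.den : ℤ) % q)) (len q))
    have h5 : ((max (len ((b.den : ℤ) % q)) (len q) : ℕ) : ℝ) ≤ κ := Nat.cast_le.2 (hmax _)
    have h6 : ((max (len ((b.den : ℤ) % q)) (len q) : ℕ) : ℝ) ^ 2 ≤ κ ^ 2 :=
      pow_le_pow_left₀ (Nat.cast_nonneg _) h5 2
    nlinarith
  have h4 : M.Z (max (len (b.num % q)) (len (Int.gcdA ((b.den : ℤ) % q) q % q))) ≤ c * κ * κ := by
    have h5 := (M.Z_mono (max_le (hmod b.num) (hmod (Int.gcdA ((b.den : ℤ) % q) q)))).trans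
      (hM.Z_le κ)
    linarith
  have h5 : (zred M q (b.num % q * (Int.gcdA ((b.den : ℤ) % q) q % q))).time ≤
      c * ((2 * κ : ℕ) + κ) * κ := by
    refine zred_time_le hM ?_ hq
    refine (len_mul_le _ _).trans ?_
    have := hmod b.num
    have := hmod (Int.gcdA ((b.den : ℤ) % q) q)
    omega
  push_cast at h5
  nlinarith

/-- Here `Y = κ + X`. The coefficient `172` covers `24 + 132` from `sum_rootModPoly_time_le`, `11`
for reducing the field data, and `5/2` for the changes of basis, where `2 ≤ c` turns `5 M.P n κ`
into `5/2` units. Throughout, `n κ ≤ M.P n κ` absorbs one dimension of the matrices. -/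
theorem sum_rootModPrime_time_le (hM : M.Tame c) (hg : GoodPrime D ℓ q) (hℓ : ℓ.Prime)
    {a : Fin r → ℕ} {cs : Fin r → Fin D.n → ℤ} (hr : 0 < r) (hq : len (q : ℤ) ≤ κ) {X E : ℕ}
    (hX : DataLen D X) (hE : ∀ i, len (a i : ℤ) ≤ E) (heE : len ((ℓ ^ m : ℕ) : ℤ) ≤ E) (N : ℕ) :
    ∑ τs : Fin N → Fin D.n → Fin q, (rootModPrime M D (ℓ ^ m) a q (List.ofFn τs) cs).time ≤
      (Fintype.card (Fin N → Fin D.n → Fin q) : ℝ) *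
        (r * D.n * (c * (172 * (κ + X) * M.P D.n κ + 3 * κ * E))) := by
  have hc := hM.two_le
  have hw : Within q D.n κ := ⟨D.one_le_n, hq⟩
  have hY : (κ : ℝ) + lg (D.n + 1) ≤ κ + X := by
    have : (lg (D.n + 1) : ℝ) ≤ X := by exact_mod_cast hX.lg
    linarith
  have h1 := sum_rootModPoly_time_le (a := a) hw hM hY hg.odd (pow_pos hℓ.pos m)
    (fun i => plen_redElt_le (M := M) (cs i)) (D.monic.map _) hg.squarefree natDegree_fbar
    (fun h hi hd => hg.coprime hℓ hi hd) hr hE heE N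
  set W := M.P D.n κ with hW
  have hn1 : (1 : ℝ) ≤ D.n := by exact_mod_cast D.one_le_n
  have hr1 : (1 : ℝ) ≤ r := by exact_mod_cast hr
  have hκ1 : (1 : ℝ) ≤ κ := by exact_mod_cast hw.one_le_κ
  have hX0 : (0 : ℝ) ≤ X := Nat.cast_nonneg X
  have hE0 : (0 : ℝ) ≤ E := Nat.cast_nonneg E
  have hWκ : D.n * (κ : ℝ) ≤ W := M.le_P _ _
  have hW0 : 0 ≤ W := M.P_nonneg _ _
  have hP1 : D.n * M.P 1 (len q) ≤ W := by
    refine (M.mul_P_le D.n 1 (len q)).trans ?_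
    rw [mul_one]
    exact M.P_mono _ _ _ hq
  have hP0 : 0 ≤ M.P 1 (len q) := M.P_nonneg _ _
  have hqκ : (len (q : ℤ) : ℝ) ≤ κ := by exact_mod_cast hq
  have hPs : D.n * (M.P 1 (len q) + len q) ≤ 2 * W := by nlinarith
  have hdata : dataTime M D q r ≤ 11 * c * D.n * ((X + κ) * W) + 2 * (r * D.n * W) := by
    have hV : 0 ≤ c * (X + κ) * κ := by positivity
    have d1 : ∑ i : Fin (D.n + 1), (zred M q (D.f.coeff i)).time ≤
        (D.n + 1) * (c * (X + κ) * κ) := by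
      refine (Finset.sum_le_card_nsmul _ _ _ fun i _ => zred_time_le hM (hX.f i) hq).trans ?_
      simp
    have d2 : ∑ i : Fin D.n, ∑ j : Fin D.n, (ratRed M q (D.Ω i j)).time ≤
        D.n * (D.n * (2 * (c * (X + κ) * κ) + 5 * (c * κ * κ))) := by
      refine (Finset.sum_le_card_nsmul _ _ _ fun i _ => Finset.sum_le_card_nsmul _ _ _ fun j _ =>
        ratRed_time_le hM (hX.num i j) (hX.den i j) hq).trans (le_of_eq ?_)
      simp only [Finset.card_univ, Fintype.card_fin, nsmul_eq_mul]
    have d3 : ∑ i : Fin D.n, ∑ j : Fin D.n, (zred M q (D.T i j)).time ≤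
        D.n * (D.n * (c * (X + κ) * κ)) := by
      refine (Finset.sum_le_card_nsmul _ _ _ fun i _ => Finset.sum_le_card_nsmul _ _ _ fun j _ =>
        zred_time_le hM (hX.T i j) hq).trans ?_
      simp
    have d4 := zred_time_le (q := q) hM hX.f₀ hq
    have d5 : c * κ * κ ≤ c * (X + κ) * κ := by
      have : c * κ * κ ≤ c * κ * κ + c * X * κ := by
        have : 0 ≤ c * X * κ := by positivity
        linarith
      linarith
    have d6 : (r : ℝ) * (D.n * (D.n * (M.P 1 (len q) + len q))) ≤ r * (D.n * (2 * W)) := by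
      gcongr
    have d7 : D.n * (D.n * (c * (X + κ) * κ)) ≤ c * D.n * ((X + κ) * W) := by
      have : D.n * (c * (X + κ) * κ) ≤ c * (X + κ) * W := by
        have := mul_le_mul_of_nonneg_left hWκ (show 0 ≤ c * ((X : ℝ) + κ) by positivity)
        linarith
      have := mul_le_mul_of_nonneg_left this (Nat.cast_nonneg (α := ℝ) D.n)
      linarith
    have d9 : D.n * (c * (X + κ) * κ) ≤ D.n * (D.n * (c * (X + κ) * κ)) :=
      le_mul_of_one_le_left (by positivity) hn1
    have d8 : c * (X + κ) * κ ≤ D.n * (D.n * (c * (X + κ) * κ)) := by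
      exact (le_mul_of_one_le_left hV hn1).trans d9
    have d10 : D.n * (D.n * (2 * (c * (X + κ) * κ) + 5 * (c * κ * κ))) ≤
        D.n * (D.n * (7 * (c * (X + κ) * κ))) := by
      gcongr
      linarith
    unfold dataTime
    linarith
  have hcoord : coordsTime M D q ≤ 3 * (r * D.n * W) := by
    have h2 : coordsTime M D q ≤ D.n * (3 * W) := by
      unfold coordsTime
      have : M.P 1 (len q) ≤ W := by nlinarith
      gcongr
      linarith
    have h3 : D.n * W ≤ r * (D.n * W) := le_mul_of_one_le_left (by positivity) hr1
    linarith
  have hsum : ∑ τs : Fin N → Fin D.n → Fin q,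
      (rootModPrime M D (ℓ ^ m) a q (List.ofFn τs) cs).time ≤
      ∑ τs : Fin N → Fin D.n → Fin q, ((dataTime M D q r + coordsTime M D q) +
        (rootModPoly M (List.ofFn τs) (D.fbar q) (ℓ ^ m) a fun i => redElt M D q (cs i)).time) := by
    refine Finset.sum_le_sum fun τs _ => ?_
    rw [rootModPrime_time_eq]
    have h2 := coordsTime_nonneg (M := M) (D := D) (q := q)
    split_ifs <;> linarith
  refine hsum.trans ?_
  rw [Finset.sum_add_distrib, Finset.sum_const, Finset.card_univ, nsmul_eq_mul]
  refine (add_le_add_right h1 _).trans ?_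
  rw [← mul_add]
  refine mul_le_mul_of_nonneg_left ?_ (Nat.cast_nonneg _)
  have k1 : r * D.n * W ≤ r * D.n * (c * (κ * W)) * (1 / 2) := by
    have : W ≤ c * (κ * W) * (1 / 2) := by
      have h3 : W ≤ κ * W := le_mul_of_one_le_left hW0 hκ1
      have h4 : 2 * (κ * W) ≤ c * (κ * W) := by gcongr
      linarith
    calc r * D.n * W ≤ r * D.n * (c * (κ * W) * (1 / 2)) := by gcongr
      _ = _ := by ring
  have k2 : c * D.n * ((X + κ) * W) ≤ r * (c * D.n * ((X + κ) * W)) :=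
    le_mul_of_one_le_left (by positivity) hr1
  have k3 : 0 ≤ r * D.n * (c * (X * W)) := by positivity
  have k4 : 0 ≤ r * D.n * (c * (κ * W)) := by positivity
  linarith

end RootModPrime

end CrtRoot
end

noncomputable section
namespace CrtRoot

/-! ## Double CRT -/

section DoubleCRT

/-- The average over the product of a function of one component is the average over that component.
This allows the primes, whose draws are independent, to be treated separately. -/
theorem sum_pi_apply_le {ι : Type} [Fintype ι] [DecidableEq ι] {β : ι → Type} [∀ i, Fintype (β i)]
    (i : ι) {g : β i → ℝ} {B : ℝ} (h : ∑ x, g x ≤ Fintype.card (β i) * B) :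
    ∑ τ : (i : ι) → β i, g (τ i) ≤ Fintype.card ((i : ι) → β i) * B := by
  have h1 : ∑ τ : (i : ι) → β i, g (τ i) =
      ∑ p : β i × ((j : {j // j ≠ i}) → β j), g p.1 :=
    Fintype.sum_equiv (Equiv.piSplitAt i β) _ _ fun τ => rfl
  rw [h1, Fintype.card_congr (Equiv.piSplitAt i β), Fintype.sum_prod_type]
  simp only [Finset.sum_const, Finset.card_univ, nsmul_eq_mul, ← Finset.mul_sum,
    Fintype.card_prod, Nat.cast_mul]
  calc _ ≤ (Fintype.card ((j : {j // j ≠ i}) → β j) : ℝ) * (Fintype.card (β i) * B) := by gcongr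
    _ = _ := by ring

variable {K : Type*} [Field K] [NumberField K] (M : MulCost) (D : OrderData K) {r k : ℕ} (e : ℕ)
  (a : Fin r → ℕ) (u : Fin r → Fin D.n → ℤ) (b : Fin r → ℕ) (q : Fin k → ℕ) [∀ j, Fact (q j).Prime]
  {N : ℕ}

/-- The product tree of the chosen primes. -/
def treeOf : PTree := (buildTree M k (List.ofFn q)).val

/-- The coordinates of the `uᵢ` modulo the prime `q j`, as they are read off the product tree. -/
def coordResidues (j : Fin k) : Fin r → Fin D.n → ℤ := fun i l =>
  (remTree M (treeOf M q) (u i l)).val.getD j 0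

/-- The root modulo the prime `q j`. -/
def primeRun (τ : Tape D.n N q) (j : Fin k) : Timed (Option (Fin D.n → ℤ)) :=
  rootModPrime M D e a (q j) (List.ofFn (τ j)) (coordResidues M D u q j)

/-- The time that is spent before the random polynomials are drawn. -/
def setupTime : ℝ :=
  (boundB M D b).time + (buildTree M k (List.ofFn q)).time +
    ∑ i, ∑ l, (remTree M (treeOf M q) (u i l)).time

/-- The integers that are recombined by the last step. -/
def lastStep (xs : Fin k → Option (Fin D.n → ℤ)) (l : Fin D.n) : Timed ℤ :=
  crtZ M (treeOf M q) q (crtPrep M (treeOf M q) q).val (fun j => (xs j).getD 0 l)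

variable {M D e a u b q}

theorem doubleCRT_val (hroot : 2 * (boundB M D b).val < ((treeOf M q).root : ℤ))
    (τ : Tape D.n N q) : (doubleCRT M D e a u b q τ).val =
      if ∀ j, (primeRun M D e a u q τ j).val.isSome then
        some fun l => (lastStep M D q (fun j => (primeRun M D e a u q τ j).val) l).val
      else none := by
  unfold doubleCRT
  simp -implicitDefEqProofs only [Timed.val_bind]
  rw [if_neg (not_le.2 (show 2 * (boundB M D b).val <
    (((buildTree M k (List.ofFn q)).val.root : ℕ) : ℤ) from hroot))]
  simp -implicitDefEqProofs only [Timed.val_bind, forFin_val]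
  split_ifs with h1 h2 h2
  · rfl
  · exact absurd h1 h2
  · exact absurd h2 h1
  · rfl

theorem doubleCRT_time (hroot : 2 * (boundB M D b).val < ((treeOf M q).root : ℤ))
    (τ : Tape D.n N q) : (doubleCRT M D e a u b q τ).time =
      setupTime M D u b q + ∑ j, (primeRun M D e a u q τ j).time +
      if ∀ j, (primeRun M D e a u q τ j).val.isSome then
        (crtPrep M (treeOf M q) q).time +
          ∑ l, (lastStep M D q (fun j => (primeRun M D e a u q τ j).val) l).time
      else 0 := by
  have hp : ∀ j, (rootModPrime M D e a (q j) (List.ofFn (τ j)) fun i l =>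
      (remTree M (buildTree M k (List.ofFn q)).val (u i l)).val.getD (j : ℕ) 0) =
      primeRun M D e a u q τ j := fun _ => rfl
  unfold doubleCRT
  simp -implicitDefEqProofs only [Timed.time_bind]
  rw [if_neg (not_le.2 (show 2 * (boundB M D b).val <
    (((buildTree M k (List.ofFn q)).val.root : ℕ) : ℤ) from hroot))]
  simp -implicitDefEqProofs only [Timed.time_bind, forFin_val, forFin_time, hp]
  split_ifs with h1
  · simp only [setupTime, Timed.time_bind, forFin_val, forFin_time, Timed.time_pure, add_zero]
    simp only [treeOf, lastStep]
    ring
  · simp only [setupTime, Timed.time_pure, add_zero]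
    simp only [treeOf]
    ring

/-- The shape of the tree does not depend on prices, so `buildTree_spec` is applied with the crude
price per digit `c k κ` and depth bound `k`, and its statements on time and depth are dropped. -/
theorem treeOf_spec {c : ℝ} (hM : M.Tame c) (hk : 0 < k) :
    (treeOf M q).leaves = List.ofFn q ∧ (treeOf M q).WF := by
  have hc := hM.two_le
  set κ := Finset.univ.sup fun j => len (q j : ℤ) with hκ
  have h := buildTree_spec (M := M) (Λ := c * (k * κ : ℕ)) (S := k * κ) (κ := κ) (by positivity)
    (fun x hx => ?_) k k (List.ofFn q) (by simp; omega) (by simpa using Nat.lt_two_pow_self.le)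
    (by simpa using Nat.lt_two_pow_self.le) (by
      simp only [List.mem_ofFn]
      rintro p ⟨j, rfl⟩
      exact Finset.le_sup (f := fun j => len (q j : ℤ)) (Finset.mem_univ j)) (by simp)
  · exact ⟨h.1, h.2.1⟩
  · have h1 : (x : ℝ) ≤ (k * κ : ℕ) := by exact_mod_cast hx
    have h2 := hM.Z_le x
    have h3 : c * (x : ℝ) ^ 2 ≤ c * (k * κ : ℕ) * x := by
      rw [pow_two, ← mul_assoc]; gcongr
    linarith

theorem treeOf_root {c : ℝ} (hM : M.Tame c) (hk : 0 < k) :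
    ((treeOf M q).root : ℤ) = ∏ j, (q j : ℤ) := by
  obtain ⟨h1, h2⟩ := treeOf_spec (q := q) hM hk
  rw [h2.root_eq, h1, List.prod_ofFn]
  simp

theorem coordResidues_modEq {c : ℝ} (hM : M.Tame c) (hk : 0 < k) (j : Fin k) (i : Fin r) (l : Fin D.n) :
    coordResidues M D u q j i l ≡ u i l [ZMOD q j] := by
  obtain ⟨h1, h2⟩ := treeOf_spec (q := q) hM hk
  have : coordResidues M D u q j i l = u i l % (q j : ℤ) := by
    rw [coordResidues, remTree_val h2, h1]
    simp [List.getD_eq_getElem?_getD]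
  rw [this]
  exact Int.mod_modEq _ _

theorem setupTime_nonneg : 0 ≤ setupTime M D u b q := by
  have h1 : 0 ≤ (boundB M D b).time :=
    Timed.bind_nonneg (foldT_time_nonneg (fun _ _ => M.Z_nonneg _) _ _) fun _ =>
      Timed.bind_nonneg (M.Z_nonneg _) fun _ => M.Z_nonneg _
  have h2 : ∀ (h : ℕ) (l : List ℕ), 0 ≤ (buildTree M h l).time := by
    intro h
    induction h with
    | zero => intro l; exact le_rfl
    | succ h ih =>
      intro l
      rw [buildTree]
      split_ifs
      · exact le_rfl
      · exact Timed.bind_nonneg (ih _) fun _ => Timed.bind_nonneg (ih _) fun _ =>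
          Timed.bind_nonneg (M.Z_nonneg _) fun _ => le_rfl
  have h3 : 0 ≤ ∑ i, ∑ l, (remTree M (treeOf M q) (u i l)).time :=
    Finset.sum_nonneg fun _ _ => Finset.sum_nonneg fun _ _ => remTree_time_nonneg _ _
  have := h2 k (List.ofFn q)
  unfold setupTime
  linarith

theorem primeRun_nonneg (τ : Tape D.n N q) (j : Fin k) :
    0 ≤ (primeRun M D e a u q τ j).time := rootModPrime_nonneg _ _ _ _

theorem lastStep_nonneg (xs : Fin k → Option (Fin D.n → ℤ)) (l : Fin D.n) :
    0 ≤ (lastStep M D q xs l).time := crtZ_time_nonneg _ _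

theorem doubleCRT_nonneg (hroot : 2 * (boundB M D b).val < ((treeOf M q).root : ℤ))
    (τ : Tape D.n N q) : 0 ≤ (doubleCRT M D e a u b q τ).time := by
  rw [doubleCRT_time hroot]
  refine add_nonneg (add_nonneg setupTime_nonneg (Finset.sum_nonneg fun j _ => primeRun_nonneg _ _))
    ?_
  split_ifs
  · exact add_nonneg crtPrep_time_nonneg (Finset.sum_nonneg fun _ _ => lastStep_nonneg _ _)
  · exact le_rfl

/-- A run without result has used up the supply for one of the primes. -/
theorem le_doubleCRT_time_of_none (hroot : 2 * (boundB M D b).val < ((treeOf M q).root : ℤ))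
    {τ : Tape D.n N q} (h : ¬ (doubleCRT M D e a u b q τ).val.isSome) :
    (N : ℝ) ≤ (doubleCRT M D e a u b q τ).time := by
  rw [doubleCRT_val hroot] at h
  have h1 : ¬ ∀ j, (primeRun M D e a u q τ j).val.isSome := by
    intro h1
    rw [if_pos h1] at h
    exact h rfl
  rw [doubleCRT_time hroot, if_neg h1, add_zero]
  push Not at h1
  obtain ⟨j, hj⟩ := h1
  have h2 := length_le_rootModPrime_time (Option.not_isSome_iff_eq_none.1 hj)
  rw [List.length_ofFn] at h2
  have h3 := Finset.single_le_sum (f := fun j => (primeRun M D e a u q τ j).time)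
    (fun j _ => primeRun_nonneg τ j) (Finset.mem_univ j)
  have h4 := setupTime_nonneg (M := M) (D := D) (u := u) (b := b) (q := q)
  exact h2.trans (h3.trans (le_add_of_nonneg_left h4))

/-- Markov's inequality: a run without result has cost at least `N`, whereas the mean cost is at
most `A` for every `N`. So the probability of failure is at most `A / N`. -/
theorem tendsto_successProb (hroot : 2 * (boundB M D b).val < ((treeOf M q).root : ℤ)) {A : ℝ}
    (hA : ∀ N, expTime M D e a u b q N ≤ A) :
    Filter.Tendsto (fun N => successProb M D e a u b q N) Filter.atTop (nhds 1) := by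
  have hlow : ∀ N : ℕ, 0 < N → 1 - A / N ≤ successProb M D e a u b q N := by
    intro N hN
    have : ∀ j, Nonempty (Fin (q j)) := fun j => ⟨⟨0, (Fact.out : (q j).Prime).pos⟩⟩
    have hcard : (0 : ℝ) < Fintype.card (Tape D.n N q) := by exact_mod_cast Fintype.card_pos
    have hN' : (0 : ℝ) < N := by exact_mod_cast hN
    classical
    have h1 := hA N
    rw [expTime, div_le_iff₀ hcard] at h1
    have h2 : ((Finset.univ.filter fun τ : Tape D.n N q =>
        ¬ (doubleCRT M D e a u b q τ).val.isSome).card : ℝ) * N ≤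
        ∑ τ : Tape D.n N q, (doubleCRT M D e a u b q τ).time := by
      rw [← nsmul_eq_mul, ← Finset.sum_const]
      refine (Finset.sum_le_sum fun τ hτ =>
        le_doubleCRT_time_of_none hroot (Finset.mem_filter.1 hτ).2).trans ?_
      exact Finset.sum_le_sum_of_subset_of_nonneg (Finset.filter_subset _ _)
        fun τ _ _ => doubleCRT_nonneg hroot τ
    have h3 := Finset.card_filter_add_card_filter_not (s := (Finset.univ : Finset (Tape D.n N q)))
      (fun τ => (doubleCRT M D e a u b q τ).val.isSome = true)
    rw [successProb, Nat.card_eq_fintype_card, Fintype.card_subtype, le_div_iff₀ hcard]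
    have h4 : ((Finset.univ.filter fun τ : Tape D.n N q =>
        (doubleCRT M D e a u b q τ).val.isSome).card : ℝ) + ((Finset.univ.filter
        fun τ : Tape D.n N q => ¬ (doubleCRT M D e a u b q τ).val.isSome).card : ℝ) =
        Fintype.card (Tape D.n N q) := by
      exact_mod_cast h3
    have h5 : ((Finset.univ.filter fun τ : Tape D.n N q =>
        ¬ (doubleCRT M D e a u b q τ).val.isSome).card : ℝ) ≤
        A / N * Fintype.card (Tape D.n N q) := by
      rw [div_mul_eq_mul_div, le_div_iff₀ hN']
      linarith
    linarith
  have hup : ∀ N : ℕ, successProb M D e a u b q N ≤ 1 := by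
    intro N
    refine div_le_one_of_le₀ ?_ (Nat.cast_nonneg _)
    rw [← Nat.card_eq_fintype_card]
    exact_mod_cast Finite.card_subtype_le _
  have hlim : Filter.Tendsto (fun N : ℕ => 1 - A / (N : ℝ)) Filter.atTop (nhds 1) := by
    simpa using (tendsto_const_div_atTop_nhds_zero_nat A).const_sub 1
  refine tendsto_of_tendsto_of_tendsto_of_le_of_le' hlim tendsto_const_nhds ?_
    (Filter.Eventually.of_forall hup)
  filter_upwards [Filter.eventually_gt_atTop 0] with N hN using hlow N hN

/-- The coordinates `w` of `f₀ x` are bounded by `B`, and the computed residues agree with them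
modulo each prime. As the product of the primes exceeds `2B`, the recombination returns exactly `w`.
-/
theorem doubleCRT_correct {c : ℝ} (hM : M.Tame c) (hk : 0 < k) {ℓ m : ℕ} (hℓ : ℓ.Prime)
    (hu : ∀ i, u i ≠ 0) (ha : ∀ i, a i < ℓ ^ m) (hb : ∀ i, house (D.elt (u i)) ≤ b i)
    {x : K} (hx : x ^ (ℓ ^ m) = ∏ i, D.elt (u i) ^ a i) (hinj : Function.Injective q)
    (hg : ∀ j, GoodPrime D ℓ (q j)) (hQ : 2 * (boundB M D b).val < ∏ j, (q j : ℤ))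
    {τ : Tape D.n N q} {z : Fin D.n → ℤ}
    (hz : (doubleCRT M D (ℓ ^ m) a u b q τ).val = some z) : D.out z = x := by
  rw [doubleCRT_val (by rw [treeOf_root hM hk]; exact hQ)] at hz
  split_ifs at hz with hall
  obtain ⟨w, hw⟩ := D.exists_elt_eq
    (D.f₀_mul_mem x (D.isIntegral_root (pow_pos hℓ.pos m) hx))
  obtain ⟨ht1, ht2⟩ := treeOf_spec (q := q) hM hk
  have hzw : z = w := by
    rw [← Option.some.inj hz]
    funext l
    refine crtZ_val ht2 ht1 (fun j => Fact.out) hinj (fun j => ?_) ?_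
    · obtain ⟨v, hv⟩ := Option.isSome_iff_exists.1 (hall j)
      simp only [hv, Option.getD_some]
      exact rootModPrime_val_modEq hM (hg j) hℓ hx hw (coordResidues_modEq hM hk j) hv l
    · have := D.abs_coord_root_le M (pow_pos hℓ.pos m) hu ha hb hx hw l
      linarith
  rw [OrderData.out, hzw, hw, mul_div_cancel_left₀]
  exact Nat.cast_ne_zero.2 D.f₀_pos.ne'

/-- With `B ≤ 0` all coordinates of `f₀ x` would vanish although `x ≠ 0`. Positivity forces at least
one prime to be chosen, and makes every divisor of `B` that occurs in its computation at most as
long as `B`. -/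
theorem boundB_pos {e : ℕ} (he : 0 < e) (hu : ∀ i, u i ≠ 0) (ha : ∀ i, a i < e)
    (hb : ∀ i, house (D.elt (u i)) ≤ b i) {x : K} (hx : x ^ e = ∏ i, D.elt (u i) ^ a i) :
    0 < (boundB M D b).val := by
  by_contra hB
  obtain ⟨w, hw⟩ := D.exists_elt_eq (D.f₀_mul_mem x (D.isIntegral_root he hx))
  have h0 : ∀ i, D.elt (u i) ≠ 0 := fun i h => by
    have := D.one_le_house (hu i)
    rw [h, house, map_zero, norm_zero] at this
    linarith
  have hx0 : x ≠ 0 := by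
    rintro rfl
    rw [zero_pow he.ne'] at hx
    exact (Finset.prod_ne_zero_iff.2 fun i _ => pow_ne_zero _ (h0 i)) hx.symm
  have hw0 : w = 0 := by
    funext l
    have := D.abs_coord_root_le M he hu ha hb hx hw l
    have h1 : |w l| < 1 := by omega
    exact Int.abs_lt_one_iff.1 h1
  rw [hw0] at hw
  have : D.elt 0 = 0 := by simp [OrderData.elt_eq_sum]
  rw [this] at hw
  exact mul_ne_zero (Nat.cast_ne_zero.2 D.f₀_pos.ne') hx0 hw.symm

end DoubleCRT

end CrtRoot
end

noncomputable section
namespace CrtRoot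

/-! ## The expected running time -/

theorem len_natCast_mono {a b : ℕ} (h : a ≤ b) : len (a : ℤ) ≤ len (b : ℤ) :=
  len_mono (by simpa only [Int.natAbs_natCast] using h)

theorem foldT_zmul_time_le (M : MulCost) (l : List ℕ) (hl : ∀ a ∈ l, 0 < a) :
    (foldT (zmul M) 1 (l.map fun a : ℕ => (a : ℤ))).val = (l.prod : ℤ) ∧
    (foldT (zmul M) 1 (l.map fun a : ℕ => (a : ℤ))).time ≤ l.length * M.Z (len (l.prod : ℤ)) := by
  induction l with
  | nil => simp [foldT]
  | cons a l ih =>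
    obtain ⟨h1, h2⟩ := ih fun a ha => hl a (List.mem_cons_of_mem _ ha)
    have ha : 0 < a := hl a List.mem_cons_self
    have hp : 0 < l.prod := List.prod_pos fun a ha => hl a (List.mem_cons_of_mem _ ha)
    simp only [List.map_cons, foldT, Timed.val_bind, Timed.time_bind, h1, zmul, tick_val, tick_time]
    refine ⟨by simp, ?_⟩
    have h3 : len (l.prod : ℤ) ≤ len (((a :: l).prod : ℕ) : ℤ) :=
      len_natCast_mono (by rw [List.prod_cons]; exact Nat.le_mul_of_pos_left _ ha)
    have h4 : len (a : ℤ) ≤ len (((a :: l).prod : ℕ) : ℤ) :=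
      len_natCast_mono (by rw [List.prod_cons]; exact Nat.le_mul_of_pos_right _ hp)
    have h5 := M.Z_mono h3
    have h6 := M.Z_mono (max_le h4 h3)
    have h7 := mul_le_mul_of_nonneg_left h5 (Nat.cast_nonneg (α := ℝ) l.length)
    rw [List.length_cons]
    push_cast
    push_cast at h6 h7 h2
    linarith

section

variable {K : Type*} [Field K] [NumberField K] {M : MulCost} {D : OrderData K} {r k : ℕ}
  {a : Fin r → ℕ} {u : Fin r → Fin D.n → ℤ} {b : Fin r → ℕ} {q : Fin k → ℕ} [∀ j, Fact (q j).Prime]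
  {N κ : ℕ} {c Λ : ℝ}

theorem boundB_val_eq_natCast : (boundB M D b).val = ((D.f₀ * (D.Cinf * ∏ i, b i) : ℕ) : ℤ) := by
  rw [D.boundB_val]; push_cast; rfl

/-- Every factor and every partial product divides the positive number `B`, so each of the `r + 2`
products stays within the length of `B`. -/
theorem boundB_time_le (hB : 0 < (boundB M D b).val) {S : ℕ} (hS : len (boundB M D b).val ≤ S) :
    (boundB M D b).time ≤ (r + 2) * M.Z S := by
  rw [boundB_val_eq_natCast] at hB hS
  have hB' : 0 < D.f₀ * (D.Cinf * ∏ i, b i) := by exact_mod_cast hB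
  have hdvd : ∀ d : ℕ, d ∣ D.f₀ * (D.Cinf * ∏ i, b i) → len (d : ℤ) ≤ S := fun d hd =>
    (len_natCast_mono (Nat.le_of_dvd hB' hd)).trans hS
  have hprod : 0 < ∏ i, b i := Nat.pos_of_ne_zero fun h => by simp [h] at hB'
  have hbi : ∀ i, 0 < b i := fun i =>
    Nat.pos_of_ne_zero fun h => hprod.ne' (Finset.prod_eq_zero (Finset.mem_univ i) h)
  obtain ⟨h1, h2⟩ := foldT_zmul_time_le M (List.ofFn b) (by
    simp only [List.mem_ofFn]
    rintro _ ⟨i, rfl⟩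
    exact hbi i)
  have hmap : ((List.ofFn b).map fun a : ℕ => (a : ℤ)) = List.ofFn fun i => (b i : ℤ) := by
    rw [List.map_ofFn]; rfl
  rw [hmap, List.prod_ofFn] at h1 h2
  rw [List.length_ofFn] at h2
  have d1 := hdvd (∏ i, b i) ((Dvd.intro_left _ rfl).trans (Dvd.intro_left _ rfl))
  have d2 := hdvd D.Cinf ((Dvd.intro _ rfl).trans (Dvd.intro_left _ rfl))
  have d3 := hdvd (D.Cinf * ∏ i, b i) (Dvd.intro_left _ rfl)
  have d4 := hdvd D.f₀ (Dvd.intro _ rfl)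
  simp only [boundB, Timed.time_bind, zmul, tick_time, tick_val]
  rw [h1]
  have e1 := M.Z_mono d1
  have e2 := M.Z_mono (max_le d2 d1)
  have e3 : M.Z (max (len (D.f₀ : ℤ)) (len ((D.Cinf : ℤ) * ((∏ i, b i : ℕ) : ℤ)))) ≤ M.Z S :=
    M.Z_mono (max_le d4 (by exact_mod_cast d3))
  have e4 := mul_le_mul_of_nonneg_left e1 (Nat.cast_nonneg (α := ℝ) r)
  linarith

theorem len_le_of_abs_le_prod (hM : M.Tame c) (hk : 0 < k) (hκ : ∀ j, len (q j : ℤ) ≤ κ) {z : ℤ}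
    (hz : |z| ≤ ∏ j, (q j : ℤ)) : len z ≤ k * κ := by
  obtain ⟨h1, h2⟩ := treeOf_spec (q := q) hM hk
  have h3 := h2.len_root_le (κ := κ) (by
    rw [h1]
    simp only [List.mem_ofFn]
    rintro _ ⟨i, rfl⟩
    exact hκ i)
  rw [h1, List.length_ofFn, treeOf_root hM hk] at h3
  refine (len_mono ?_).trans h3
  zify
  exact hz.trans (le_abs_self _)

theorem treeOf_time_le (hk : 0 < k) (hκ : ∀ j, len (q j : ℤ) ≤ κ) (hΛ : 1 ≤ Λ)
    (hZ : ∀ x ≤ 2 * (k * κ), M.Z x ≤ Λ * x) : (treeOf M q).depth ≤ lg k ∧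
      (buildTree M k (List.ofFn q)).time ≤ lg k * (Λ * (k * κ : ℕ)) := by
  have h := buildTree_spec (M := M) (Λ := Λ) (S := 2 * (k * κ)) (κ := κ) (by linarith)
    hZ k (lg k) (List.ofFn q) (by simp; omega) (by simpa using Nat.lt_two_pow_self.le)
    (by
      rw [List.length_ofFn]; exact (Nat.lt_pow_succ_log_self one_lt_two k).le) (by
      simp only [List.mem_ofFn]
      rintro p ⟨j, rfl⟩
      exact hκ j) (by simp; omega)
  rw [List.length_ofFn] at h
  exact ⟨h.2.2.1, h.2.2.2⟩

theorem setupTime_le (hM : M.Tame c) (hk : 0 < k) (hκ : ∀ j, len (q j : ℤ) ≤ κ) (hΛ : 1 ≤ Λ)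
    (hZ : ∀ x ≤ 2 * (k * κ), M.Z x ≤ Λ * x) (hb : ∀ i, house (D.elt (u i)) ≤ b i)
    (hB : 0 < (boundB M D b).val) (hQ : 2 * (boundB M D b).val < ∏ j, (q j : ℤ)) :
    setupTime M D u b q ≤
      Λ * (k * κ : ℕ) * ((r + 2) + lg k + r * D.n * (3 * lg k + 2)) := by
  have hΛ0 : 0 ≤ Λ := by linarith
  obtain ⟨t1, t2⟩ := treeOf_spec (q := q) hM hk
  obtain ⟨t3, t4⟩ := treeOf_time_le hk hκ hΛ hZ
  have h1 := boundB_time_le hB (S := k * κ)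
    (len_le_of_abs_le_prod hM hk hκ (by rw [abs_of_pos hB]; linarith))
  have h2 : (r + 2) * M.Z (k * κ) ≤ (r + 2) * (Λ * (k * κ : ℕ)) :=
    mul_le_mul_of_nonneg_left (hZ _ (by omega)) (by positivity)
  have hB' : 0 < D.f₀ * (D.Cinf * ∏ i, b i) := by
    rw [boundB_val_eq_natCast] at hB
    exact_mod_cast hB
  -- The input coordinates are at most `Cinf * b i`, which divides `B`; hence they are shorter than
  -- the product of the primes, and the first division of the remainder tree costs no more than a
  -- level below it.
  have hlen : ∀ i l, len (u i l) ≤ k * κ := by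
    intro i l
    refine len_le_of_abs_le_prod hM hk hκ ?_
    have h3 := D.abs_coord_le (fun φ => (norm_embedding_le_house _ φ).trans (hb i)) l
    have h4 : |u i l| ≤ ((D.Cinf * b i : ℕ) : ℤ) := by
      have : ((|u i l| : ℤ) : ℝ) ≤ (((D.Cinf * b i : ℕ) : ℤ) : ℝ) := by push_cast; exact h3
      exact_mod_cast this
    have h5 : D.Cinf * b i ≤ D.f₀ * (D.Cinf * ∏ i, b i) := Nat.le_of_dvd hB'
      ((mul_dvd_mul_left _ (Finset.dvd_prod_of_mem b (Finset.mem_univ i))).trans (Dvd.intro_left _ rfl))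
    have h6 : ((D.Cinf * b i : ℕ) : ℤ) ≤ (boundB M D b).val := by
      rw [boundB_val_eq_natCast]; exact_mod_cast h5
    linarith
  have hrem : ∀ i l, (remTree M (treeOf M q) (u i l)).time ≤
      Λ * (k * κ : ℕ) * (3 * lg k + 2) := by
    intro i l
    have hlv : (treeOf M q).leaves.length = k := by rw [t1, List.length_ofFn]
    have h3 := remTree_time_le (κ := κ) hΛ0 hZ t2 (by
      rw [t1]
      simp only [List.mem_ofFn]
      rintro _ ⟨j, rfl⟩
      exact ⟨(Fact.out : (q j).Prime).pos, hκ j⟩) (by rw [hlv]; omega) (u i l)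
    rw [hlv] at h3
    have h4 : ((len (u i l) : ℕ) : ℝ) ≤ (k * κ : ℕ) := by exact_mod_cast hlen i l
    have h5 : ((treeOf M q).depth : ℝ) ≤ lg k := by exact_mod_cast t3
    refine h3.trans ?_
    rw [mul_assoc]
    refine mul_le_mul_of_nonneg_left ?_ hΛ0
    have h6 := mul_le_mul_of_nonneg_right h5 (Nat.cast_nonneg (α := ℝ) (k * κ))
    linarith
  have hsum : ∑ i, ∑ l, (remTree M (treeOf M q) (u i l)).time ≤
      r * (D.n * (Λ * (k * κ : ℕ) * (3 * lg k + 2))) := by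
    refine (Finset.sum_le_card_nsmul _ _ _ fun i _ => Finset.sum_le_card_nsmul _ _ _ fun l _ =>
      hrem i l).trans (le_of_eq ?_)
    simp only [Finset.card_univ, Fintype.card_fin, nsmul_eq_mul]
  unfold setupTime
  linarith

theorem lastStep_time_le (hM : M.Tame c) (hk : 0 < k) (hκ : ∀ j, len (q j : ℤ) ≤ κ) (hΛ : 1 ≤ Λ)
    (hZ : ∀ x ≤ 2 * (k * κ), M.Z x ≤ Λ * x) {e : ℕ} {τ : Tape D.n N q}
    (hall : ∀ j, (primeRun M D e a u q τ j).val.isSome) :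
    (crtPrep M (treeOf M q) q).time +
        ∑ l, (lastStep M D q (fun j => (primeRun M D e a u q τ j).val) l).time ≤
      Λ * (k * κ : ℕ) * ((9 * lg k + 3 + lg κ) + D.n * (6 * lg k + 7)) := by
  obtain ⟨t1, t2⟩ := treeOf_spec (q := q) hM hk
  obtain ⟨t3, t4⟩ := treeOf_time_le hk hκ hΛ hZ
  have hκ' : ∀ j, 0 < q j ∧ len (q j : ℤ) ≤ κ := fun j => ⟨(Fact.out : (q j).Prime).pos, hκ j⟩
  have h5 : ((treeOf M q).depth : ℝ) ≤ lg k := by exact_mod_cast t3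
  have hV : 0 ≤ Λ * (k * κ : ℕ) := mul_nonneg (by linarith) (Nat.cast_nonneg _)
  have h1 := crtPrep_time_le hΛ hZ t2 t1 hκ' le_rfl
  have h2 : ∀ l, (lastStep M D q (fun j => (primeRun M D e a u q τ j).val) l).time ≤
      Λ * (k * κ : ℕ) * (6 * lg k + 7) := by
    intro l
    have h3 := crtZ_time_le hΛ hZ t2 t1 hκ' le_rfl
      (m := (crtPrep M (treeOf M q) q).val)
      (v := fun j => ((primeRun M D e a u q τ j).val).getD 0 l)
      (fun j => (crtPrep_len_le t2 t1 (fun j => (hκ' j).1) j).trans (hκ j)) fun j => by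
        obtain ⟨v, hv⟩ := Option.isSome_iff_exists.1 (hall j)
        simp only [hv, Option.getD_some]
        exact (rootModPrime_val_range hv l).trans (hκ j)
    refine h3.trans ?_
    have := mul_le_mul_of_nonneg_left h5 hV
    linarith
  have hsum : ∑ l, (lastStep M D q (fun j => (primeRun M D e a u q τ j).val) l).time ≤
      D.n * (Λ * (k * κ : ℕ) * (6 * lg k + 7)) := by
    refine (Finset.sum_le_card_nsmul _ _ _ fun l _ => h2 l).trans (le_of_eq ?_)
    simp only [Finset.card_univ, Fintype.card_fin, nsmul_eq_mul]
  have := mul_le_mul_of_nonneg_left h5 hV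
  linarith

/-- Set-up and final recombination are bounded for every outcome of the draws; the work modulo the
primes is averaged prime by prime. -/
theorem expTime_le {ℓ m : ℕ} (hM : M.Tame c) (hk : 0 < k) (hr : 0 < r)
    (hκ : ∀ j, len (q j : ℤ) ≤ κ) (hΛ : 1 ≤ Λ)
    (hZ : ∀ x ≤ 2 * (k * κ), M.Z x ≤ Λ * x) (hℓ : ℓ.Prime) (hg : ∀ j, GoodPrime D ℓ (q j))
    (hb : ∀ i, house (D.elt (u i)) ≤ b i) (hB : 0 < (boundB M D b).val)
    (hQ : 2 * (boundB M D b).val < ∏ j, (q j : ℤ)) {X E : ℕ} (hX : DataLen D X)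
    (hE : ∀ i, len (a i : ℤ) ≤ E) (heE : len ((ℓ ^ m : ℕ) : ℤ) ≤ E) (N : ℕ) :
    expTime M D (ℓ ^ m) a u b q N ≤
      r * D.n * (c * (172 * (k * (κ + X)) * M.P D.n κ + 3 * (k * κ) * E)) +
      r * D.n * (35 * (Λ * (k * κ : ℕ) * lg (k * κ))) := by
  have : ∀ j, Nonempty (Fin (q j)) := fun j => ⟨⟨0, (Fact.out : (q j).Prime).pos⟩⟩
  have hcard : (0 : ℝ) < Fintype.card (Tape D.n N q) := by exact_mod_cast Fintype.card_pos
  have hroot : 2 * (boundB M D b).val < ((treeOf M q).root : ℤ) := by rwa [treeOf_root hM hk]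
  have h1 := setupTime_le hM hk hκ hΛ hZ hb hB hQ
  set V := Λ * ((k * κ : ℕ) : ℝ) with hVdef
  have hV : 0 ≤ V := mul_nonneg (by linarith) (Nat.cast_nonneg _)
  set A := V * ((r + 2) + lg k + r * D.n * (3 * lg k + 2)) with hA
  set A' := V * ((9 * lg k + 3 + lg κ) + D.n * (6 * lg k + 7)) with hA'
  have hA'0 : 0 ≤ A' := by positivity
  have h2 : ∀ τ : Tape D.n N q, (doubleCRT M D (ℓ ^ m) a u b q τ).time ≤
      (A + A') + ∑ j, (primeRun M D (ℓ ^ m) a u q τ j).time := by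
    intro τ
    rw [doubleCRT_time hroot]
    split_ifs with hall
    · have := lastStep_time_le hM hk hκ hΛ hZ hall
      linarith
    · linarith
  rw [expTime, div_le_iff₀ hcard]
  have h3 : ∀ j, ∑ τ : Tape D.n N q, (primeRun M D (ℓ ^ m) a u q τ j).time ≤
      (Fintype.card (Tape D.n N q) : ℝ) *
        (r * D.n * (c * (172 * (κ + X) * M.P D.n κ + 3 * κ * E))) := fun j =>
    sum_pi_apply_le (β := fun j => Fin N → Fin D.n → Fin (q j)) j
      (sum_rootModPrime_time_le hM (hg j) hℓ hr (hκ j) hX hE heE N)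
  have h4 : ∑ τ : Tape D.n N q, (doubleCRT M D (ℓ ^ m) a u b q τ).time ≤
      (Fintype.card (Tape D.n N q) : ℝ) * (A + A') + k * ((Fintype.card (Tape D.n N q) : ℝ) *
        (r * D.n * (c * (172 * (κ + X) * M.P D.n κ + 3 * κ * E)))) := by
    refine (Finset.sum_le_sum fun τ _ => h2 τ).trans ?_
    rw [Finset.sum_add_distrib, Finset.sum_comm]
    refine add_le_add (by rw [Finset.sum_const, Finset.card_univ, nsmul_eq_mul]) ?_
    refine (Finset.sum_le_card_nsmul _ _ _ fun j _ => h3 j).trans (le_of_eq ?_)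
    rw [Finset.card_univ, Fintype.card_fin, nsmul_eq_mul]
  have hn1 : (1 : ℝ) ≤ D.n := by exact_mod_cast D.one_le_n
  have hr1 : (1 : ℝ) ≤ r := by exact_mod_cast hr
  have hκ1 : 1 ≤ κ := (one_le_len _).trans (hκ ⟨0, hk⟩)
  have l1 : (lg k : ℝ) ≤ lg (k * κ) := by
    exact_mod_cast lg_mono (Nat.le_mul_of_pos_right _ hκ1)
  have l2 : (lg κ : ℝ) ≤ lg (k * κ) := by
    exact_mod_cast lg_mono (Nat.le_mul_of_pos_left _ hk)
  have l3 : (1 : ℝ) ≤ lg (k * κ) := by exact_mod_cast one_le_lg _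
  set L : ℝ := (lg (k * κ) : ℝ) with hL
  have hAA : A + A' ≤ r * D.n * (35 * (V * L)) := by
    have e0 : (1 : ℝ) ≤ r * D.n := by nlinarith
    have e1 : (r : ℝ) ≤ r * D.n := le_mul_of_one_le_right (by positivity) hn1
    have e2 : (D.n : ℝ) ≤ r * D.n := le_mul_of_one_le_left (by positivity) hr1
    set ρ : ℝ := r * D.n
    -- In units of `ρ * L` the groups of summands contribute `4`, `5`, `13` and `13`, altogether
    -- `35`.
    have e3 : (r + 2 : ℝ) + lg k + ρ * (3 * lg k + 2) + ((9 * lg k + 3 + lg κ) +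
        D.n * (6 * lg k + 7)) ≤ ρ * (35 * L) := by
      have f0 : 0 ≤ L := by linarith
      have f1 : (r : ℝ) ≤ ρ * L := by nlinarith
      have f2 : L ≤ ρ * L := le_mul_of_one_le_left f0 e0
      have f3 : ρ * (3 * lg k + 2) ≤ ρ * (5 * L) := by
        refine mul_le_mul_of_nonneg_left (by linarith) (by linarith)
      have f4 : D.n * (6 * (lg k : ℝ) + 7) ≤ ρ * (13 * L) := by
        refine mul_le_mul e2 (by linarith) (by positivity) (by linarith)
      linarith
    calc A + A' = V * ((r + 2 : ℝ) + lg k + ρ * (3 * lg k + 2) + ((9 * lg k + 3 + lg κ) +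
        D.n * (6 * lg k + 7))) := by rw [hA, hA']; ring
      _ ≤ V * (ρ * (35 * L)) := mul_le_mul_of_nonneg_left e3 hV
      _ = _ := by ring
  have h5 := mul_le_mul_of_nonneg_left hAA hcard.le
  linarith

end

end CrtRoot
end

noncomputable section
namespace CrtRoot

/-! ## Logarithms and the choice of the constants -/

theorem lg_le_one_add {x : ℕ} : (lg x : ℝ) ≤ 1 + Real.log x / Real.log 2 := by
  have h := Real.natLog_le_logb x 2
  rw [Real.logb] at h
  rw [lg]
  push_cast at h ⊢
  linarith

/-- This is `log x ≤ x ^ δ / δ` with `δ = 1 / (2 + ε)`. It converts the quasi-linear price of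
integer products, multiplied by one more logarithm, into the quadratic bound of `Tame`. -/
theorem exists_lg_rpow_le {ε : ℝ} (hε : 0 < ε) :
    ∃ A : ℝ, 1 ≤ A ∧ ∀ x : ℕ, 0 < x → (lg x : ℝ) ^ (2 + ε) ≤ A * x := by
  have h2 : 0 < Real.log 2 := Real.log_pos one_lt_two
  have hδ : 0 < 1 / (2 + ε) := by positivity
  have hB : 1 ≤ 1 + 1 / (1 / (2 + ε) * Real.log 2) := by
    have : 0 ≤ 1 / (1 / (2 + ε) * Real.log 2) := by positivity
    linarith
  refine ⟨(1 + 1 / (1 / (2 + ε) * Real.log 2)) ^ (2 + ε), Real.one_le_rpow hB (by linarith),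
    fun x hx => ?_⟩
  have hx1 : (1 : ℝ) ≤ x := by exact_mod_cast hx
  have h3 : (lg x : ℝ) ≤ (1 + 1 / (1 / (2 + ε) * Real.log 2)) * (x : ℝ) ^ (1 / (2 + ε)) := by
    have h4 := Real.log_le_rpow_div (x := (x : ℝ)) (by linarith) hδ
    have h5 : (1 : ℝ) ≤ (x : ℝ) ^ (1 / (2 + ε)) := Real.one_le_rpow hx1 hδ.le
    have h6 := div_le_div_of_nonneg_right h4 h2.le
    have h7 : (x : ℝ) ^ (1 / (2 + ε)) / (1 / (2 + ε)) / Real.log 2 =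
        1 / (1 / (2 + ε) * Real.log 2) * (x : ℝ) ^ (1 / (2 + ε)) := by
      rw [div_div]; ring
    have h8 := lg_le_one_add (x := x)
    linarith
  calc (lg x : ℝ) ^ (2 + ε)
      ≤ ((1 + 1 / (1 / (2 + ε) * Real.log 2)) * (x : ℝ) ^ (1 / (2 + ε))) ^ (2 + ε) :=
        Real.rpow_le_rpow (Nat.cast_nonneg _) h3 (by linarith)
    _ = _ := by
        rw [Real.mul_rpow (by linarith) (by positivity), ← Real.rpow_mul (by linarith),
          one_div_mul_cancel (by linarith), Real.rpow_one]

/-- Superadditivity and the doubling property give `2 P(1,1) ≤ P(2,1) ≤ c P(1,1)`, and `P(1,1) ≥ 1`.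
-/
theorem MulCost.Fast.two_le {M : MulCost} {c ε : ℝ} (h : M.Fast c ε) : 2 ≤ c := by
  have h1 := h.2 1 1
  have h2 := M.P_add 1 1 1
  have h3 := M.le_P 1 1
  norm_num at h1 h2 h3
  by_contra hc
  nlinarith

theorem MulCost.Fast.tame {M : MulCost} {c ε A : ℝ} (h : M.Fast c ε) (hA : 1 ≤ A)
    (hlg : ∀ x : ℕ, 0 < x → (lg x : ℝ) ^ (2 + ε) ≤ A * x) : M.Tame (c * A) := by
  have hc := h.two_le
  have hcA : c ≤ c * A := le_mul_of_one_le_right (by linarith) hA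
  refine ⟨hc.trans hcA, fun s => ?_, fun d s =>
    (h.2 d s).trans (mul_le_mul_of_nonneg_right hcA (M.P_nonneg d s))⟩
  rcases Nat.eq_zero_or_pos s with rfl | hs
  · have := h.1 0
    have h0 := M.Z_nonneg 0
    simp only [Nat.cast_zero, mul_zero, zero_mul] at this
    have h00 : M.Z 0 = 0 := le_antisymm this h0
    simp [h00]
  · have hl : (0 : ℝ) < lg s := by exact_mod_cast one_le_lg s
    calc M.Z s * lg s ≤ c * s * (lg s : ℝ) ^ (1 + ε) * lg s :=
          mul_le_mul_of_nonneg_right (h.1 s) hl.le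
      _ = c * s * (lg s : ℝ) ^ (2 + ε) := by
          rw [mul_assoc, ← Real.rpow_add_one hl.ne']
          ring_nf
      _ ≤ c * s * (A * s) := by
          have := hlg s hs
          gcongr
      _ = c * A * (s : ℝ) ^ 2 := by ring

/-- The length is at most `1 + log₂ e ≤ 2 log₂ e`, and `2 / log 2 < 3`. -/
theorem len_le_three_mul_log {e : ℕ} (he : 2 ≤ e) : (len (e : ℤ) : ℝ) ≤ 3 * Real.log e := by
  have h1 := two_pow_len_le (z := (e : ℤ)) (by omega)
  rw [Int.natAbs_natCast] at h1
  have h2 : Real.log ((2 : ℝ) ^ (len (e : ℤ) - 1)) ≤ Real.log e :=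
    Real.log_le_log (by positivity) (by exact_mod_cast h1)
  rw [Real.log_pow, Nat.cast_sub (one_le_len _), Nat.cast_one] at h2
  have h3 : Real.log 2 ≤ Real.log e := Real.log_le_log two_pos (by exact_mod_cast he)
  have h4 := Real.log_two_gt_d9
  nlinarith

/-- If the field data are longer than the primes, then there are at most `2 ^ X` primes, as they are
distinct and below `2 ^ X`. So the overhead `k X` exceeds `k κ` by at most a constant that depends
only on the field. -/
theorem mul_le_of_injective {k κ X : ℕ} {q : Fin k → ℕ} (hinj : Function.Injective q)
    (hκ : ∀ j, len (q j : ℤ) ≤ κ) : k * X ≤ k * κ + X * 2 ^ X := by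
  rcases le_total X κ with h | h
  · exact (Nat.mul_le_mul_left k h).trans (Nat.le_add_right _ _)
  · have hlt : ∀ j, q j < 2 ^ κ := fun j => by
      have := natAbs_lt_two_pow_len (q j : ℤ)
      rw [Int.natAbs_natCast] at this
      exact this.trans_le (Nat.pow_le_pow_right two_pos (hκ j))
    have hcard : k ≤ 2 ^ κ := by
      have := Fintype.card_le_of_injective (fun j => (⟨q j, hlt j⟩ : Fin (2 ^ κ)))
        fun i j hij => hinj (Fin.mk.inj hij)
      simpa using this
    have := Nat.mul_le_mul_right X (hcard.trans (Nat.pow_le_pow_right two_pos h))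
    rw [mul_comm X]
    omega

theorem size_nonneg {K : Type*} [Field K] [NumberField K] {D : OrderData K} {r : ℕ}
    {u : Fin r → Fin D.n → ℤ} (hu : ∀ i, u i ≠ 0) : 0 ≤ size fun i => D.elt (u i) :=
  Finset.sum_nonneg fun i _ => by
    have := Real.logb_nonneg one_lt_two (D.one_le_house (hu i))
    linarith

/-- For `s ≥ 3` one has `log s ≥ 1`, so the additive constants are absorbed by the factor. -/
theorem lg_two_mul_le {c s : ℝ} (hc : 2 ≤ c) (hs : 3 ≤ s) {x : ℕ} (hx : 0 < x) (hxs : (x : ℝ) ≤ c * s) :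
    (lg (2 * x) : ℝ) ≤ (2 + Real.log c / Real.log 2 + 1 / Real.log 2) * Real.log s := by
  have h2 : 0 < Real.log 2 := Real.log_pos one_lt_two
  have hls : 1 ≤ Real.log s := by
    rw [Real.le_log_iff_exp_le (by linarith)]
    have := Real.exp_one_lt_d9
    linarith
  have h1 := lg_le_one_add (x := 2 * x)
  have h3 : Real.log ((2 * x : ℕ) : ℝ) ≤ Real.log 2 + Real.log c + Real.log s := by
    rw [← Real.log_mul (by norm_num) (by linarith), ← Real.log_mul (by positivity) (by linarith)]
    refine Real.log_le_log (by positivity) ?_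
    push_cast
    linarith
  have h4 := div_le_div_of_nonneg_right h3 h2.le
  rw [add_div, add_div, div_self h2.ne'] at h4
  have h5 : 0 ≤ Real.log c / Real.log 2 := div_nonneg (Real.log_nonneg (by linarith)) h2.le
  have h6 : Real.log c / Real.log 2 ≤ Real.log c / Real.log 2 * Real.log s :=
    le_mul_of_one_le_right h5 hls
  have h7 : Real.log s / Real.log 2 = 1 / Real.log 2 * Real.log s := by ring
  linarith

end CrtRoot
end

/-! ### The main theorem -/

theorem mainTheorem4 (ε c : ℝ) (hε : 0 < ε) :
    ∃ C : ℝ, 0 < C ∧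
      ∀ (K : Type*) [Field K] [NumberField K] (D : CrtRoot.OrderData K),
      ∃ s₀ : ℝ, 1 ≤ s₀ ∧
      ∀ (M : CrtRoot.MulCost), M.Fast c ε →
      ∀ (ℓ m e : ℕ), ℓ.Prime → 0 < m → e = ℓ ^ m →
      ∀ (r : ℕ), 0 < r →
      ∀ (u : Fin r → Fin D.n → ℤ) (a : Fin r → ℕ) (b : Fin r → ℕ),
        (∀ i, u i ≠ 0) → (∀ i, a i < e) →
        (∀ i, NumberField.house (D.elt (u i)) ≤ b i) →
        (∃ x : K, x ^ e = ∏ i, D.elt (u i) ^ a i) →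
      ∀ (k κ : ℕ) (q : Fin k → ℕ) [∀ j, Fact (q j).Prime],
        Function.Injective q →
        (∀ j, CrtRoot.GoodPrime D ℓ (q j)) →
        2 * (CrtRoot.boundB M D b).val < ∏ j, (q j : ℤ) →
        κ = Finset.univ.sup (fun j => CrtRoot.len (q j)) →
        (k : ℝ) * κ ≤ c * (s₀ + CrtRoot.size (fun i => D.elt (u i))) →
        (∀ (N : ℕ) (τ : CrtRoot.Tape D.n N q) (z : Fin D.n → ℤ),
          (CrtRoot.doubleCRT M D e a u b q τ).val = some z →
            D.out z ^ e = ∏ i, D.elt (u i) ^ a i) ∧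
        Filter.Tendsto (fun N => CrtRoot.successProb M D e a u b q N) Filter.atTop (nhds 1) ∧
        ∀ (s : ℝ), s = s₀ + CrtRoot.size (fun i => D.elt (u i)) →
        ∀ N : ℕ, CrtRoot.expTime M D e a u b q N ≤
          C * (r * D.n * s * (M.P D.n κ + Real.log s ^ (2 + ε) + Real.log e)) := by
  obtain ⟨A, hA, hlg⟩ := CrtRoot.exists_lg_rpow_le hε
  by_cases hc : 2 ≤ c
  swap
  -- For `c < 2` no prices satisfy the assumptions.
  · exact ⟨1, one_pos, fun K _ _ D => ⟨1, le_rfl, fun M hM => absurd hM.two_le hc⟩⟩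
  have hA0 : 0 < A := by linarith
  have hc0 : 0 < c := by linarith
  set c₂ := 2 + Real.log c / Real.log 2 + 1 / Real.log 2 with hc₂
  have hc₂0 : 0 ≤ c₂ := by
    have h1 : 0 < Real.log 2 := Real.log_pos one_lt_two
    have h2 : 0 ≤ Real.log c := Real.log_nonneg (by linarith)
    positivity
  -- The three summands belong to the terms `M.P D.n κ`, `log e` and `log s ^ (2 + ε)`. The factor
  -- `2 * c + 1` bounds `k (κ + X) / s`, and `9 = 3 * 3` combines the coefficient of `E` with the
  -- length of `e` in terms of `log e`.
  refine ⟨c * A * (172 * (2 * c + 1)) + c * A * (9 * c) + 35 * (c * c * c₂ ^ (2 + ε)),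
    by positivity, fun K _ _ D => ?_⟩
  obtain ⟨X, hX⟩ := CrtRoot.exists_dataLen D
  -- The `3` ensures `log s ≥ 1`, and `X * 2 ^ X` is the constant of `mul_le_of_injective`.
  refine ⟨3 + (X * 2 ^ X : ℕ), by
    have : (0 : ℝ) ≤ (X * 2 ^ X : ℕ) := Nat.cast_nonneg _
    linarith, ?_⟩
  rintro M hM ℓ m e hℓ hm rfl r hr u a b hu ha hb ⟨x, hx⟩ k κ q _ hinj hg hQ hκ hkκ
  have hT := hM.tame hA hlg
  have he : 0 < ℓ ^ m := pow_pos hℓ.pos m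
  have hB := CrtRoot.boundB_pos (M := M) he hu ha hb hx
  have hk : 0 < k := by
    by_contra hk
    obtain rfl : k = 0 := by omega
    simp only [Finset.univ_eq_empty, Finset.prod_empty] at hQ
    omega
  have hκ' : ∀ j, CrtRoot.len (q j : ℤ) ≤ κ := fun j => by
    rw [hκ]
    exact Finset.le_sup (f := fun j => CrtRoot.len (q j : ℤ)) (Finset.mem_univ j)
  have hκ1 : 0 < κ := (CrtRoot.one_le_len _).trans (hκ' ⟨0, hk⟩)
  have hroot : 2 * (CrtRoot.boundB M D b).val < ((CrtRoot.treeOf M q).root : ℤ) := by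
    rwa [CrtRoot.treeOf_root hT hk]
  -- The combination tree handles numbers of length up to `2 * (k * κ)`, so the price per digit `Λ`
  -- has to be valid up to this length.
  set L : ℝ := (CrtRoot.lg (2 * (k * κ)) : ℝ) with hL
  have hL1 : 1 ≤ L := Nat.one_le_cast.2 (CrtRoot.one_le_lg _)
  set Λ : ℝ := c * L ^ (1 + ε) with hΛdef
  have hΛ : 1 ≤ Λ := by
    have := Real.one_le_rpow hL1 (show 0 ≤ 1 + ε by linarith)
    nlinarith
  have hZ : ∀ y ≤ 2 * (k * κ), M.Z y ≤ Λ * y := by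
    intro y hy
    refine (hM.1 y).trans ?_
    have h1 : (CrtRoot.lg y : ℝ) ≤ L := Nat.cast_le.2 (CrtRoot.lg_mono hy)
    have h2 : (CrtRoot.lg y : ℝ) ^ (1 + ε) ≤ L ^ (1 + ε) :=
      Real.rpow_le_rpow (Nat.cast_nonneg _) h1 (by linarith)
    calc c * y * (CrtRoot.lg y : ℝ) ^ (1 + ε) ≤ c * y * L ^ (1 + ε) := by gcongr
      _ = Λ * y := by rw [hΛdef]; ring
  have hE : ∀ i, CrtRoot.len (a i : ℤ) ≤ CrtRoot.len ((ℓ ^ m : ℕ) : ℤ) := fun i =>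
    CrtRoot.len_natCast_mono (ha i).le
  have hbound := CrtRoot.expTime_le hT hk hr hκ' hΛ hZ hℓ hg hb hB hQ hX hE le_rfl
  refine ⟨fun N τ z hz => ?_, CrtRoot.tendsto_successProb hroot hbound, ?_⟩
  · rw [CrtRoot.doubleCRT_correct hT hk hℓ hu ha hb hx hinj hg hQ hz, hx]
  rintro s rfl N
  set s := 3 + ((X * 2 ^ X : ℕ) : ℝ) + CrtRoot.size fun i => D.elt (u i) with hs
  have hsize := CrtRoot.size_nonneg hu
  have hX0 : (0 : ℝ) ≤ (X * 2 ^ X : ℕ) := Nat.cast_nonneg _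
  have hs3 : 3 ≤ s := by linarith
  refine (hbound N).trans ?_
  set W := M.P D.n κ with hW
  have hW0 : 0 ≤ W := M.P_nonneg _ _
  set ρ : ℝ := r * D.n with hρ
  have hρ0 : 0 ≤ ρ := by positivity
  have hkX : (k : ℝ) * (κ + X) ≤ (2 * c + 1) * s := by
    have h1 : (k : ℝ) * X ≤ k * κ + (X * 2 ^ X : ℕ) := by
      exact_mod_cast CrtRoot.mul_le_of_injective (X := X) hinj hκ'
    linarith
  have he2 : 2 ≤ ℓ ^ m := hℓ.two_le.trans (Nat.le_self_pow hm.ne' ℓ)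
  have hlen := CrtRoot.len_le_three_mul_log he2
  have hloge : 0 ≤ Real.log ((ℓ ^ m : ℕ) : ℝ) := Real.log_natCast_nonneg _
  set le := Real.log ((ℓ ^ m : ℕ) : ℝ) with hle
  have hls : 0 ≤ Real.log s := Real.log_nonneg (by linarith)
  have b1 : (k : ℝ) * (κ + X) * W ≤ (2 * c + 1) * s * W := mul_le_mul_of_nonneg_right hkX hW0
  have b2 : (k : ℝ) * κ * CrtRoot.len ((ℓ ^ m : ℕ) : ℤ) ≤ c * s * (3 * le) :=
    mul_le_mul hkκ hlen (Nat.cast_nonneg _) (by positivity)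
  have b3 : Λ * (k * κ : ℕ) * CrtRoot.lg (k * κ) ≤
      c * c * c₂ ^ (2 + ε) * (s * Real.log s ^ (2 + ε)) := by
    have hkκ' : ((k * κ : ℕ) : ℝ) ≤ c * s := by push_cast; exact hkκ
    have h1 : (CrtRoot.lg (k * κ) : ℝ) ≤ L :=
      Nat.cast_le.2 (CrtRoot.lg_mono (Nat.le_mul_of_pos_left _ two_pos))
    have h2 : L ≤ c₂ * Real.log s := CrtRoot.lg_two_mul_le hc hs3 (Nat.mul_pos hk hκ1) hkκ'
    have h3 : L ^ (2 + ε) ≤ c₂ ^ (2 + ε) * Real.log s ^ (2 + ε) := by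
      rw [← Real.mul_rpow hc₂0 hls]
      exact Real.rpow_le_rpow (by linarith) h2 (by linarith)
    have hL0 : 0 < L := by linarith
    have h4 : L ^ (1 + ε) * L = L ^ (2 + ε) := by
      rw [← Real.rpow_add_one hL0.ne']; ring_nf
    calc Λ * (k * κ : ℕ) * CrtRoot.lg (k * κ) ≤ Λ * (c * s) * L := by
          refine mul_le_mul (mul_le_mul_of_nonneg_left hkκ' (by linarith)) h1 (Nat.cast_nonneg _) ?_
          positivity
      _ = c * c * s * L ^ (2 + ε) := by rw [hΛdef, ← h4]; ring
      _ ≤ c * c * s * (c₂ ^ (2 + ε) * Real.log s ^ (2 + ε)) :=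
          mul_le_mul_of_nonneg_left h3 (by positivity)
      _ = _ := by ring
  set LL := Real.log s ^ (2 + ε) with hLL
  have hLL0 : 0 ≤ LL := Real.rpow_nonneg hls _
  have c1 := mul_le_mul_of_nonneg_left b1 (show 0 ≤ ρ * (c * A) * 172 by positivity)
  have c2 := mul_le_mul_of_nonneg_left b2 (show 0 ≤ ρ * (c * A) * 3 by positivity)
  have c3 := mul_le_mul_of_nonneg_left b3 (show 0 ≤ ρ * 35 by positivity)
  set p := c₂ ^ (2 + ε) with hp
  have hp0 : 0 ≤ p := Real.rpow_nonneg hc₂0 _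
  have hs0 : 0 ≤ s := by linarith
  have g1 : 0 ≤ c * A * (172 * (2 * c + 1)) * (ρ * s * (LL + le)) := by positivity
  have g2 : 0 ≤ c * A * (9 * c) * (ρ * s * (W + LL)) := by positivity
  have g3 : 0 ≤ 35 * (c * c * p) * (ρ * s * (W + le)) := by positivity
  linarith
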